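/- Let $\mathbb K$ be $\mathbb R$ or $\mathbb C$, let $M$ be a smooth (second countable, Hausdorff) manifold of dimension $m$, and let $A\to M$ be a $\mathbb K$-Lie algebroid of rank $n$ with bracket $[\cdot,\cdot]$, anchor $a$ (with values in $TM$, resp. $TM\otimes\mathbb C$) and differential $d$. Let $\Lambda\in\Gamma(\wedge^2A)$ satisfy $[[\Lambda,\Lambda],X]=0$ for all $X\in\Gamma(A)$ (Schouten bracket), and let $(A,A^*)$ be the corresponding exact Lie bialgebroid; that is, $A^*$ carries the bracket $$[\xi,\theta]_\Lambda=\mathcal L_{\Lambda^\sharp\xi}\theta-\mathcal L_{\Lambda^\sharp\theta}\xi-d(\Lambda(\xi,\theta))$$ and the anchor $a_*=a\circ\Lambda^\sharp$, where $\langle\Lambda^\sharp\xi,\theta\rangle=\Lambda(\xi,\theta)$. Let $\mathscr L$ be a line bundle over $M$ with an isomorphism $\mathscr L\otimes\mathscr L\cong\wedge^nA^*\otimes\wedge^mT^*M$ (where $\wedge^mT^*M$ is complexified if $\mathbb K=\mathbb C$), and put $\mathscr L'=\wedge^nA\otimes\mathscr L$, so that $\mathscr L'\otimes\mathscr L'\cong\wedge^nA\otimes\wedge^mT^*M$.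 The natural map $\Phi:\Gamma(\wedge^kA\otimes\mathscr L)\to\Gamma(\wedge^{n-k}A^*\otimes\mathscr L')$, $\Phi(u)(X_1,\dots,X_{n-k})=X_1\wedge\cdots\wedge X_{n-k}\wedge u$, is an isomorphism. There is exactly one action of $A^*$ on $\mathscr L$ that induces on $\mathscr L\otimes\mathscr L$ the canonical action $\xi\cdot(s\otimes\mu)=[\xi,s]_\Lambda\otimes\mu+s\otimes\mathcal L_{a_*(\xi)}\mu$ of $A^*$ on $\wedge^nA^*\otimes\wedge^mT^*M$, and exactly one action of $A$ on $\mathscr L'$ that induces on $\mathscr L'\otimes\mathscr L'$ the canonical action $X\cdot(V\otimes\mu)=[X,V]\otimes\mu+V\otimes\mathcal L_{a(X)}\mu$ of $A$ on $\wedge^nA\otimes\wedge^mT^*M$. Let $\breve d_*:\Gamma(\wedge^kA\otimes\mathscr L)\to\Gamma(\wedge^{k+1}A\otimes\mathscr L)$ be the Chevalley--Eilenberg differential of $A^*$ with coefficients in $\mathscr L$, let $\breve d$ be the Chevalley--Eilenberg differential of $A$ with coefficients in $\mathscr L'$, and let $\breve\partial:\Gamma(\wedge^kA\otimes\mathscr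 L)\to\Gamma(\wedge^{k-1}A\otimes\mathscr L)$ be the operator with $$\Phi(\breve\partial u)=(-1)^{n-k}\,\breve d\,\Phi(u),\qquad u\in\Gamma(\wedge^kA\otimes\mathscr L).$$ Then the operator $\eth=\breve d_*+\breve\partial$ on $\Gamma(\wedge A\otimes\mathscr L)$ satisfies $\eth^2=0$. -/

import Mathlib

open scoped Manifold ContDiff TensorProduct

noncomputable section
namespace DiracGen

section Algebra
variable {R : Type*} [CommRing R] [Algebra ℝ R]

/-- An additive operator `δ` on an `R`-module `N` with `δ (f • x) = D f • x + f • δ x`, i.e. a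
derivation of the module `N` over the derivation `D` of `R`. -/
structure DerivOp (D : Derivation ℝ R R) (N : Type*) [AddCommGroup N] [Module R N] where
  toFun : N →+ N
  leibniz : ∀ (f : R) (x : N), toFun (f • x) = D f • x + f • toFun x

namespace DerivOp
variable {D : Derivation ℝ R R} {V N : Type*} [AddCommGroup V] [Module R V]
  [AddCommGroup N] [Module R N]

instance : CoeFun (DerivOp D N) (fun _ => N → N) := ⟨fun δ => δ.toFun⟩

/-- The derivation `D` itself, as an operator on `R`. -/
def fn (D : Derivation ℝ R R) : DerivOp D R where
  toFun := D.toLinearMap.toAddMonoidHom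
  leibniz f x := by simp [mul_comm, add_comm]

/-- The induced operator on `Hom(V, N)`: `(δφ)(v) = τ(φ v) - φ(δ v)`. -/
def hom (δ : DerivOp D V) (τ : DerivOp D N) : DerivOp D (V →ₗ[R] N) where
  toFun := AddMonoidHom.mk' (fun φ =>
    { toFun := fun v => τ (φ v) - φ (δ v)
      map_add' := fun v w => by simp only [map_add]; abel
      map_smul' := fun f v => by
        simp only [map_smul, leibniz, map_add, RingHom.id_apply, smul_sub]; abel })
    (fun φ ψ => by
      ext v
      simp only [LinearMap.add_apply, map_add, LinearMap.coe_mk, AddHom.coe_mk]; abel)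
  leibniz f φ := by
    ext v
    simp only [AddMonoidHom.mk'_apply, LinearMap.add_apply, LinearMap.smul_apply,
      LinearMap.coe_mk, AddHom.coe_mk, leibniz, smul_sub]
    abel

theorem alt_aux_add (δ : DerivOp D V) {k : ℕ} (θ : V [⋀^Fin k]→ₗ[R] N) (v : Fin k → V)
    (i : Fin k) (x y : V) :
    ∑ l, θ (Function.update (Function.update v i (x + y)) l
        (δ (Function.update v i (x + y) l))) =
      ∑ l, θ (Function.update (Function.update v i x) l (δ (Function.update v i x l))) +
      ∑ l, θ (Function.update (Function.update v i y) l (δ (Function.update v i y l))) := by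
  rw [← Finset.sum_add_distrib]
  refine Finset.sum_congr rfl fun l _ => ?_
  by_cases h : l = i
  · subst h; simp
  · simp only [Function.update_of_ne h, Function.update_comm (Ne.symm h)]
    simp

theorem alt_aux_smul (δ : DerivOp D V) {k : ℕ} (θ : V [⋀^Fin k]→ₗ[R] N) (v : Fin k → V)
    (i : Fin k) (f : R) (x : V) :
    ∑ l, θ (Function.update (Function.update v i (f • x)) l
        (δ (Function.update v i (f • x) l))) =
      D f • θ (Function.update v i x) +
      f • ∑ l, θ (Function.update (Function.update v i x) l (δ (Function.update v i x l))) := by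
  have h : ∀ l, θ (Function.update (Function.update v i (f • x)) l
        (δ (Function.update v i (f • x) l))) =
      (if l = i then D f • θ (Function.update v i x) else 0) +
      f • θ (Function.update (Function.update v i x) l (δ (Function.update v i x l))) := by
    intro l
    by_cases h : l = i
    · subst h; simp [leibniz]
    · simp only [Function.update_of_ne h, Function.update_comm (Ne.symm h), if_neg h, zero_add]
      simp
  simp only [h, Finset.sum_add_distrib, Finset.smul_sum]
  simp

theorem alt_aux_eq (δ : DerivOp D V) {k : ℕ} (θ : V [⋀^Fin k]→ₗ[R] N) (v : Fin k → V)
    (i j : Fin k) (hv : v i = v j) (hij : i ≠ j) :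
    ∑ l, θ (Function.update v l (δ (v l))) = 0 := by
  rw [Fintype.sum_eq_add i j hij]
  · have : Function.update v j (δ (v j)) = Function.update v i (δ (v i)) ∘ Equiv.swap i j := by
      ext l
      by_cases h1 : l = i
      · subst h1; simp [hij, hij.symm, hv]
      by_cases h2 : l = j
      · subst h2; simp [hv]
      · simp [Equiv.swap_apply_of_ne_of_ne h1 h2, h1, h2]
    rw [this, AlternatingMap.map_swap _ _ hij, add_neg_cancel]
  · rintro l ⟨h1, h2⟩
    exact θ.map_eq_zero_of_eq _ (by simpa [h1.symm, h2.symm] using hv) hij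

/-- The induced operator on alternating `k`-forms:
`(δθ)(v₁,…,v_k) = τ(θ(v₁,…,v_k)) - ∑ θ(v₁,…,δ v_l,…,v_k)`. -/
def alt (δ : DerivOp D V) (τ : DerivOp D N) (k : ℕ) : DerivOp D (V [⋀^Fin k]→ₗ[R] N) where
  toFun := AddMonoidHom.mk' (fun θ =>
    { toFun := fun v => τ (θ v) - ∑ l, θ (Function.update v l (δ (v l)))
      map_update_add' := fun {inst} v i x y => by
        rw [Subsingleton.elim inst (instDecidableEqFin k), alt_aux_add, θ.map_update_add, map_add]
        abel
      map_update_smul' := fun {inst} v i f x => by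
        rw [Subsingleton.elim inst (instDecidableEqFin k), alt_aux_smul, θ.map_update_smul,
          leibniz, smul_sub]
        abel
      map_eq_zero_of_eq' := fun v i j hv hij => by
        rw [alt_aux_eq δ θ v i j hv hij, θ.map_eq_zero_of_eq v hv hij, map_zero, sub_zero] })
    (fun θ η => by
      ext v
      simp only [AlternatingMap.add_apply, map_add, AlternatingMap.coe_mk, MultilinearMap.coe_mk,
        Finset.sum_add_distrib]
      abel)
  leibniz f θ := by
    ext v
    simp only [AddMonoidHom.mk'_apply, AlternatingMap.add_apply, AlternatingMap.smul_apply,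
      AlternatingMap.coe_mk, MultilinearMap.coe_mk, leibniz, smul_sub, Finset.smul_sum]
    abel

@[simp] theorem alt_apply (δ : DerivOp D V) (τ : DerivOp D N) {k : ℕ} (θ : V [⋀^Fin k]→ₗ[R] N)
    (v : Fin k → V) :
    δ.alt τ k θ v = τ (θ v) - ∑ l, θ (Function.update v l (δ (v l))) := rfl

end DerivOp

theorem update_vecCons_succ {Γ : Type*} {k : ℕ} (x : Γ) (Y : Fin k → Γ) (l : Fin k) (z : Γ) :
    Function.update (Matrix.vecCons x Y) l.succ z = Matrix.vecCons x (Function.update Y l z) := by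
  funext j
  refine Fin.cases ?_ (fun j => ?_) j
  · rw [Function.update_of_ne (Fin.succ_ne_zero l).symm]; rfl
  · by_cases h : j = l
    · subst h; simp
    · simp [Function.update_of_ne, h]

variable (R) in
/-- An anchor and a skew-symmetric bracket that satisfy the Leibniz rule. The algebra `R` is the
algebra of smooth functions and `Γ` the module of sections; derivations of `R` are vector fields.
The bracket is assumed additive; `ℝ`-bilinearity follows from the Leibniz rule. The Jacobi identity
is not required here, so that differentials can be written down before it is established. -/
structure SkewAlgebroid (Γ : Type*) [AddCommGroup Γ] [Module R Γ] where
  anchor : Γ →ₗ[R] Derivation ℝ R R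
  bracket : Γ →+ Γ →+ Γ
  bracket_self : ∀ X, bracket X X = 0
  bracket_smul : ∀ (X Y : Γ) (f : R), bracket X (f • Y) = anchor X f • Y + f • bracket X Y

variable (R) in
/-- A Lie algebroid: the bracket satisfies the Jacobi identity and the anchor is a morphism. -/
structure LieAlgebroid (Γ : Type*) [AddCommGroup Γ] [Module R Γ]
    extends SkewAlgebroid R Γ where
  jacobi : ∀ X Y Z, bracket X (bracket Y Z) = bracket (bracket X Y) Z + bracket Y (bracket X Z)
  anchor_bracket : ∀ X Y, anchor (bracket X Y) = ⁅anchor X, anchor Y⁆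

variable (R) in
/-- The tangent Lie algebroid: derivations of `R` with their commutator bracket. -/
def tangent : LieAlgebroid R (Derivation ℝ R R) where
  anchor := LinearMap.id
  bracket := AddMonoidHom.mk' (fun X => AddMonoidHom.mk' (fun Y => ⁅X, Y⁆) (lie_add X))
    (fun X Y => by ext1 Z; exact add_lie X Y Z)
  bracket_self X := lie_self X
  bracket_smul X Y f := by
    ext g
    simp [Derivation.commutator_apply]
    ring
  jacobi X Y Z := leibniz_lie X Y Z
  anchor_bracket _ _ := rfl

namespace SkewAlgebroid
variable {Γ : Type*} [AddCommGroup Γ] [Module R Γ] {N : Type*} [AddCommGroup N] [Module R N]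

/-- The operator `Y ↦ [X, Y]`. -/
def ad (S : SkewAlgebroid R Γ) (X : Γ) : DerivOp (S.anchor X) Γ where
  toFun := S.bracket X
  leibniz f Y := S.bracket_smul X Y f

/-- The Lie derivative on dual sections: `(L_X ξ)(Y) = a(X)(ξ(Y)) - ξ([X, Y])`. -/
def adDual (S : SkewAlgebroid R Γ) (X : Γ) : DerivOp (S.anchor X) (Module.Dual R Γ) :=
  (S.ad X).hom (DerivOp.fn _)

theorem bracket_skew (S : SkewAlgebroid R Γ) (X Y : Γ) : S.bracket X Y = - S.bracket Y X := by
  have h := S.bracket_self (X + Y)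
  simp only [map_add, AddMonoidHom.add_apply, S.bracket_self, zero_add, add_zero] at h
  exact eq_neg_of_add_eq_zero_right h

theorem bracket_smul_left (S : SkewAlgebroid R Γ) (X Y : Γ) (f : R) :
    S.bracket (f • X) Y = f • S.bracket X Y - S.anchor Y f • X := by
  rw [S.bracket_skew, S.bracket_smul, S.bracket_skew X Y, smul_neg]; abel

/-- The differential of a function: `(d f)(X) = a(X) f`. -/
def d₀ (S : SkewAlgebroid R Γ) (f : R) : Module.Dual R Γ where
  toFun X := S.anchor X f
  map_add' := by simp
  map_smul' := by simp

/-- An action (without the flatness condition) of `S` on the module `N`: an operator `act X` for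
each section `X`, with `act X (f • n) = (a(X) f) • n + f • act X n` and `act (f • X) = f • act X`. -/
@[ext]
structure Connection (S : SkewAlgebroid R Γ) (N : Type*) [AddCommGroup N] [Module R N] where
  act : (X : Γ) → DerivOp (S.anchor X) N
  add_left : ∀ X Y n, act (X + Y) n = act X n + act Y n
  smul_left : ∀ (f : R) X n, act (f • X) n = f • act X n

/-- The Chevalley--Eilenberg formula with coefficients in `N`:
`∑ᵢ (-1)ⁱ Xᵢ·θ(X₀,…,X̂ᵢ,…,X_k) + ∑_{i<j} (-1)^{i+j} θ([Xᵢ,Xⱼ],X₀,…,X̂ᵢ,…,X̂ⱼ,…,X_k)`. Here the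
bracket `[Xᵢ,Xⱼ]` is left in the place of `Xⱼ`; moving it to the front gives the usual sign.
The place `l` of the list without `Xᵢ` holds the section number `l + 1` exactly if `i ≤ l`. -/
def ceFun (S : SkewAlgebroid R Γ) (E : S.Connection N) {k : ℕ} (θ : Γ [⋀^Fin k]→ₗ[R] N)
    (X : Fin (k + 1) → Γ) : N :=
  ∑ i : Fin (k + 1), (-1 : ℤ) ^ (i : ℕ) • (E.act (X i) (θ (i.removeNth X)) -
    ∑ l : Fin k, if i ≤ l.castSucc then
      θ (Function.update (i.removeNth X) l (S.bracket (X i) (X l.succ))) else 0)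

theorem ceFun_succ (S : SkewAlgebroid R Γ) (E : S.Connection N) {k : ℕ}
    (θ : Γ [⋀^Fin (k + 1)]→ₗ[R] N) (x : Γ) (X : Fin (k + 1) → Γ) :
    S.ceFun E θ (Matrix.vecCons x X) = ((S.ad x).alt (E.act x) (k + 1) θ) X -
      S.ceFun E (θ.curryLeft x) X := by
  have key : ∀ (i : Fin (k + 1)),
      i.succ.removeNth (Matrix.vecCons x X : Fin (k + 2) → Γ) =
        Matrix.vecCons x (i.removeNth X) := by
    intro i; ext l
    refine Fin.cases ?_ (fun l => ?_) l
    · simp [Fin.removeNth]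
    · simp [Fin.removeNth]
  have key0 : (0 : Fin (k + 2)).removeNth (Matrix.vecCons x X : Fin (k + 2) → Γ) = X := by
    ext l; simp [Fin.removeNth]
  rw [ceFun, Fin.sum_univ_succ]
  refine (congrArg₂ (· + ·) ?_ ?_).trans (sub_eq_add_neg _ _).symm
  · simp [ad, key0]
  · rw [ceFun, ← Finset.sum_neg_distrib]
    refine Finset.sum_congr rfl fun i _ => ?_
    rw [key, Fin.val_succ, pow_succ, mul_neg_one, neg_smul, Fin.sum_univ_succ]
    congr 3
    simp only [Matrix.cons_val_succ]
    rw [if_neg (by simp), zero_add]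
    refine Finset.sum_congr rfl fun l _ => ?_
    have : (i.succ ≤ l.succ.castSucc) ↔ i ≤ l.castSucc := by simp
    simp only [this, AlternatingMap.curryLeft_apply_apply, update_vecCons_succ]

theorem ceFun_add (S : SkewAlgebroid R Γ) (E : S.Connection N) {k : ℕ}
    (θ η : Γ [⋀^Fin k]→ₗ[R] N) (X : Fin (k + 1) → Γ) :
    S.ceFun E (θ + η) X = S.ceFun E θ X + S.ceFun E η X := by
  simp only [ceFun, ← Finset.sum_add_distrib, ← smul_add]
  refine Finset.sum_congr rfl fun i _ => ?_
  congr 1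
  have h : ∀ (p : Prop) [Decidable p] (u v : N), (if p then u + v else 0) =
      (if p then u else 0) + (if p then v else 0) := by
    intro p _ u v; split_ifs <;> simp
  simp only [AlternatingMap.add_apply, map_add, h, Finset.sum_add_distrib]
  abel

theorem alt_ad_self (S : SkewAlgebroid R Γ) (E : S.Connection N) : ∀ {k : ℕ}
    (θ : Γ [⋀^Fin (k + 1)]→ₗ[R] N) (x : Γ) (Y : Fin k → Γ),
    (S.ad x).alt (E.act x) (k + 1) θ (Matrix.vecCons x Y) =
      S.ceFun E (θ.curryLeft x) (Matrix.vecCons x Y)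
  | 0, θ, x, Y => by
    have h1 : θ (Function.update (Matrix.vecCons x Y) 0 ((S.ad x) (Matrix.vecCons x Y 0))) = 0 :=
      θ.map_coord_zero 0 (by simp [ad, S.bracket_self])
    rw [DerivOp.alt_apply, Fin.sum_univ_succ, h1, ceFun, Fin.sum_univ_succ]
    have h2 : (0 : Fin (0 + 1)).removeNth (Matrix.vecCons x Y : Fin (0 + 1) → Γ) = Y :=
      Subsingleton.elim _ _
    rw [h2]
    simp
  | k + 1, θ, x, Y => by
    have h0 : S.ceFun E (0 : Γ [⋀^Fin k]→ₗ[R] N) Y = 0 := by simp [ceFun]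
    rw [ceFun_succ, AlternatingMap.curryLeft_same, h0, sub_zero]
    simp only [DerivOp.alt_apply, AlternatingMap.curryLeft_apply_apply]
    rw [Fin.sum_univ_succ]
    have h1 : θ (Function.update (Matrix.vecCons x Y) 0 ((S.ad x) (Matrix.vecCons x Y 0))) = 0 :=
      θ.map_coord_zero 0 (by simp [ad, S.bracket_self])
    rw [h1, zero_add]
    congr 1
    refine Finset.sum_congr rfl fun l _ => ?_
    rw [update_vecCons_succ, Matrix.cons_val_succ]

theorem exists_ce (S : SkewAlgebroid R Γ) (E : S.Connection N) : ∀ {k : ℕ}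
    (θ : Γ [⋀^Fin k]→ₗ[R] N), ∃ η : Γ [⋀^Fin (k + 1)]→ₗ[R] N, ∀ X, η X = S.ceFun E θ X
  | 0, θ => by
    refine ⟨AlternatingMap.ofSubsingleton R Γ N (0 : Fin 1)
      { toFun := fun x => E.act x (θ ![])
        map_add' := fun x y => E.add_left x y _
        map_smul' := fun f x => E.smul_left f x _ }, fun X => ?_⟩
    simp [ceFun]
    congr 2
    exact Subsingleton.elim _ _
  | k + 1, θ => by
    choose d hd using fun x => exists_ce S E (θ.curryLeft x)
    set T : Γ → Γ [⋀^Fin (k + 1)]→ₗ[R] N := fun x => (S.ad x).alt (E.act x) (k + 1) θ - d x with hT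
    have T_apply : ∀ x X, T x X = S.ceFun E θ (Matrix.vecCons x X) := by
      intro x X
      rw [ceFun_succ, hT, AlternatingMap.sub_apply, hd]
    have T_add : ∀ x y, T (x + y) = T x + T y := by
      intro x y
      ext X
      simp only [hT, AlternatingMap.sub_apply, AlternatingMap.add_apply, hd, map_add, ceFun_add]
      simp only [DerivOp.alt_apply, E.add_left, ad, map_add, AddMonoidHom.add_apply,
        AlternatingMap.map_update_add, Finset.sum_add_distrib]
      abel
    have T_self : ∀ x (Y : Fin k → Γ), T x (Matrix.vecCons x Y) = 0 := by
      intro x Y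
      simp only [hT, AlternatingMap.sub_apply, hd, alt_ad_self, sub_self]
    have T_swap : ∀ x y (Y : Fin k → Γ), T x (Matrix.vecCons y Y) = - T y (Matrix.vecCons x Y) := by
      intro x y Y
      have h := T_self (x + y) Y
      rw [T_add, AlternatingMap.add_apply, AlternatingMap.map_vecCons_add,
        AlternatingMap.map_vecCons_add, T_self, T_self, zero_add, add_zero] at h
      exact eq_neg_of_add_eq_zero_left h
    have cons_eta : ∀ X : Fin (k + 1) → Γ, X = Matrix.vecCons (X 0) (Fin.tail X) :=
      fun X => (Fin.cons_self_tail X).symm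
    have T_smul : ∀ (f : R) x, T (f • x) = f • T x := by
      intro f x
      ext X
      rw [cons_eta X, AlternatingMap.smul_apply, T_swap, AlternatingMap.map_vecCons_smul,
        T_swap x, smul_neg]
    let T' : Γ →ₗ[R] Γ [⋀^Fin (k + 1)]→ₗ[R] N :=
      { toFun := T, map_add' := T_add, map_smul' := T_smul }
    let m : MultilinearMap R (fun _ : Fin (k + 2) => Γ) N :=
      LinearMap.uncurryLeft (M := fun _ : Fin (k + 2) => Γ) (AlternatingMap.toMultilinearMapLM (S := R) ∘ₗ T')
    have m_apply : ∀ X, m X = T (X 0) (Fin.tail X) := fun X => rfl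
    have T_tail : ∀ x (X : Fin (k + 1) → Γ) j, X j = x → T x X = 0 := by
      intro x X j hj
      by_cases h : j = 0
      · subst h
        rw [cons_eta X, hj, T_self]
      · have := (T x).map_swap X (i := 0) (j := j) (Ne.symm h)
        rw [cons_eta (X ∘ _)] at this
        simp only [Function.comp_apply, Equiv.swap_apply_left, hj, T_self] at this
        exact neg_eq_zero.mp this.symm
    refine ⟨{ m with map_eq_zero_of_eq' := fun X i j hX hij => ?_ }, fun X => ?_⟩
    · change m X = 0
      rw [m_apply]
      revert hX hij
      refine Fin.cases ?_ (fun i => ?_) i <;> refine Fin.cases ?_ (fun j => ?_) j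
      · intro _ h; exact absurd rfl h
      · intro h _; exact T_tail _ _ j h.symm
      · intro h _; exact T_tail _ _ i h
      · intro h hij
        exact (T (X 0)).map_eq_zero_of_eq _ h (fun e => hij (by rw [e]))
    · change m X = _
      rw [m_apply, T_apply]
      congr 1
      exact Fin.cons_self_tail X

/-- The Chevalley--Eilenberg differential as a map from `k`-forms to `(k + 1)`-forms. -/
def ce (S : SkewAlgebroid R Γ) (E : S.Connection N) {k : ℕ} (θ : Γ [⋀^Fin k]→ₗ[R] N) :
    Γ [⋀^Fin (k + 1)]→ₗ[R] N where
  toFun := S.ceFun E θ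
  map_update_add' X i x y := by
    obtain ⟨η, h⟩ := S.exists_ce E θ
    simp only [← h]; exact η.toMultilinearMap.map_update_add' X i x y
  map_update_smul' X i f x := by
    obtain ⟨η, h⟩ := S.exists_ce E θ
    simp only [← h]; exact η.toMultilinearMap.map_update_smul' X i f x
  map_eq_zero_of_eq' X i j hX hij := by
    obtain ⟨η, h⟩ := S.exists_ce E θ
    rw [← h]; exact η.map_eq_zero_of_eq X hX hij

end SkewAlgebroid

end Algebra

section Total
variable (R : Type*) [CommRing R]

/-- Inhomogeneous alternating forms on `V` with values in `N`. With `V = Γ(A)` these are the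
sections of `∧A* ⊗ L` for `N = Γ(L)`; with `V = Γ(A*)` those of `∧A ⊗ L`. For a bundle of finite
rank the components above the rank vanish, so the product over `k` is the direct sum. -/
abbrev Forms (V N : Type*) [AddCommGroup V] [Module R V] [AddCommGroup N] [Module R N] :=
  ∀ k : ℕ, V [⋀^Fin k]→ₗ[R] N

variable {R}
variable {Γ : Type*} [AddCommGroup Γ] [Module R Γ] {N : Type*} [AddCommGroup N] [Module R N]

/-- Exterior multiplication `a ↦ X ∧ a` from degree `k` to degree `k + 1`, where a section of
`∧ᵏA ⊗ L` is an alternating form on `Γ(A*)`. -/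
def wedgeAux (X : Γ) {k : ℕ} :
    (Module.Dual R Γ [⋀^Fin k]→ₗ[R] N) →ₗ[R] Module.Dual R Γ [⋀^Fin (k + 1)]→ₗ[R] N :=
  AlternatingMap.alternatizeUncurryFinLM ∘ₗ LinearMap.smulRightₗ (Module.Dual.eval R Γ X)

theorem wedgeAux_apply (X : Γ) {k : ℕ} (a : Module.Dual R Γ [⋀^Fin k]→ₗ[R] N)
    (ξ : Fin (k + 1) → Module.Dual R Γ) :
    wedgeAux X a ξ = ∑ i : Fin (k + 1), (-1 : ℤ) ^ (i : ℕ) • (ξ i X • a (i.removeNth ξ)) := by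
  simp [wedgeAux, AlternatingMap.alternatizeUncurryFin_apply]

theorem wedgeAux_wedgeAux (X : Γ) {k : ℕ} (a : Module.Dual R Γ [⋀^Fin k]→ₗ[R] N) :
    wedgeAux X (wedgeAux X a) = 0 := by
  have h := AlternatingMap.alternatizeUncurryFin_alternatizeUncurryFinLM_comp_of_symmetric
    (f := (Module.Dual.eval R Γ X).smulRight ((Module.Dual.eval R Γ X).smulRight a))
    (fun ξ η => by
      ext v
      simp only [LinearMap.smulRight_apply, LinearMap.smul_apply, AlternatingMap.smul_apply,
        smul_smul, mul_comm])
  rw [← h]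
  simp only [wedgeAux, LinearMap.comp_apply, AlternatingMap.alternatizeUncurryFinLM_apply]
  congr 1
  ext ξ : 1
  simp

/-- Exterior multiplication by `X` on the total space. -/
def wedge : Γ →ₗ[R] Module.End R (Forms R (Module.Dual R Γ) N) where
  toFun X := LinearMap.pi fun k => match k with
    | 0 => 0
    | k + 1 => wedgeAux X ∘ₗ LinearMap.proj k
  map_add' X Y := by
    refine LinearMap.ext fun a => funext fun k => ?_
    cases k with
    | zero => simp
    | succ k =>
      ext ξ
      simp [wedgeAux_apply, add_smul, Finset.sum_add_distrib]
  map_smul' f X := by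
    refine LinearMap.ext fun a => funext fun k => ?_
    cases k with
    | zero => simp
    | succ k =>
      ext ξ
      simp only [LinearMap.pi_apply, LinearMap.comp_apply, LinearMap.proj_apply, wedgeAux_apply,
        RingHom.id_apply, LinearMap.smul_apply, Pi.smul_apply, AlternatingMap.smul_apply,
        Finset.smul_sum, map_smul, smul_eq_mul, mul_smul]
      refine Finset.sum_congr rfl fun i _ => ?_
      rw [smul_comm ((-1 : ℤ) ^ (i : ℕ)) f]

theorem wedge_wedge (X : Γ) :
    (wedge X * wedge X : Module.End R (Forms R (Module.Dual R Γ) N)) = 0 := by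
  refine LinearMap.ext fun a => funext fun k => ?_
  rcases k with _ | _ | k
  · rfl
  · change wedgeAux X 0 = 0
    simp
  · exact wedgeAux_wedgeAux X (a k)

/-- Exterior multiplication by elements of the exterior algebra. -/
def wedgeAction : ExteriorAlgebra R Γ →ₐ[R] Module.End R (Forms R (Module.Dual R Γ) N) :=
  ExteriorAlgebra.lift R ⟨wedge, wedge_wedge⟩

/-- The isomorphism `∧A ⊗ L → ∧A* ⊗ (∧ⁿA ⊗ L)` with `n` the rank of `A`, given by
`(starMap n a)(X₁,…,X_j) = X₁ ∧ … ∧ X_j ∧ a` (the component of degree `n`); it sends `∧ᵏA ⊗ L` to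
`∧ⁿ⁻ᵏA* ⊗ (∧ⁿA ⊗ L)`. -/
def starMap (n : ℕ) (a : Forms R (Module.Dual R Γ) N) :
    Forms R Γ (Module.Dual R Γ [⋀^Fin n]→ₗ[R] N) := fun j =>
  (LinearMap.proj n ∘ₗ LinearMap.applyₗ a ∘ₗ (wedgeAction (N := N)).toLinearMap).compAlternatingMap
    (ExteriorAlgebra.ιMulti R j)

end Total

section Dirac
variable {R : Type*} [CommRing R] [Algebra ℝ R]
variable {Γ : Type*} [AddCommGroup Γ] [Module R Γ] {N : Type*} [AddCommGroup N] [Module R N]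

/-- The Chevalley--Eilenberg differential on the total space. -/
def SkewAlgebroid.d (S : SkewAlgebroid R Γ) (E : S.Connection N) (θ : Forms R Γ N) : Forms R Γ N
  | 0 => 0
  | k + 1 => S.ce E (θ k)

/-- The Chevalley--Eilenberg differential multiplied by `(-1)ʲ` on forms of degree `j`. -/
def SkewAlgebroid.dSigned (S : SkewAlgebroid R Γ) (E : S.Connection N) (θ : Forms R Γ N) :
    Forms R Γ N
  | 0 => 0
  | k + 1 => (-1 : ℤ) ^ k • S.ce E (θ k)

variable (R Γ) in
/-- A section `Λ` of `∧²A`, given by the skew-symmetric map `Λ♯ : Γ(A*) → Γ(A)`. -/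
structure Bivector where
  sharp : Module.Dual R Γ →ₗ[R] Γ
  sharp_self : ∀ ξ : Module.Dual R Γ, ξ (sharp ξ) = 0

/-- The value `Λ(ξ, θ) = ⟨θ, Λ♯ ξ⟩`. -/
def Bivector.toFun (Λ : Bivector R Γ) (ξ θ : Module.Dual R Γ) : R := θ (Λ.sharp ξ)

theorem Bivector.toFun_skew (Λ : Bivector R Γ) (ξ θ : Module.Dual R Γ) :
    Λ.toFun ξ θ = - Λ.toFun θ ξ := by
  have h := Λ.sharp_self (ξ + θ)
  simp only [map_add, LinearMap.add_apply, Λ.sharp_self, zero_add, add_zero] at h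
  exact eq_neg_of_add_eq_zero_left h

/-- The decomposable bivector `X ∧ Y`. -/
def Bivector.wedge (X Y : Γ) : Bivector R Γ where
  sharp := (Module.Dual.eval R Γ X).smulRight Y - (Module.Dual.eval R Γ Y).smulRight X
  sharp_self ξ := by simp [mul_comm]

/-- The bracket `[ξ, θ] = L_{Λ♯ξ} θ - L_{Λ♯θ} ξ - d(Λ(ξ, θ))` of dual sections. -/
def Bivector.bracketAux (S : SkewAlgebroid R Γ) (Λ : Bivector R Γ) (ξ θ : Module.Dual R Γ) :
    Module.Dual R Γ :=
  S.adDual (Λ.sharp ξ) θ - S.adDual (Λ.sharp θ) ξ - S.d₀ (Λ.toFun ξ θ)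

theorem adDual_apply (S : SkewAlgebroid R Γ) (X Y : Γ) (ξ : Module.Dual R Γ) :
    S.adDual X ξ Y = S.anchor X (ξ Y) - ξ (S.bracket X Y) := rfl

theorem Bivector.bracketAux_apply (S : SkewAlgebroid R Γ) (Λ : Bivector R Γ)
    (ξ θ : Module.Dual R Γ) (Y : Γ) :
    Λ.bracketAux S ξ θ Y = (S.anchor (Λ.sharp ξ) (θ Y) - θ (S.bracket (Λ.sharp ξ) Y)) -
      (S.anchor (Λ.sharp θ) (ξ Y) - ξ (S.bracket (Λ.sharp θ) Y)) -
      S.anchor Y (θ (Λ.sharp ξ)) := rfl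

/-- The structure on `A*` induced by `Λ`: the above bracket, with anchor `a ∘ Λ♯`. -/
def SkewAlgebroid.dualOf (S : SkewAlgebroid R Γ) (Λ : Bivector R Γ) :
    SkewAlgebroid R (Module.Dual R Γ) where
  anchor := S.anchor ∘ₗ Λ.sharp
  bracket := AddMonoidHom.mk' (fun ξ => AddMonoidHom.mk' (Λ.bracketAux S ξ)
      (fun θ η => by
        ext Y
        simp only [LinearMap.add_apply, Bivector.bracketAux_apply, map_add, AddMonoidHom.add_apply,
          Derivation.add_apply]
        ring))
    (fun θ η => by
      ext ξ Y
      simp only [LinearMap.add_apply, Bivector.bracketAux_apply, map_add, AddMonoidHom.add_apply,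
          Derivation.add_apply, AddMonoidHom.mk'_apply]
      ring)
  bracket_self ξ := by
    ext Y
    simp [Bivector.bracketAux_apply, Λ.sharp_self]
  bracket_smul ξ θ f := by
    have h := Λ.toFun_skew ξ θ
    ext Y
    simp only [Bivector.toFun] at h
    simp only [LinearMap.add_apply, Bivector.bracketAux_apply, map_smul, AddMonoidHom.mk'_apply,
      LinearMap.smul_apply, smul_eq_mul, Derivation.leibniz, Derivation.smul_apply,
      S.bracket_smul_left, map_sub, LinearMap.comp_apply, h]
    simp only [map_neg]
    ring

/-- The Schouten bracket of two bivectors as a trilinear form on dual sections: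
`[P, Q](α, β, γ) = ∑_cyc ⟨L_{P♯α} β, Q♯γ⟩ + ⟨L_{Q♯α} β, P♯γ⟩`. The next fact shows that this is the
biderivation extending the bracket of sections. -/
def schouten (S : SkewAlgebroid R Γ) (P Q : Bivector R Γ) (α β γ : Module.Dual R Γ) : R :=
  (S.adDual (P.sharp α) β (Q.sharp γ) + S.adDual (Q.sharp α) β (P.sharp γ))
  + (S.adDual (P.sharp β) γ (Q.sharp α) + S.adDual (Q.sharp β) γ (P.sharp α))
  + (S.adDual (P.sharp γ) α (Q.sharp β) + S.adDual (Q.sharp γ) α (P.sharp β))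

/-- On decomposable bivectors, `[X₁∧X₂, Y₁∧Y₂] = ∑ (-1)^{i+j} [Xᵢ,Yⱼ] ∧ X_{i'} ∧ Y_{j'}`,
with `i'` and `j'` the complementary indices. -/
theorem schouten_wedge (S : SkewAlgebroid R Γ) (X₁ X₂ Y₁ Y₂ : Γ) (α β γ : Module.Dual R Γ) :
    let w (X Y Z : Γ) : R := Matrix.det !![α X, α Y, α Z; β X, β Y, β Z; γ X, γ Y, γ Z]
    schouten S (.wedge X₁ X₂) (.wedge Y₁ Y₂) α β γ =
    w (S.bracket X₁ Y₁) X₂ Y₂ - w (S.bracket X₁ Y₂) X₂ Y₁ - w (S.bracket X₂ Y₁) X₁ Y₂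
      + w (S.bracket X₂ Y₂) X₁ Y₁ := by
  intro w
  have e1 := S.bracket_skew Y₁ X₁
  have e2 := S.bracket_skew Y₁ X₂
  have e3 := S.bracket_skew Y₂ X₁
  have e4 := S.bracket_skew Y₂ X₂
  simp only [w, Matrix.det_fin_three, schouten, Bivector.wedge, adDual_apply,
    LinearMap.sub_apply, LinearMap.smulRight_apply, Module.Dual.eval_apply, map_sub, map_smul,
    S.bracket_smul_left, smul_eq_mul, Derivation.sub_apply, Derivation.smul_apply,
    AddMonoidHom.sub_apply, e1, e2, e3, e4, map_neg,
    Matrix.of_apply, Matrix.cons_val]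
  ring

/-- The Schouten bracket `[T, X] = -L_X T` of a trivector with a section. -/
def bracketSection (S : SkewAlgebroid R Γ)
    (T : Module.Dual R Γ → Module.Dual R Γ → Module.Dual R Γ → R) (X : Γ)
    (α β γ : Module.Dual R Γ) : R :=
  T (S.adDual X α) β γ + T α (S.adDual X β) γ + T α β (S.adDual X γ) - S.anchor X (T α β γ)

variable (R Γ) in
/-- Sections of `∧ⁿA`. -/
abbrev TopMultivector (n : ℕ) := Module.Dual R Γ [⋀^Fin n]→ₗ[R] R

variable (R) in
/-- Differential forms of degree `m` on the base, with values in the scalars. -/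
abbrev TopForm (m : ℕ) := Derivation ℝ R R [⋀^Fin m]→ₗ[R] R

/-- The Lie derivative of differential forms. -/
def lieTopForm (m : ℕ) (D : Derivation ℝ R R) : DerivOp D (TopForm R m) :=
  DerivOp.alt ((tangent R).ad D) (DerivOp.fn D) m

variable (R Γ) in
/-- Sections of `∧ⁿA* ⊗ ∧ᵐT*M = Hom(∧ⁿA, ∧ᵐT*M)`. -/
abbrev CanonicalLine (n m : ℕ) := TopMultivector R Γ n →ₗ[R] TopForm R m

/-- The canonical action of `A*` on `∧ⁿA* ⊗ ∧ᵐT*M`: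
`ξ·(s ⊗ μ) = L_ξ s ⊗ μ + s ⊗ L_{a_*(ξ)} μ`. -/
def lieCanonicalLine (S : SkewAlgebroid R (Module.Dual R Γ)) (n m : ℕ) (ξ : Module.Dual R Γ) :
    DerivOp (S.anchor ξ) (CanonicalLine R Γ n m) :=
  ((S.ad ξ).alt (DerivOp.fn _) n).hom (lieTopForm m (S.anchor ξ))

/-- The canonical action of `A` on `∧ⁿA ⊗ ∧ᵐT*M`. -/
def lieDualLine (S : SkewAlgebroid R Γ) (n m : ℕ) (X : Γ) :
    DerivOp (S.anchor X) (Module.Dual R Γ [⋀^Fin n]→ₗ[R] TopForm R m) :=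
  (S.adDual X).alt (lieTopForm m (S.anchor X)) n

variable {n m : ℕ}

/-- `E` is the action of `A*` on `L` that induces the canonical action on
`L ⊗ L ≅ ∧ⁿA* ⊗ ∧ᵐT*M`. -/
def IsRootAction (S : SkewAlgebroid R (Module.Dual R Γ))
    (q : (N ⊗[R] N) ≃ₗ[R] CanonicalLine R Γ n m) (E : S.Connection N) : Prop :=
  ∀ (ξ : Module.Dual R Γ) (l l' : N),
    q (E.act ξ l ⊗ₜ l') + q (l ⊗ₜ E.act ξ l') = lieCanonicalLine S n m ξ (q (l ⊗ₜ l'))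

/-- The section `P ⊗ l` of `∧ⁿA ⊗ L`. -/
def tensorTop (P : TopMultivector R Γ n) (l : N) : Module.Dual R Γ [⋀^Fin n]→ₗ[R] N :=
  (LinearMap.toSpanSingleton R N l).compAlternatingMap P

/-- The isomorphism `(∧ⁿA ⊗ L) ⊗ (∧ⁿA ⊗ L) ≅ ∧ⁿA ⊗ ∧ᵐT*M` coming from `L ⊗ L ≅ ∧ⁿA* ⊗ ∧ᵐT*M`:
`(B, P ⊗ l) ↦ (η ↦ ⟨B(η) ⊗ l, P⟩)`. It makes `∧ⁿA ⊗ L` the square root of `∧ⁿA ⊗ ∧ᵐT*M`. -/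
def dualSquare (q : (N ⊗[R] N) ≃ₗ[R] CanonicalLine R Γ n m)
    (B : Module.Dual R Γ [⋀^Fin n]→ₗ[R] N) (P : TopMultivector R Γ n) (l : N) :
    Module.Dual R Γ [⋀^Fin n]→ₗ[R] TopForm R m :=
  (LinearMap.applyₗ P ∘ₗ q.toLinearMap ∘ₗ (TensorProduct.mk R N N).flip l).compAlternatingMap B

theorem dualSquare_apply (q : (N ⊗[R] N) ≃ₗ[R] CanonicalLine R Γ n m)
    (B : Module.Dual R Γ [⋀^Fin n]→ₗ[R] N) (P : TopMultivector R Γ n) (l : N)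
    (η : Fin n → Module.Dual R Γ) : dualSquare q B P l η = q (B η ⊗ₜ l) P := rfl

/-- `E` is the action of `A` on the square root `∧ⁿA ⊗ L` of `∧ⁿA ⊗ ∧ᵐT*M` that induces the
canonical action.
It suffices to say so on sections of the form `P ⊗ l`, as these span. -/
def IsDualRootAction (S : SkewAlgebroid R Γ)
    (q : (N ⊗[R] N) ≃ₗ[R] CanonicalLine R Γ n m)
    (E : S.Connection (Module.Dual R Γ [⋀^Fin n]→ₗ[R] N)) : Prop :=
  ∀ (X : Γ) (P P' : TopMultivector R Γ n) (l l' : N),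
    dualSquare q (E.act X (tensorTop P l)) P' l' + dualSquare q (E.act X (tensorTop P' l')) P l =
      lieDualLine S n m X (dualSquare q (tensorTop P l) P' l')

/-- The operator `Ð = d_* + ∂` on sections of `∧A ⊗ L`: `d_*` is the differential of `A*` with
coefficients in `L`, and `∂` is the differential of `A` with coefficients in `∧ⁿA ⊗ L`, carried over
by `∧ᵏA ⊗ L ≅ ∧ⁿ⁻ᵏA* ⊗ (∧ⁿA ⊗ L)`, with the sign for which
`∂(w ⊗ l) = (-∂_Ω w + ½ ι_{ξ₀} w) ⊗ l` in a local trivialization. -/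
def dirac (S : SkewAlgebroid R Γ) (S' : SkewAlgebroid R (Module.Dual R Γ))
    (hs : Function.Bijective (starMap (R := R) (Γ := Γ) (N := N) n))
    (E : S.Connection (Module.Dual R Γ [⋀^Fin n]→ₗ[R] N)) (E' : S'.Connection N)
    (a : Forms R (Module.Dual R Γ) N) : Forms R (Module.Dual R Γ) N :=
  S'.d E' a + (Equiv.ofBijective _ hs).symm (S.dSigned E (starMap n a))

end Dirac

section Geometry

variable {𝕂 : Type*} [RCLike 𝕂] {m : ℕ}
  {M : Type*} [TopologicalSpace M] [ChartedSpace (EuclideanSpace ℝ (Fin m)) M]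

/-- The scalars form a smooth ring over `ℝ`. -/
instance : ContMDiffRing 𝓘(ℝ, 𝕂) ∞ 𝕂 where
  contMDiff_add := by
    rw [← modelWithCornersSelf_prod, chartedSpaceSelf_prod]
    exact contDiff_add.contMDiff
  contMDiff_mul := by
    rw [← modelWithCornersSelf_prod, chartedSpaceSelf_prod]
    exact contDiff_mul.contMDiff

variable (𝕂 m M) in
/-- Smooth real or complex functions on the real manifold `M`. -/
abbrev SmoothFunctions := C^∞⟮𝓡 m, M; 𝓘(ℝ, 𝕂), 𝕂⟯

variable {F : Type*} [NormedAddCommGroup F] [NormedSpace ℝ F] [NormedSpace 𝕂 F]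
  [IsScalarTower ℝ 𝕂 F]
  {A : M → Type*} [TopologicalSpace (Bundle.TotalSpace F A)]
  [∀ x, TopologicalSpace (A x)] [∀ x, AddCommGroup (A x)] [∀ x, Module ℝ (A x)]
  [∀ x, Module 𝕂 (A x)] [FiberBundle F A] [VectorBundle ℝ F A] [VectorBundle 𝕂 F A]

theorem contMDiff_smul_section (f : SmoothFunctions 𝕂 m M) (s : Cₛ^∞⟮𝓡 m; F, A⟯) :
    ContMDiff (𝓡 m) ((𝓡 m).prod 𝓘(ℝ, F)) ∞
      (fun x => Bundle.TotalSpace.mk' F x ((f x • s x : A x))) := by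
  intro x₀
  have hs := s.contMDiff x₀
  have hf : ContMDiffAt (𝓡 m) 𝓘(ℝ, 𝕂) ∞ f x₀ := f.contMDiff x₀
  rw [Bundle.contMDiffAt_section] at hs ⊢
  have hsm : ContMDiff (𝓘(ℝ, 𝕂).prod 𝓘(ℝ, F)) 𝓘(ℝ, F) ∞ (fun p : 𝕂 × F => p.1 • p.2) := by
    rw [← modelWithCornersSelf_prod, chartedSpaceSelf_prod]
    exact (contDiff_fst.smul contDiff_snd).contMDiff
  refine (hsm.contMDiffAt.comp x₀ (hf.prodMk hs)).congr_of_eventuallyEq ?_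
  set e := trivializationAt F A x₀
  filter_upwards [e.open_baseSet.mem_nhds (FiberBundle.mem_baseSet_trivializationAt' x₀)] with x hx
  exact (e.linear 𝕂 hx).2 _ _

/-- Smooth sections form a module over the smooth functions, pointwise. -/
instance : Module (SmoothFunctions 𝕂 m M) Cₛ^∞⟮𝓡 m; F, A⟯ where
  smul f s := ⟨fun x => f x • s x, contMDiff_smul_section f s⟩
  one_smul s := by ext x; exact one_smul 𝕂 (s x)
  mul_smul f g s := by ext x; exact mul_smul (f x) (g x) (s x)
  smul_zero f := by ext x; exact smul_zero (f x)
  smul_add f s t := by ext x; exact smul_add (f x) (s x) (t x)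
  add_smul f g s := by ext x; exact add_smul (f x) (g x) (s x)
  zero_smul s := by ext x; exact zero_smul 𝕂 (s x)

theorem smul_section_apply (f : SmoothFunctions 𝕂 m M) (s : Cₛ^∞⟮𝓡 m; F, A⟯) (x : M) :
    (f • s) x = f x • s x := rfl

end Geometry
end DiracGen
end

open DiracGen

/-!
Let `∂` be the operator that the action of `A` on `∧ⁿA ⊗ L` induces on sections of `∧A ⊗ L`. This
action is flat, so `∂² = 0`. As `Φ` turns exterior multiplication into contraction, Cartan's formula
becomes `∂ (X ∧ ·) + (X ∧ ·) ∂ = L_X`. The commutator `[Λ ∧ ·, ∂]` therefore behaves like the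
differential of `A*` with coefficients in `L`, for a connection read off in degree zero. A trace
computation in local frames shows that this connection is the action of `A*` on `L`, so that
`d_* = [Λ ∧ ·, ∂]` and `d_* ∂ + ∂ d_* = [Λ ∧ ·, ∂²] = 0`.

It remains to see `d_*² = 0`. Replacing `X` by `f X` in `[[Λ, Λ], X] = 0` and taking a trace gives
`[Λ, Λ] (df, ·, ·) = 0`. Together with the invariance of `[Λ, Λ]` this is the Jacobi identity for
`A*`, and the square root of a flat action is flat.

The local arguments take place on all of `M`: instead of restricting to open sets, one multiplies by
cut-off functions, and a local frame consists of global sections that satisfy the equations of a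
frame up to such a factor.
-/

noncomputable section
namespace DiracGen

section Contraction
variable {R : Type*} [CommRing R]
variable {V N : Type*} [AddCommGroup V] [Module R V] [AddCommGroup N] [Module R N]

/-- Contraction `ι_v`, which lowers the degree of an inhomogeneous form by one. -/
def contract : V →+ AddMonoid.End (Forms R V N) :=
  AddMonoidHom.mk' (fun v => AddMonoidHom.mk' (fun a k => (a (k + 1)).curryLeft v)
      fun a b => by ext; simp)
    fun v w => by
      ext a k x
      exact (a (k + 1)).map_vecCons_add x v w

theorem contract_apply (v : V) (a : Forms R V N) (k : ℕ) :
    contract v a k = (a (k + 1)).curryLeft v := rfl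

/-- Multiplication of inhomogeneous forms by scalars. -/
def scale : R →+* AddMonoid.End (Forms R V N) := Module.toAddMonoidEnd R _

theorem scale_apply (f : R) (a : Forms R V N) : scale f a = f • a := rfl

theorem contract_mul_scale (f : R) (v : V) :
    (contract v * scale f : AddMonoid.End (Forms R V N)) = scale f * contract v := by
  ext
  simp [contract_apply, scale_apply]

theorem contract_mul_self (v : V) :
    (contract v * contract v : AddMonoid.End (Forms R V N)) = 0 := by
  ext
  simp [contract_apply]

theorem contract_anticomm (v w : V) :
    (contract v * contract w : AddMonoid.End (Forms R V N)) = -(contract w * contract v) := by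
  have h := contract_mul_self (R := R) (N := N) (v + w)
  rw [map_add, add_mul, mul_add, mul_add, contract_mul_self, contract_mul_self, zero_add,
    add_zero] at h
  exact eq_neg_of_add_eq_zero_left h

theorem eq_zero_of_contract {ι : Type*} (T : ι → Forms R V N) (zero : ∀ w, T w 0 = 0)
    (step : ∀ w v, ∃ w', ∀ k, T w' k = 0 → contract v (T w) k = 0) (w : ι) : T w = 0 := by
  funext k
  induction k generalizing w with
  | zero => exact zero w
  | succ k ih =>
    ext x
    obtain ⟨w', hw'⟩ := step w (x 0)
    have hx := DFunLike.congr_fun (hw' k (ih w')) (Fin.tail x)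
    rwa [contract_apply, AlternatingMap.curryLeft_apply_apply, Matrix.vecCons,
      Fin.cons_self_tail] at hx

theorem op_eq_zero_of_contract_anticomm (T : AddMonoid.End (Forms R V N)) (zero : ∀ w, T w 0 = 0)
    (anticomm : ∀ v, contract v * T + T * contract v = 0) : T = 0 := by
  refine AddMonoidHom.ext <| eq_zero_of_contract T zero fun w v => ⟨contract v w, fun k hk => ?_⟩
  have h := congrFun (DFunLike.congr_fun (anticomm v) w) k
  change contract v (T w) k + T (contract v w) k = 0 at h
  rwa [hk, add_zero] at h

theorem op_eq_zero_of_contract_comm (T : AddMonoid.End (Forms R V N)) (zero : ∀ w, T w 0 = 0)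
    (comm : ∀ v, contract v * T = T * contract v) : T = 0 :=
  AddMonoidHom.ext <| eq_zero_of_contract T zero fun w v =>
    ⟨contract v w, fun k hk => (congrFun (DFunLike.congr_fun (comm v) w) k).trans hk⟩

end Contraction

section LieOperators
variable {R : Type*} [CommRing R] [Algebra ℝ R]
variable {V N : Type*} [AddCommGroup V] [Module R V] [AddCommGroup N] [Module R N]
variable {D D₁ D₂ : Derivation ℝ R R}

namespace DerivOp

@[ext] theorem ext {δ δ' : DerivOp D N} (h : ∀ x, δ x = δ' x) : δ = δ' := by
  cases δ
  cases δ'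
  congr
  exact AddMonoidHom.ext h

/-- The commutator of two derivations of a module, over the commutator of the derivations of the
ring. -/
def comm (δ₁ : DerivOp D₁ N) (δ₂ : DerivOp D₂ N) : DerivOp ⁅D₁, D₂⁆ N where
  toFun := δ₁.toFun.comp δ₂.toFun - δ₂.toFun.comp δ₁.toFun
  leibniz f x := by
    simp only [AddMonoidHom.sub_apply, AddMonoidHom.comp_apply, leibniz, map_add,
      Derivation.commutator_apply, sub_smul, smul_sub]
    abel

@[simp] theorem comm_apply (δ₁ : DerivOp D₁ N) (δ₂ : DerivOp D₂ N) (x : N) :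
    δ₁.comm δ₂ x = δ₁ (δ₂ x) - δ₂ (δ₁ x) := rfl

@[simp] theorem hom_apply (δ : DerivOp D V) (τ : DerivOp D N) (φ : V →ₗ[R] N) (v : V) :
    δ.hom τ φ v = τ (φ v) - φ (δ v) := rfl

@[simp] theorem fn_apply (D : Derivation ℝ R R) (f : R) : fn D f = D f := rfl

end DerivOp

/-- The Lie derivative of inhomogeneous forms induced by derivations of `V` and of `N`. -/
def lieOp (δ : DerivOp D V) (τ : DerivOp D N) : AddMonoid.End (Forms R V N) :=
  AddMonoidHom.mk' (fun a k => δ.alt τ k (a k)) fun a b => by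
    funext
    simp

theorem lieOp_apply (δ : DerivOp D V) (τ : DerivOp D N) (a : Forms R V N) (k : ℕ) :
    lieOp δ τ a k = δ.alt τ k (a k) := rfl

theorem lieOp_zero_apply (δ : DerivOp D V) (τ : DerivOp D N) (a : Forms R V N) (x : Fin 0 → V) :
    lieOp δ τ a 0 x = τ (a 0 x) := by
  simp [lieOp_apply]

theorem lieOp_congr {D' : Derivation ℝ R R} {δ : DerivOp D V} {δ' : DerivOp D' V}
    {τ : DerivOp D N} {τ' : DerivOp D' N} (hδ : ∀ v, δ v = δ' v) (hτ : ∀ n, τ n = τ' n) :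
    lieOp δ τ = lieOp δ' τ' := by
  ext
  simp only [lieOp_apply, DerivOp.alt_apply, hδ, hτ]

theorem lieOp_mul_scale (δ : DerivOp D V) (τ : DerivOp D N) (f : R) :
    lieOp δ τ * scale f = scale f * lieOp δ τ + scale (D f) := by
  refine AddMonoidHom.ext fun a => funext fun k => ?_
  exact ((δ.alt τ k).leibniz f (a k)).trans (add_comm _ _)

theorem contract_mul_lieOp (δ : DerivOp D V) (τ : DerivOp D N) (v : V) :
    contract v * lieOp δ τ = lieOp δ τ * contract v - contract (δ v) := by
  ext a k x
  change δ.alt τ (k + 1) (a (k + 1)) (Matrix.vecCons v x) =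
    δ.alt τ k ((a (k + 1)).curryLeft v) x - a (k + 1) (Matrix.vecCons (δ v) x)
  have update_zero : Function.update (Matrix.vecCons v x) 0 (δ v) = Matrix.vecCons (δ v) x :=
    Fin.update_cons_zero _ _ _
  simp only [DerivOp.alt_apply, Fin.sum_univ_succ, update_vecCons_succ, Matrix.cons_val_succ,
    AlternatingMap.curryLeft_apply_apply, Matrix.cons_val_zero, update_zero]
  abel

theorem lieOp_commutator (δ₁ : DerivOp D₁ V) (τ₁ : DerivOp D₁ N) (δ₂ : DerivOp D₂ V)
    (τ₂ : DerivOp D₂ N) :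
    lieOp δ₁ τ₁ * lieOp δ₂ τ₂ - lieOp δ₂ τ₂ * lieOp δ₁ τ₁ =
      lieOp (δ₁.comm δ₂) (τ₁.comm τ₂) := by
  rw [← sub_eq_zero]
  refine op_eq_zero_of_contract_comm _ (fun w => ?_) fun v => ?_
  · ext x
    change lieOp δ₁ τ₁ (lieOp δ₂ τ₂ w) 0 x - lieOp δ₂ τ₂ (lieOp δ₁ τ₁ w) 0 x -
      lieOp (δ₁.comm δ₂) (τ₁.comm τ₂) w 0 x = 0
    simp [lieOp_zero_apply]
  · have comm₁ := contract_mul_lieOp (N := N) δ₁ τ₁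
    have comm₂ := contract_mul_lieOp (N := N) δ₂ τ₂
    simp only [mul_sub, sub_mul, ← mul_assoc, comm₁, comm₂, contract_mul_lieOp]
    simp only [mul_sub, mul_assoc, comm₁, comm₂, DerivOp.comm_apply, map_sub]
    abel

end LieOperators

section Wedge
variable {R : Type*} [CommRing R]

section Alternatization
variable {V N : Type*} [AddCommGroup V] [Module R V] [AddCommGroup N] [Module R N]

theorem curryLeft_alternatizeUncurryFin {k : ℕ} (f : V →ₗ[R] V [⋀^Fin (k + 1)]→ₗ[R] N) (v : V) :
    (AlternatingMap.alternatizeUncurryFin f).curryLeft v = f v -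
      AlternatingMap.alternatizeUncurryFin (AlternatingMap.curryLeftLinearMap.flip v ∘ₗ f) := by
  ext x
  have removeNth_succ : ∀ i : Fin (k + 1), i.succ.removeNth (Matrix.vecCons v x) =
      Matrix.vecCons v (i.removeNth x) := fun i => by
    funext l
    cases l using Fin.cases <;> simp [Fin.removeNth]
  simp [AlternatingMap.alternatizeUncurryFin_apply, Fin.sum_univ_succ (n := k + 1),
    removeNth_succ, pow_succ, sub_eq_add_neg]

theorem curryLeft_alternatizeUncurryFin_zero (f : V →ₗ[R] V [⋀^Fin 0]→ₗ[R] N) (v : V) :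
    (AlternatingMap.alternatizeUncurryFin f).curryLeft v = f v := by
  ext x
  simp [AlternatingMap.alternatizeUncurryFin_apply]

end Alternatization

variable {Γ N : Type*} [AddCommGroup Γ] [Module R Γ] [AddCommGroup N] [Module R N]

/-- Exterior multiplication `X ∧ ·` by sections, as additive operators. -/
def wedgeOp : Γ →+ AddMonoid.End (Forms R (Module.Dual R Γ) N) :=
  LinearMap.toAddMonoidHom'.comp wedge.toAddMonoidHom

theorem wedgeOp_apply (X : Γ) (a : Forms R (Module.Dual R Γ) N) : wedgeOp X a = wedge X a := rfl

theorem wedgeOp_zero_apply (X : Γ) (a : Forms R (Module.Dual R Γ) N) : wedgeOp X a 0 = 0 := rfl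

theorem wedgeOp_succ_apply (X : Γ) (a : Forms R (Module.Dual R Γ) N) (k : ℕ) :
    wedgeOp X a (k + 1) = wedgeAux X (a k) := rfl

theorem wedgeOp_smul (f : R) (X : Γ) :
    (wedgeOp (f • X) : AddMonoid.End (Forms R (Module.Dual R Γ) N)) = scale f * wedgeOp X :=
  AddMonoidHom.ext fun a => DFunLike.congr_fun (map_smul wedge f X) a

theorem wedgeOp_mul_scale (f : R) (X : Γ) :
    (wedgeOp X * scale f : AddMonoid.End (Forms R (Module.Dual R Γ) N)) = scale f * wedgeOp X :=
  AddMonoidHom.ext fun a => map_smul (wedge X) f a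

theorem curryLeft_wedgeAux {k : ℕ} (ξ : Module.Dual R Γ) (X : Γ)
    (a : Module.Dual R Γ [⋀^Fin (k + 1)]→ₗ[R] N) :
    (wedgeAux X a).curryLeft ξ = ξ X • a - wedgeAux X (a.curryLeft ξ) :=
  curryLeft_alternatizeUncurryFin _ ξ

theorem curryLeft_wedgeAux_zero (ξ : Module.Dual R Γ) (X : Γ)
    (a : Module.Dual R Γ [⋀^Fin 0]→ₗ[R] N) : (wedgeAux X a).curryLeft ξ = ξ X • a :=
  curryLeft_alternatizeUncurryFin_zero _ ξ

theorem contract_mul_wedgeOp (ξ : Module.Dual R Γ) (X : Γ) :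
    (contract ξ * wedgeOp X : AddMonoid.End (Forms R (Module.Dual R Γ) N)) =
      scale (ξ X) - wedgeOp X * contract ξ := by
  refine AddMonoidHom.ext fun a => funext fun k => ?_
  cases k with
  | zero => exact (curryLeft_wedgeAux_zero ξ X (a 0)).trans (sub_zero (ξ X • a 0)).symm
  | succ k => exact curryLeft_wedgeAux ξ X (a (k + 1))

theorem wedgeOp_mul_contract (X : Γ) (ξ : Module.Dual R Γ) :
    (wedgeOp X * contract ξ : AddMonoid.End (Forms R (Module.Dual R Γ) N)) =
      scale (ξ X) - contract ξ * wedgeOp X := by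
  rw [contract_mul_wedgeOp, sub_sub_cancel]

theorem contract_mul_wedgeOp_mul_wedgeOp (ξ : Module.Dual R Γ) (X Y : Γ) :
    (contract ξ * (wedgeOp X * wedgeOp Y) : AddMonoid.End (Forms R (Module.Dual R Γ) N)) =
      wedgeOp X * wedgeOp Y * contract ξ + wedgeOp (ξ X • Y - ξ Y • X) := by
  rw [← mul_assoc, contract_mul_wedgeOp, sub_mul, mul_assoc (wedgeOp X), contract_mul_wedgeOp,
    mul_sub, wedgeOp_mul_scale, map_sub, wedgeOp_smul, wedgeOp_smul, mul_assoc]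
  abel

end Wedge

theorem lieOp_mul_wedgeOp {R Γ N : Type*} [CommRing R] [Algebra ℝ R] [AddCommGroup Γ] [Module R Γ]
    [AddCommGroup N] [Module R N] (S : SkewAlgebroid R Γ) (X Y : Γ)
    (τ : DerivOp (S.anchor X) N) :
    lieOp (S.adDual X) τ * wedgeOp Y =
      wedgeOp Y * lieOp (S.adDual X) τ + wedgeOp (S.bracket X Y) := by
  rw [← sub_eq_zero]
  refine op_eq_zero_of_contract_anticomm _ (fun w => ?_) fun ξ => ?_
  · ext x
    change lieOp (S.adDual X) τ (wedgeOp Y w) 0 x - (wedgeOp Y (lieOp (S.adDual X) τ w) 0 +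
      wedgeOp (S.bracket X Y) w 0) x = 0
    simp [lieOp_zero_apply, wedgeOp_zero_apply]
  · have contract_lie := contract_mul_lieOp (N := N) (S.adDual X) τ
    have contract_wedge := contract_mul_wedgeOp (R := R) (Γ := Γ) (N := N)
    have lie_scale := lieOp_mul_scale (S.adDual X) τ
    simp only [mul_sub, mul_add, sub_mul, add_mul, ← mul_assoc, contract_lie, contract_wedge]
    simp only [mul_sub, mul_assoc, contract_lie, contract_wedge,
      lie_scale, adDual_apply, map_sub]
    abel

section Bivector
variable {R : Type*} [CommRing R] [Algebra ℝ R]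

theorem half_smul_add_self {P : Type*} [AddCommGroup P] [Module R P] (x : P) :
    algebraMap ℝ R 2⁻¹ • (x + x) = x := by
  rw [← two_smul R x, smul_smul, ← map_ofNat (algebraMap ℝ R) 2, ← map_mul]
  norm_num

variable {Γ N : Type*} [AddCommGroup Γ] [Module R Γ] [AddCommGroup N] [Module R N]

namespace Bivector

/-- The linear map `η ↦ (Λ♯ η) ∧ a`. Half its alternatization is `Λ ∧ a`. -/
def sharpWedge (Λ : Bivector R Γ) {k : ℕ} (a : Module.Dual R Γ [⋀^Fin k]→ₗ[R] N) :
    Module.Dual R Γ →ₗ[R] Module.Dual R Γ [⋀^Fin (k + 1)]→ₗ[R] N where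
  toFun η := wedgeAux (Λ.sharp η) a
  map_add' η θ := by
    ext
    simp [wedgeAux_apply, add_smul, Finset.sum_add_distrib]
  map_smul' f η := by
    ext
    simp only [wedgeAux_apply, map_smul, smul_eq_mul, mul_smul, AlternatingMap.smul_apply,
      Finset.smul_sum, RingHom.id_apply]
    exact Finset.sum_congr rfl fun i _ => smul_comm _ _ _

/-- Exterior multiplication `Λ ∧ ·` by a bivector. -/
def wedgeOp (Λ : Bivector R Γ) : AddMonoid.End (Forms R (Module.Dual R Γ) N) :=
  AddMonoidHom.mk' (fun a k => match k with
    | 0 => 0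
    | 1 => 0
    | _ + 2 => algebraMap ℝ R 2⁻¹ • AlternatingMap.alternatizeUncurryFin (Λ.sharpWedge (a _)))
    fun a b => by
      funext k
      rcases k with _ | _ | k
      · exact (add_zero _).symm
      · exact (add_zero _).symm
      · have sharpWedge_add : Λ.sharpWedge (a k + b k) = Λ.sharpWedge (a k) + Λ.sharpWedge (b k) :=
          LinearMap.ext fun η => map_add (wedgeAux (Λ.sharp η)) _ _
        simp only [Pi.add_apply, sharpWedge_add, ← smul_add,
          ← AlternatingMap.alternatizeUncurryFinLM_apply, map_add]

theorem wedgeOp_zero_apply (Λ : Bivector R Γ) (a : Forms R (Module.Dual R Γ) N) :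
    Λ.wedgeOp a 0 = 0 := rfl

theorem wedgeOp_add_two_apply (Λ : Bivector R Γ) (a : Forms R (Module.Dual R Γ) N) (k : ℕ) :
    Λ.wedgeOp a (k + 2) =
      algebraMap ℝ R 2⁻¹ • AlternatingMap.alternatizeUncurryFin (Λ.sharpWedge (a k)) := rfl

theorem curryLeft_sharpWedge (Λ : Bivector R Γ) (a : Forms R (Module.Dual R Γ) N) (k : ℕ)
    (ξ η : Module.Dual R Γ) : (Λ.sharpWedge (a k) η).curryLeft ξ =
      -η (Λ.sharp ξ) • a k - DiracGen.wedgeOp (Λ.sharp η) (contract ξ a) k := by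
  rw [← show ξ (Λ.sharp η) = -η (Λ.sharp ξ) from Λ.toFun_skew η ξ]
  exact congrFun (DFunLike.congr_fun (contract_mul_wedgeOp ξ (Λ.sharp η)) a) k

theorem curryLeft_alternatize_sharpWedge_zero (Λ : Bivector R Γ)
    (a : Forms R (Module.Dual R Γ) N) (ξ : Module.Dual R Γ) :
    (AlternatingMap.alternatizeUncurryFin (Λ.sharpWedge (a 0))).curryLeft ξ =
      wedgeAux (Λ.sharp ξ) (a 0) + wedgeAux (Λ.sharp ξ) (a 0) := by
  have curry : AlternatingMap.curryLeftLinearMap.flip ξ ∘ₗ Λ.sharpWedge (a 0) =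
      -(Module.Dual.eval R Γ (Λ.sharp ξ)).smulRight (a 0) := by
    refine LinearMap.ext fun η => (Λ.curryLeft_sharpWedge a 0 ξ η).trans ?_
    rw [DiracGen.wedgeOp_zero_apply, sub_zero, neg_smul]
    rfl
  rw [curryLeft_alternatizeUncurryFin, curry, ← AlternatingMap.alternatizeUncurryFinLM_apply,
    map_neg, sub_neg_eq_add]
  rfl

theorem curryLeft_alternatize_sharpWedge_succ (Λ : Bivector R Γ)
    (a : Forms R (Module.Dual R Γ) N) (k : ℕ) (ξ : Module.Dual R Γ) :
    (AlternatingMap.alternatizeUncurryFin (Λ.sharpWedge (a (k + 1)))).curryLeft ξ =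
      AlternatingMap.alternatizeUncurryFin (Λ.sharpWedge (contract ξ a k)) +
        (wedgeAux (Λ.sharp ξ) (a (k + 1)) + wedgeAux (Λ.sharp ξ) (a (k + 1))) := by
  have curry : AlternatingMap.curryLeftLinearMap.flip ξ ∘ₗ Λ.sharpWedge (a (k + 1)) =
      -(Module.Dual.eval R Γ (Λ.sharp ξ)).smulRight (a (k + 1)) -
        Λ.sharpWedge (contract ξ a k) := by
    refine LinearMap.ext fun η => (Λ.curryLeft_sharpWedge a (k + 1) ξ η).trans ?_
    rw [DiracGen.wedgeOp_succ_apply, neg_smul]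
    rfl
  rw [curryLeft_alternatizeUncurryFin, curry, ← AlternatingMap.alternatizeUncurryFinLM_apply,
    map_sub, map_neg]
  simp only [sub_sub_eq_add_sub, sub_neg_eq_add]
  exact (add_right_comm _ _ _).trans (add_comm _ _)

theorem contract_mul_wedgeOp (Λ : Bivector R Γ) (ξ : Module.Dual R Γ) :
    (contract ξ * Λ.wedgeOp : AddMonoid.End (Forms R (Module.Dual R Γ) N)) =
      Λ.wedgeOp * contract ξ + DiracGen.wedgeOp (Λ.sharp ξ) := by
  refine AddMonoidHom.ext fun a => funext fun k => ?_
  rcases k with _ | k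
  · exact (map_zero (AlternatingMap.curryLeftLinearMap.flip ξ)).trans (add_zero _).symm
  · change (Λ.wedgeOp a (k + 2)).curryLeft ξ = Λ.wedgeOp (contract ξ a) (k + 1) +
      wedgeAux (Λ.sharp ξ) (a k)
    rw [wedgeOp_add_two_apply, AlternatingMap.curryLeft_smul, LinearMap.smul_apply]
    rcases k with _ | k
    · rw [curryLeft_alternatize_sharpWedge_zero, half_smul_add_self]
      exact (zero_add _).symm
    · rw [curryLeft_alternatize_sharpWedge_succ, smul_add, half_smul_add_self]
      rfl

end Bivector
end Bivector

section Differential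
variable {R : Type*} [CommRing R] [Algebra ℝ R]
variable {Γ N : Type*} [AddCommGroup Γ] [Module R Γ] [AddCommGroup N] [Module R N]

namespace SkewAlgebroid

/-- A connection is flat if it represents the bracket. A flat connection is an action of the
algebroid. -/
def Connection.IsFlat {S : SkewAlgebroid R Γ} (E : S.Connection N) : Prop :=
  ∀ X Y n, E.act (S.bracket X Y) n = E.act X (E.act Y n) - E.act Y (E.act X n)

/-- The Chevalley--Eilenberg differential as an additive operator on inhomogeneous forms. -/
def dOp (S : SkewAlgebroid R Γ) (E : S.Connection N) : AddMonoid.End (Forms R Γ N) :=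
  AddMonoidHom.mk' (S.d E) fun a b => by
    funext k
    cases k with
    | zero => exact (add_zero _).symm
    | succ k => ext x; exact S.ceFun_add E _ _ x

theorem dOp_zero_apply (S : SkewAlgebroid R Γ) (E : S.Connection N) (a : Forms R Γ N) :
    S.dOp E a 0 = 0 := rfl

theorem dOp_congr (S : SkewAlgebroid R Γ) (E : S.Connection N) {a b : Forms R Γ N} {k : ℕ}
    (h : a k = b k) : S.dOp E a (k + 1) = S.dOp E b (k + 1) :=
  congrArg (S.ce E) h

theorem contract_mul_dOp (S : SkewAlgebroid R Γ) (E : S.Connection N) (X : Γ) :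
    contract X * S.dOp E = lieOp (S.ad X) (E.act X) - S.dOp E * contract X := by
  refine AddMonoidHom.ext fun a => funext fun k => ?_
  ext x
  cases k with
  | zero =>
    change S.ceFun E (a 0) (Matrix.vecCons X x) = lieOp (S.ad X) (E.act X) a 0 x - 0
    simp [lieOp_zero_apply, ceFun]
  | succ k => exact S.ceFun_succ E (a (k + 1)) X x

end SkewAlgebroid

namespace LieAlgebroid

theorem lieOp_commutator (S : LieAlgebroid R Γ) {E : S.Connection N} (hE : E.IsFlat) (X Y : Γ) :
    lieOp (S.ad X) (E.act X) * lieOp (S.ad Y) (E.act Y) =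
      lieOp (S.ad Y) (E.act Y) * lieOp (S.ad X) (E.act X) +
        lieOp (S.ad (S.bracket X Y)) (E.act (S.bracket X Y)) := by
  rw [← sub_eq_iff_eq_add', DiracGen.lieOp_commutator]
  exact lieOp_congr (fun Z => sub_eq_iff_eq_add.mpr (S.jacobi X Y Z)) fun n => (hE X Y n).symm

theorem lieOp_mul_dOp (S : LieAlgebroid R Γ) {E : S.Connection N} (hE : E.IsFlat) (X : Γ) :
    lieOp (S.ad X) (E.act X) * S.dOp E = S.dOp E * lieOp (S.ad X) (E.act X) := by
  rw [← sub_eq_zero]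
  refine op_eq_zero_of_contract_anticomm _ (fun w => ?_) fun Y => ?_
  · ext x
    change lieOp (S.ad X) (E.act X) (S.dOp E w) 0 x - 0 = 0
    simp [lieOp_zero_apply, S.dOp_zero_apply]
  · have contract_lie : ∀ Y, contract Y * lieOp (S.ad X) (E.act X) =
        lieOp (S.ad X) (E.act X) * contract Y - contract (S.bracket X Y) :=
      contract_mul_lieOp (N := N) (S.ad X) (E.act X)
    have contract_d := S.contract_mul_dOp E
    simp only [mul_sub, sub_mul, ← mul_assoc, contract_lie, contract_d]
    simp only [mul_sub, mul_assoc, contract_lie, contract_d, S.lieOp_commutator hE X Y]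
    abel

theorem dOp_mul_dOp (S : LieAlgebroid R Γ) {E : S.Connection N} (hE : E.IsFlat) :
    S.dOp E * S.dOp E = 0 := by
  refine op_eq_zero_of_contract_comm _ (fun w => S.dOp_zero_apply E (S.dOp E w)) fun X => ?_
  have contract_d := S.contract_mul_dOp E
  simp only [sub_mul, ← mul_assoc, contract_d]
  simp only [mul_sub, mul_assoc, contract_d, S.lieOp_mul_dOp hE]
  abel

end LieAlgebroid
end Differential

section Parity
variable {R : Type*} [CommRing R]
variable {V N : Type*} [AddCommGroup V] [Module R V] [AddCommGroup N] [Module R N]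

/-- The parity operator, which is `(-1)ᵏ` on forms of degree `k`. It keeps track of the degree
dependent signs in `SkewAlgebroid.dSigned` and in the interplay of `starMap` with contractions. -/
def parity : AddMonoid.End (Forms R V N) :=
  AddMonoidHom.mk' (fun a k => (-1 : ℤ) ^ k • a k) fun a b => funext fun k => smul_add _ (a k) (b k)

theorem parity_apply (a : Forms R V N) (k : ℕ) : parity a k = (-1 : ℤ) ^ k • a k := rfl

theorem parity_mul_parity : (parity * parity : AddMonoid.End (Forms R V N)) = 1 := by
  refine AddMonoidHom.ext fun a => funext fun k => ?_
  change (-1 : ℤ) ^ k • (-1 : ℤ) ^ k • a k = a k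
  rw [smul_smul, ← mul_pow, neg_one_mul, neg_neg, one_pow, one_smul]

theorem contract_mul_parity (v : V) :
    (contract v * parity : AddMonoid.End (Forms R V N)) = -(parity * contract v) := by
  ext a k x
  change ((-1 : ℤ) ^ (k + 1) • a (k + 1)) (Matrix.vecCons v x) =
    -((-1 : ℤ) ^ k • (a (k + 1)).curryLeft v) x
  simp [pow_succ]

variable [Algebra ℝ R]

theorem lieOp_mul_parity {D : Derivation ℝ R R} (δ : DerivOp D V) (τ : DerivOp D N) :
    lieOp δ τ * parity = parity * lieOp δ τ :=
  AddMonoidHom.ext fun a => funext fun k => map_zsmul (δ.alt τ k).toFun ((-1 : ℤ) ^ k) (a k)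

namespace SkewAlgebroid
variable (S : SkewAlgebroid R V) (E : S.Connection N)

theorem dOp_parity_apply (a : Forms R V N) (k : ℕ) :
    S.dOp E (parity a) (k + 1) = (-1 : ℤ) ^ k • S.dOp E a (k + 1) :=
  (S.dOp_congr E (b := (-1 : ℤ) ^ k • a) rfl).trans
    (congrFun (map_zsmul (S.dOp E) ((-1 : ℤ) ^ k) a) (k + 1))

theorem dOp_mul_parity : S.dOp E * parity = -(parity * S.dOp E) := by
  refine AddMonoidHom.ext fun a => funext fun k => ?_
  cases k with
  | zero =>
    change (0 : V [⋀^Fin 0]→ₗ[R] N) = -((-1 : ℤ) ^ 0 • 0)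
    rw [smul_zero, neg_zero]
  | succ k =>
    change S.dOp E (parity a) (k + 1) = -((-1 : ℤ) ^ (k + 1) • S.dOp E a (k + 1))
    rw [dOp_parity_apply, pow_succ, mul_neg_one, neg_smul, neg_neg]

theorem dSigned_eq (a : Forms R V N) : S.dSigned E a = S.dOp E (parity a) := by
  funext k
  cases k with
  | zero => rfl
  | succ k => exact (S.dOp_parity_apply E a k).symm

end SkewAlgebroid
end Parity

section Star
variable {R : Type*} [CommRing R]
variable {Γ N : Type*} [AddCommGroup Γ] [Module R Γ] [AddCommGroup N] [Module R N]

theorem ι_mul_ιMulti (X : Γ) : ∀ {j : ℕ} (Y : Fin j → Γ),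
    ExteriorAlgebra.ι R X * ExteriorAlgebra.ιMulti R j Y =
      (-1 : ℤ) ^ j • (ExteriorAlgebra.ιMulti R j Y * ExteriorAlgebra.ι R X)
  | 0, Y => by simp
  | j + 1, Y => by
    have swap : ExteriorAlgebra.ι R X * ExteriorAlgebra.ι R (Y 0) =
        -(ExteriorAlgebra.ι R (Y 0) * ExteriorAlgebra.ι R X) :=
      eq_neg_of_add_eq_zero_left (ExteriorAlgebra.ι_add_mul_swap X (Y 0))
    rw [ExteriorAlgebra.ιMulti_succ_apply, ← mul_assoc, swap, neg_mul, mul_assoc,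
      ι_mul_ιMulti X, mul_smul_comm, pow_succ, mul_neg_one, neg_smul, mul_assoc]

theorem wedgeAction_ι (X : Γ) (a : Forms R (Module.Dual R Γ) N) :
    wedgeAction (N := N) (ExteriorAlgebra.ι R X) a = wedgeOp X a := by
  rw [wedgeAction, ExteriorAlgebra.lift_ι_apply, wedgeOp_apply]

theorem starMap_apply (n : ℕ) (a : Forms R (Module.Dual R Γ) N) (j : ℕ) (X : Fin j → Γ) :
    starMap n a j X = wedgeAction (N := N) (ExteriorAlgebra.ιMulti R j X) a n := rfl

theorem starMap_zero_apply (n : ℕ) (a : Forms R (Module.Dual R Γ) N) (X : Fin 0 → Γ) :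
    starMap n a 0 X = a n := by
  simp [starMap_apply]

variable (R Γ N) in
/-- The map `starMap n` as a linear map. -/
def starHom (n : ℕ) : Forms R (Module.Dual R Γ) N →ₗ[R]
    Forms R Γ (Module.Dual R Γ [⋀^Fin n]→ₗ[R] N) where
  toFun := starMap n
  map_add' a b := by
    ext1 j
    ext1 X
    simp [starMap_apply]
  map_smul' f a := by
    ext1 j
    ext1 X
    simp [starMap_apply]

theorem starHom_apply (n : ℕ) (a : Forms R (Module.Dual R Γ) N) :
    starHom R Γ N n a = starMap n a := rfl

theorem contract_starMap (n : ℕ) (X : Γ) (a : Forms R (Module.Dual R Γ) N) :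
    contract X (starMap n a) = parity (starMap n (wedgeOp X a)) := by
  funext j
  ext1 Y
  change starMap n a (j + 1) (Matrix.vecCons X Y) =
    (-1 : ℤ) ^ j • starMap n (wedgeOp X a) j Y
  rw [starMap_apply, starMap_apply, ExteriorAlgebra.ιMulti_succ_apply, Matrix.cons_val_zero,
    ← wedgeAction_ι]
  change wedgeAction (N := N) (ExteriorAlgebra.ι R X * ExteriorAlgebra.ιMulti R j Y) a n = _
  rw [ι_mul_ιMulti, map_zsmul, map_mul]
  rfl

theorem starMap_wedgeOp (n : ℕ) (X : Γ) (a : Forms R (Module.Dual R Γ) N) :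
    starMap n (wedgeOp X a) = parity (contract X (starMap n a)) := by
  rw [contract_starMap]
  exact (DFunLike.congr_fun parity_mul_parity _).symm

theorem starMap_eq_zero (n : ℕ) {j : ℕ} (a : Forms R (Module.Dual R Γ) N)
    (h : ∀ k, k + j = n → a k = 0) : starMap (Γ := Γ) n a j = 0 := by
  induction j generalizing a with
  | zero =>
    ext1 X
    rw [starMap_zero_apply, h n rfl]
    rfl
  | succ j ih =>
    have wedge_zero (X : Γ) : starMap (Γ := Γ) n (wedgeOp X a) j = 0 := ih _ fun k hk => by
      cases k with
      | zero => rfl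
      | succ k => rw [wedgeOp_succ_apply, h k (by omega), map_zero]
    ext1 Y
    have hY := DFunLike.congr_fun (congrFun (contract_starMap n (Y 0) a) j) (Fin.tail Y)
    rw [parity_apply, wedge_zero, smul_zero] at hY
    rwa [contract_apply, AlternatingMap.curryLeft_apply_apply, Matrix.vecCons,
      Fin.cons_self_tail] at hY

theorem starMap_congr (n : ℕ) {j : ℕ} (a b : Forms R (Module.Dual R Γ) N)
    (h : ∀ k, k + j = n → a k = b k) : starMap (Γ := Γ) n a j = starMap n b j := by
  rw [← sub_eq_zero, ← Pi.sub_apply, ← starHom_apply n a, ← starHom_apply n b, ← map_sub,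
    starHom_apply]
  exact starMap_eq_zero n _ fun k hk => by rw [Pi.sub_apply, h k hk, sub_self]

theorem starMap_lieOp [Algebra ℝ R] (S : SkewAlgebroid R Γ) (n : ℕ) (X : Γ)
    (τ : DerivOp (S.anchor X) N) (a : Forms R (Module.Dual R Γ) N) :
    starMap n (lieOp (S.adDual X) τ a) =
      lieOp (S.ad X) ((S.adDual X).alt τ n) (starMap n a) := by
  set lie := lieOp (S.ad X) ((S.adDual X).alt τ n) with lie_def
  let defect (a : Forms R (Module.Dual R Γ) N) :=
    starMap n (lieOp (S.adDual X) τ a) - lie (starMap n a)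
  refine sub_eq_zero.mp (eq_zero_of_contract defect (fun w => ?_)
    (fun w Y => ⟨wedgeOp Y w, fun k hk => ?_⟩) a)
  · ext1 x
    change starMap n (lieOp (S.adDual X) τ w) 0 x - lie (starMap n w) 0 x = 0
    rw [starMap_zero_apply, lie_def, lieOp_zero_apply, starMap_zero_apply, sub_eq_zero]
    rfl
  · have contract_lie : contract Y (lie (starMap n w)) = lie (contract Y (starMap n w)) -
        contract (S.bracket X Y) (starMap n w) :=
      DFunLike.congr_fun (contract_mul_lieOp (S.ad X) ((S.adDual X).alt τ n) Y) (starMap n w)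
    have lie_parity : ∀ θ, lie (parity θ) = parity (lie θ) :=
      DFunLike.congr_fun (lieOp_mul_parity (S.ad X) ((S.adDual X).alt τ n))
    have wedge_lie : lieOp (S.adDual X) τ (wedgeOp Y w) =
        wedgeOp Y (lieOp (S.adDual X) τ w) + wedgeOp (S.bracket X Y) w :=
      DFunLike.congr_fun (lieOp_mul_wedgeOp S X Y τ) w
    have contract_defect : contract Y (defect w) = parity (defect (wedgeOp Y w)) := by
      simp only [defect, map_sub, contract_lie, contract_starMap, lie_parity, wedge_lie,
        ← starHom_apply n (_ + _), map_add]
      simp only [starHom_apply]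
      abel
    rw [contract_defect, parity_apply, hk, smul_zero]

theorem op_eq_zero_of_wedge_anticomm {n : ℕ}
    (hs : Function.Injective (starMap (R := R) (Γ := Γ) (N := N) n))
    (T : AddMonoid.End (Forms R (Module.Dual R Γ) N)) (top : ∀ w, T w n = 0)
    (anticomm : ∀ X, wedgeOp X * T + T * wedgeOp X = 0) : T = 0 := by
  refine AddMonoidHom.ext fun w => hs <| .trans ?_ (map_zero (starHom R Γ N n)).symm
  refine eq_zero_of_contract (fun a => starMap n (T a)) (fun w => ?_)
    (fun w Y => ⟨wedgeOp Y w, fun k hk => ?_⟩) w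
  · ext1 x
    rw [starMap_zero_apply, top]
    rfl
  · have wedge_T : wedgeOp Y (T w) = -T (wedgeOp Y w) :=
      eq_neg_of_add_eq_zero_left (DFunLike.congr_fun (anticomm Y) w)
    rw [contract_starMap, parity_apply, wedge_T, ← starHom_apply, map_neg, Pi.neg_apply,
      starHom_apply, hk, neg_zero, smul_zero]

end Star

section Boundary
variable {R : Type*} [CommRing R] [Algebra ℝ R]
variable {Γ N : Type*} [AddCommGroup Γ] [Module R Γ] [AddCommGroup N] [Module R N]
variable {n : ℕ} (hs : Function.Bijective (starMap (R := R) (Γ := Γ) (N := N) n))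
  (S : SkewAlgebroid R Γ) (E : S.Connection (Module.Dual R Γ [⋀^Fin n]→ₗ[R] N))

/-- The operator `∂` on sections of `∧A ⊗ L`: the signed differential, carried over by `starMap`. -/
def boundary : AddMonoid.End (Forms R (Module.Dual R Γ) N) :=
  let star := LinearEquiv.ofBijective (starHom R Γ N n) hs
  star.symm.toAddMonoidHom.comp ((S.dOp E * parity).comp star.toAddMonoidHom)

theorem starMap_boundary (a : Forms R (Module.Dual R Γ) N) :
    starMap n (boundary hs S E a) = S.dOp E (parity (starMap n a)) :=
  (LinearEquiv.ofBijective (starHom R Γ N n) hs).apply_symm_apply _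

theorem dirac_eq (S' : SkewAlgebroid R (Module.Dual R Γ)) (E' : S'.Connection N)
    (a : Forms R (Module.Dual R Γ) N) :
    dirac S S' hs E E' a = (S'.dOp E' + boundary hs S E) a := by
  refine congrArg (S'.d E' a + ·) (hs.1 ?_)
  exact (Equiv.ofBijective_apply_symm_apply _ hs _).trans <|
    (S.dSigned_eq E _).trans (starMap_boundary hs S E a).symm

theorem boundary_top (a : Forms R (Module.Dual R Γ) N) : boundary hs S E a n = 0 := by
  rw [← starMap_zero_apply (Γ := Γ) n (boundary hs S E a) ![], starMap_boundary, S.dOp_zero_apply]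
  rfl

theorem boundary_zero_apply (a : Forms R (Module.Dual R Γ) N) (h : a 1 = 0) :
    boundary hs S E a 0 = 0 := by
  have star_single : starMap (Γ := Γ) n (Pi.single 0 (boundary hs S E a 0)) =
      starMap n (0 : Forms R (Module.Dual R Γ) N) := by
    rw [← starHom_apply n 0, map_zero]
    funext j
    rcases eq_or_ne j n with rfl | hj
    · rw [starMap_congr j _ (boundary hs S E a) fun k hk => ?single, starMap_boundary]
      case single =>
        obtain rfl : k = 0 := by omega
        simp
      cases j with
      | zero => rfl
      | succ j =>
        have star_top : starMap (Γ := Γ) (j + 1) a j = 0 := starMap_eq_zero _ a fun k hk => by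
          obtain rfl : k = 1 := by omega
          exact h
        rw [S.dOp_parity_apply, S.dOp_congr E (b := 0) star_top, map_zero]
        exact smul_zero _
    · exact starMap_eq_zero _ _ fun k hk => Pi.single_eq_of_ne (by omega) _
  simpa using congrFun (hs.1 star_single) 0

theorem boundary_mul_boundary (hE : S.dOp E * S.dOp E = 0) :
    boundary hs S E * boundary hs S E = 0 := by
  have d_parity : ∀ θ, S.dOp E (parity θ) = -parity (S.dOp E θ) :=
    DFunLike.congr_fun (S.dOp_mul_parity E)
  have d_d : ∀ θ, S.dOp E (S.dOp E θ) = 0 := DFunLike.congr_fun hE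
  refine AddMonoidHom.ext fun a => hs.1 ?_
  change starMap n (boundary hs S E (boundary hs S E a)) = starHom R Γ N n 0
  rw [starMap_boundary, starMap_boundary, d_parity, d_d, map_zero, map_zero, neg_zero]

theorem boundary_mul_wedgeOp (X : Γ) (τ : DerivOp (S.anchor X) N)
    (hτ : ∀ b, E.act X b = (S.adDual X).alt τ n b) :
    boundary hs S E * wedgeOp X = lieOp (S.adDual X) τ - wedgeOp X * boundary hs S E := by
  rw [eq_sub_iff_add_eq]
  refine AddMonoidHom.ext fun a => hs.1 ?_
  have parity_parity : ∀ θ : Forms R Γ (Module.Dual R Γ [⋀^Fin n]→ₗ[R] N),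
      parity (parity θ) = θ := DFunLike.congr_fun parity_mul_parity
  have d_parity : ∀ θ, S.dOp E (parity θ) = -parity (S.dOp E θ) :=
    DFunLike.congr_fun (S.dOp_mul_parity E)
  have contract_parity : ∀ θ : Forms R Γ (Module.Dual R Γ [⋀^Fin n]→ₗ[R] N),
      contract X (parity θ) = -parity (contract X θ) :=
    DFunLike.congr_fun (contract_mul_parity X)
  have cartan : contract X (S.dOp E (starMap n a)) =
      lieOp (S.ad X) (E.act X) (starMap n a) - S.dOp E (contract X (starMap n a)) :=
    DFunLike.congr_fun (S.contract_mul_dOp E X) (starMap n a)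
  calc starMap n (boundary hs S E (wedgeOp X a) + wedgeOp X (boundary hs S E a))
      = starMap n (boundary hs S E (wedgeOp X a)) + starMap n (wedgeOp X (boundary hs S E a)) :=
        map_add (starHom R Γ N n) _ _
    _ = S.dOp E (contract X (starMap n a)) + contract X (S.dOp E (starMap n a)) := by
        rw [starMap_boundary, starMap_wedgeOp, starMap_wedgeOp, starMap_boundary, parity_parity,
          d_parity, map_neg, contract_parity, neg_neg, parity_parity]
    _ = lieOp (S.ad X) ((S.adDual X).alt τ n) (starMap n a) := by
        rw [cartan, add_sub_cancel, lieOp_congr (fun _ => rfl) hτ]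
    _ = starMap n (lieOp (S.adDual X) τ a) := (starMap_lieOp S n X τ a).symm

end Boundary

section ExactForms
variable {R : Type*} [CommRing R] [Algebra ℝ R] {Γ : Type*} [AddCommGroup Γ] [Module R Γ]

namespace SkewAlgebroid
variable (S : SkewAlgebroid R Γ)

theorem d₀_apply (f : R) (X : Γ) : S.d₀ f X = S.anchor X f := rfl

theorem d₀_add (f g : R) : S.d₀ (f + g) = S.d₀ f + S.d₀ g := LinearMap.ext fun X => by
  simp only [d₀_apply, LinearMap.add_apply, map_add]

theorem d₀_sub (f g : R) : S.d₀ (f - g) = S.d₀ f - S.d₀ g := LinearMap.ext fun X => by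
  simp only [d₀_apply, LinearMap.sub_apply, map_sub]

theorem d₀_neg (f : R) : S.d₀ (-f) = -S.d₀ f := LinearMap.ext fun X => by
  simp only [d₀_apply, LinearMap.neg_apply, map_neg]

theorem adDual_sub (X Y : Γ) (ξ : Module.Dual R Γ) :
    S.adDual (X - Y) ξ = S.adDual X ξ - S.adDual Y ξ := LinearMap.ext fun Z => by
  simp only [adDual_apply, LinearMap.sub_apply, map_sub, Derivation.sub_apply,
    AddMonoidHom.sub_apply]
  abel

end SkewAlgebroid
end ExactForms

section DerivedBracket
variable {R : Type*} [CommRing R] [Algebra ℝ R]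
variable {Γ N : Type*} [AddCommGroup Γ] [Module R Γ] [AddCommGroup N] [Module R N] {n : ℕ}

/-- The connection `E` on `∧ⁿA ⊗ L` is induced by derivations `δ X` of the sections of `L`, with
the sections of `A` acting on `∧ⁿA` by the bracket. -/
def SkewAlgebroid.Connection.IsInducedBy {S : SkewAlgebroid R Γ}
    (E : S.Connection (Module.Dual R Γ [⋀^Fin n]→ₗ[R] N)) (δ : ∀ X, DerivOp (S.anchor X) N) :
    Prop :=
  ∀ X b, E.act X b = (S.adDual X).alt (δ X) n b

variable (hs : Function.Bijective (starMap (R := R) (Γ := Γ) (N := N) n))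
  {S : SkewAlgebroid R Γ} {E : S.Connection (Module.Dual R Γ [⋀^Fin n]→ₗ[R] N)}
  {δ : ∀ X, DerivOp (S.anchor X) N}

/-- The anticommutator of `ι_ξ` and `∂`. It is, up to sign, contraction with the two-form `dξ`, and
is used in place of it. -/
def boundaryContract (hs : Function.Bijective (starMap (R := R) (Γ := Γ) (N := N) n))
    (S : SkewAlgebroid R Γ) (E : S.Connection (Module.Dual R Γ [⋀^Fin n]→ₗ[R] N))
    (ξ : Module.Dual R Γ) : AddMonoid.End (Forms R (Module.Dual R Γ) N) :=
  contract ξ * boundary hs S E + boundary hs S E * contract ξ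

section Induced
variable (hδ : E.IsInducedBy δ)
include hδ

theorem wedgeOp_mul_boundary (X : Γ) :
    wedgeOp X * boundary hs S E = lieOp (S.adDual X) (δ X) - boundary hs S E * wedgeOp X := by
  rw [boundary_mul_wedgeOp hs S E X (δ X) (hδ X), sub_sub_cancel]

theorem contract_mul_derivedBracket (Λ : Bivector R Γ) (ξ : Module.Dual R Γ) :
    contract ξ * (Λ.wedgeOp * boundary hs S E - boundary hs S E * Λ.wedgeOp) =
      lieOp (S.adDual (Λ.sharp ξ)) (δ (Λ.sharp ξ)) +
        (Λ.wedgeOp * boundaryContract hs S E ξ - boundaryContract hs S E ξ * Λ.wedgeOp) -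
      (Λ.wedgeOp * boundary hs S E - boundary hs S E * Λ.wedgeOp) * contract ξ := by
  have contract_bivector := Λ.contract_mul_wedgeOp (N := N) ξ
  have wedge_boundary := wedgeOp_mul_boundary hs hδ (Λ.sharp ξ)
  have contract_bivector_assoc : ∀ T, contract ξ * (Λ.wedgeOp * T) =
      Λ.wedgeOp * (contract ξ * T) + wedgeOp (Λ.sharp ξ) * T := fun T => by
    rw [← mul_assoc, contract_bivector, add_mul, mul_assoc]
  simp only [boundaryContract, mul_sub, mul_add, sub_mul, add_mul, mul_assoc, contract_bivector,
    contract_bivector_assoc, wedge_boundary]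
  abel

variable [Subsingleton (Module.Dual R Γ [⋀^Fin (n + 1)]→ₗ[R] N)]

theorem boundary_mul_scale (f : R) :
    boundary hs S E * scale f = scale f * boundary hs S E + contract (S.d₀ f) := by
  rw [← sub_eq_zero]
  refine op_eq_zero_of_wedge_anticomm hs.1 _ (fun w => ?_) fun X => ?_
  · change boundary hs S E (scale f w) n - (f • boundary hs S E w n +
      (w (n + 1)).curryLeft (S.d₀ f)) = 0
    rw [boundary_top, boundary_top, Subsingleton.elim (w (n + 1)) 0]
    simp
  · have wedge_boundary := wedgeOp_mul_boundary hs hδ X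
    have wedge_scale := wedgeOp_mul_scale (R := R) (N := N) f X
    have wedge_contract : (wedgeOp X * contract (S.d₀ f) :
        AddMonoid.End (Forms R (Module.Dual R Γ) N)) =
        scale (S.anchor X f) - contract (S.d₀ f) * wedgeOp X := wedgeOp_mul_contract X (S.d₀ f)
    have lie_scale := lieOp_mul_scale (S.adDual X) (δ X) f
    simp only [mul_sub, mul_add, sub_mul, add_mul, ← mul_assoc, wedge_boundary, wedge_scale,
      wedge_contract]
    simp only [mul_assoc, wedge_boundary, wedge_scale, lie_scale, mul_sub]
    abel

theorem wedgeOp_mul_boundaryContract (ξ : Module.Dual R Γ) (X : Γ) :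
    wedgeOp X * boundaryContract hs S E ξ = boundaryContract hs S E ξ * wedgeOp X +
      contract (S.adDual X ξ - S.d₀ (ξ X)) := by
  have wedge_boundary := wedgeOp_mul_boundary hs hδ X
  have wedge_contract := wedgeOp_mul_contract (N := N) X ξ
  have boundary_scale := boundary_mul_scale hs hδ (ξ X)
  have contract_lie := contract_mul_lieOp (S.adDual X) (δ X) ξ
  simp only [boundaryContract, mul_add, sub_mul, add_mul, ← mul_assoc, wedge_boundary,
    wedge_contract, map_sub]
  simp only [mul_sub, mul_assoc, wedge_boundary, wedge_contract, boundary_scale, contract_lie]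
  abel

theorem boundaryContract_mul_scale (ξ : Module.Dual R Γ) (f : R) :
    boundaryContract hs S E ξ * scale f = scale f * boundaryContract hs S E ξ := by
  have boundary_scale := boundary_mul_scale hs hδ f
  have contract_scale := contract_mul_scale (R := R) (N := N) f ξ
  have contract_anticomm := contract_anticomm (R := R) (N := N) ξ (S.d₀ f)
  simp only [boundaryContract, mul_add, add_mul]
  simp only [mul_assoc, contract_scale, boundary_scale, contract_anticomm, mul_add]
  simp only [← mul_assoc, contract_scale, boundary_scale, add_mul]
  abel

theorem contract_mul_boundaryContract (ξ η : Module.Dual R Γ) :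
    contract η * boundaryContract hs S E ξ = boundaryContract hs S E ξ * contract η := by
  rw [← sub_eq_zero]
  have contract_top (ζ : Module.Dual R Γ) (w : Forms R (Module.Dual R Γ) N) :
      contract ζ w n = 0 := by
    rw [contract_apply, Subsingleton.elim (w (n + 1)) 0]
    rfl
  have boundaryContract_top (w) : boundaryContract hs S E ξ w n = 0 := by
    change contract ξ (boundary hs S E w) n + boundary hs S E (contract ξ w) n = 0
    rw [contract_top, boundary_top, add_zero]
  refine op_eq_zero_of_wedge_anticomm hs.1 _ (fun w => ?_) fun X => ?_
  · change contract η (boundaryContract hs S E ξ w) n -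
      boundaryContract hs S E ξ (contract η w) n = 0
    rw [contract_top, boundaryContract_top, sub_zero]
  · have wedge_boundaryContract := wedgeOp_mul_boundaryContract hs hδ ξ X
    have wedge_contract := wedgeOp_mul_contract (N := N) X η
    have boundaryContract_scale := boundaryContract_mul_scale hs hδ ξ (η X)
    have contract_anticomm := contract_anticomm (R := R) (N := N) η (S.adDual X ξ - S.d₀ (ξ X))
    simp only [mul_sub, sub_mul, ← mul_assoc, wedge_boundaryContract, wedge_contract, add_mul]
    simp only [mul_sub, mul_add, mul_assoc, wedge_boundaryContract, wedge_contract,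
      boundaryContract_scale, contract_anticomm]
    abel

end Induced

theorem SkewAlgebroid.adDual_sharp (Λ : Bivector R Γ) (ξ η : Module.Dual R Γ) :
    S.adDual (Λ.sharp ξ) η = Λ.bracketAux S ξ η +
      (S.adDual (Λ.sharp η) ξ - S.d₀ (ξ (Λ.sharp η))) := by
  have skew : ξ (Λ.sharp η) = -Λ.toFun ξ η := Λ.toFun_skew η ξ
  rw [skew, S.d₀_neg, Bivector.bracketAux]
  abel

/-- The connection `E'` of `A*` on `L` is the degree-zero part of the commutator of `∂` and `Λ ∧ ·`,
in the form in which a contraction `ι_ξ` of that commutator produces it. -/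
def SkewAlgebroid.Connection.IsDerived {Λ : Bivector R Γ} (E' : (S.dualOf Λ).Connection N)
    (hs : Function.Bijective (starMap (R := R) (Γ := Γ) (N := N) n))
    (E : S.Connection (Module.Dual R Γ [⋀^Fin n]→ₗ[R] N)) (δ : ∀ X, DerivOp (S.anchor X) N) :
    Prop :=
  ∀ ξ (w : Forms R (Module.Dual R Γ) N) x, E'.act ξ (w 0 x) =
    δ (Λ.sharp ξ) (w 0 x) - boundaryContract hs S E ξ (Λ.wedgeOp w) 0 x

section Derived
variable [Subsingleton (Module.Dual R Γ [⋀^Fin (n + 1)]→ₗ[R] N)] (hδ : E.IsInducedBy δ)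
  {Λ : Bivector R Γ} {E' : (S.dualOf Λ).Connection N} (hE' : E'.IsDerived hs E δ)
include hδ hE'

theorem lieOp_dualOf (ξ : Module.Dual R Γ) :
    lieOp ((S.dualOf Λ).ad ξ) (E'.act ξ) = lieOp (S.adDual (Λ.sharp ξ)) (δ (Λ.sharp ξ)) +
      (Λ.wedgeOp * boundaryContract hs S E ξ - boundaryContract hs S E ξ * Λ.wedgeOp) := by
  rw [← sub_eq_zero]
  refine op_eq_zero_of_contract_comm _ (fun w => ?_) fun η => ?_
  · ext x
    change lieOp ((S.dualOf Λ).ad ξ) (E'.act ξ) w 0 x -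
      (lieOp (S.adDual (Λ.sharp ξ)) (δ (Λ.sharp ξ)) w 0 x +
        ((0 : N) - boundaryContract hs S E ξ (Λ.wedgeOp w) 0 x)) = 0
    rw [lieOp_zero_apply, lieOp_zero_apply, hE']
    abel
  · have contract_lie_dual : contract η * lieOp ((S.dualOf Λ).ad ξ) (E'.act ξ) =
        lieOp ((S.dualOf Λ).ad ξ) (E'.act ξ) * contract η - contract (Λ.bracketAux S ξ η) :=
      contract_mul_lieOp _ _ _
    have contract_lie := contract_mul_lieOp (S.adDual (Λ.sharp ξ)) (δ (Λ.sharp ξ)) η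
    have contract_boundaryContract := contract_mul_boundaryContract hs hδ ξ η
    have contract_bivector := Λ.contract_mul_wedgeOp (N := N) η
    have wedge_boundaryContract := wedgeOp_mul_boundaryContract hs hδ ξ (Λ.sharp η)
    rw [S.adDual_sharp, map_add] at contract_lie
    simp only [mul_sub, mul_add, sub_mul, add_mul, ← mul_assoc, contract_lie_dual, contract_lie,
      contract_boundaryContract, contract_bivector]
    simp only [mul_add, mul_assoc, contract_boundaryContract, contract_bivector,
      wedge_boundaryContract]
    abel

theorem dOp_dualOf : (S.dualOf Λ).dOp E' =
    Λ.wedgeOp * boundary hs S E - boundary hs S E * Λ.wedgeOp := by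
  rw [← sub_eq_zero]
  refine op_eq_zero_of_contract_anticomm _ (fun w => ?_) fun ξ => ?_
  · change 0 - (Λ.wedgeOp (boundary hs S E w) 0 - boundary hs S E (Λ.wedgeOp w) 0) = 0
    rw [boundary_zero_apply hs S E _ rfl, Λ.wedgeOp_zero_apply, sub_zero, sub_zero]
  · rw [mul_sub, sub_mul, contract_mul_derivedBracket hs hδ Λ, SkewAlgebroid.contract_mul_dOp,
      lieOp_dualOf hs hδ hE']
    abel

theorem dirac_dirac (d_sq : S.dOp E * S.dOp E = 0)
    (dual_d_sq : (S.dualOf Λ).dOp E' * (S.dualOf Λ).dOp E' = 0)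
    (a : Forms R (Module.Dual R Γ) N) :
    dirac S (S.dualOf Λ) hs E E' (dirac S (S.dualOf Λ) hs E E' a) = 0 := by
  have boundary_sq := boundary_mul_boundary hs S E d_sq
  have anticomm : (S.dualOf Λ).dOp E' * boundary hs S E +
      boundary hs S E * (S.dualOf Λ).dOp E' = 0 := by
    rw [dOp_dualOf hs hδ hE', sub_mul, mul_sub, mul_assoc, boundary_sq, ← mul_assoc,
      ← mul_assoc (boundary hs S E), boundary_sq]
    simp
  have dirac_sq : ((S.dualOf Λ).dOp E' + boundary hs S E) *
      ((S.dualOf Λ).dOp E' + boundary hs S E) = 0 := by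
    rw [mul_add, add_mul, add_mul, dual_d_sq, boundary_sq, zero_add, add_zero, add_comm, anticomm]
  rw [dirac_eq, dirac_eq]
  exact DFunLike.congr_fun dirac_sq a

end Derived
end DerivedBracket

section Jacobi
variable {R : Type*} [CommRing R] [Algebra ℝ R] {Γ : Type*} [AddCommGroup Γ] [Module R Γ]

theorem two_mul_cancel {a b : R} (h : 2 * a = 2 * b) : a = b := by
  rw [← half_smul_add_self (R := R) a, ← half_smul_add_self (R := R) b, ← two_mul, ← two_mul, h]

/-- The failure of `Λ♯` to preserve brackets. -/
def sharpDefect (S : SkewAlgebroid R Γ) (Λ : Bivector R Γ) (ξ η : Module.Dual R Γ) : Γ :=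
  S.bracket (Λ.sharp ξ) (Λ.sharp η) - Λ.sharp (Λ.bracketAux S ξ η)

section Skew
variable (S : SkewAlgebroid R Γ) (Λ : Bivector R Γ)

theorem sharp_bracketAux (ξ η : Module.Dual R Γ) : Λ.sharp (Λ.bracketAux S ξ η) =
    S.bracket (Λ.sharp ξ) (Λ.sharp η) - sharpDefect S Λ ξ η :=
  (sub_sub_cancel _ _).symm

theorem schouten_self (α β γ : Module.Dual R Γ) :
    schouten S Λ Λ α β γ = 2 * γ (sharpDefect S Λ α β) := by
  have γ_sharp_bracket : γ (Λ.sharp (Λ.bracketAux S α β)) = -Λ.bracketAux S α β (Λ.sharp γ) :=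
    Λ.toFun_skew _ γ
  have γ_sharp : γ (Λ.sharp α) = -α (Λ.sharp γ) := Λ.toFun_skew α γ
  have β_sharp : β (Λ.sharp α) = -α (Λ.sharp β) := Λ.toFun_skew α β
  have γ_bracket := congrArg γ (S.bracket_skew (Λ.sharp β) (Λ.sharp α))
  have α_bracket := congrArg α (S.bracket_skew (Λ.sharp γ) (Λ.sharp β))
  rw [map_neg] at γ_bracket α_bracket
  simp only [schouten, sharpDefect, map_sub, γ_sharp_bracket, Bivector.bracketAux_apply,
    adDual_apply, γ_sharp, β_sharp, γ_bracket, α_bracket, map_neg]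
  ring

theorem schouten_cyclic (α β γ : Module.Dual R Γ) :
    schouten S Λ Λ α β γ = schouten S Λ Λ β γ α := by
  simp only [schouten]
  ring

theorem sharpDefect_cyclic (α β γ : Module.Dual R Γ) :
    γ (sharpDefect S Λ α β) = α (sharpDefect S Λ β γ) :=
  two_mul_cancel (by rw [← schouten_self, ← schouten_self, schouten_cyclic])

theorem sharpDefect_skew (α β : Module.Dual R Γ) :
    sharpDefect S Λ α β = -sharpDefect S Λ β α := by
  have bracketAux_skew : Λ.bracketAux S α β = -Λ.bracketAux S β α := (S.dualOf Λ).bracket_skew α β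
  rw [sharpDefect, sharpDefect, bracketAux_skew, S.bracket_skew, map_neg]
  abel

theorem anchor_sharpDefect (hd : ∀ f β γ, schouten S Λ Λ (S.d₀ f) β γ = 0)
    (ξ η : Module.Dual R Γ) : S.anchor (sharpDefect S Λ ξ η) = 0 := by
  ext f
  change S.d₀ f (sharpDefect S Λ ξ η) = 0
  refine two_mul_cancel ?_
  rw [← schouten_self, ← schouten_cyclic, hd, mul_zero]

theorem sharpDefect_invariant (hΛ : ∀ X, bracketSection S (schouten S Λ Λ) X = 0)
    (α β γ : Module.Dual R Γ) (X : Γ) :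
    2 * S.anchor X (γ (sharpDefect S Λ α β)) = α (S.bracket X (sharpDefect S Λ β γ)) +
      β (S.bracket X (sharpDefect S Λ γ α)) + γ (S.bracket X (sharpDefect S Λ α β)) := by
  have invariant := congrFun (congrFun (congrFun (hΛ X) α) β) γ
  simp only [bracketSection, Pi.zero_apply] at invariant
  rw [schouten_cyclic S Λ (S.adDual X α) β γ, schouten_cyclic S Λ α (S.adDual X β) γ,
    schouten_cyclic S Λ (S.adDual X β) γ α] at invariant
  have anchor_cyclic := congrArg (S.anchor X) (sharpDefect_cyclic S Λ α β γ)
  have anchor_cyclic' := congrArg (S.anchor X) (sharpDefect_cyclic S Λ β γ α)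
  have anchor_two : S.anchor X (2 * γ (sharpDefect S Λ α β)) =
      2 * S.anchor X (γ (sharpDefect S Λ α β)) := by
    rw [two_mul, map_add, two_mul]
  simp only [schouten_self, adDual_apply, anchor_two] at invariant
  refine two_mul_cancel ?_
  linear_combination invariant + 4 * anchor_cyclic + 2 * anchor_cyclic'

end Skew

theorem bracketAux_cyclic_sum (S : SkewAlgebroid R Γ) (Λ : Bivector R Γ)
    (ξ η ζ : Module.Dual R Γ) :
    S.anchor (Λ.sharp ξ) (Λ.toFun η ζ) + Λ.toFun ξ (Λ.bracketAux S η ζ) +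
      S.anchor (Λ.sharp ζ) (Λ.toFun ξ η) - Λ.toFun (Λ.bracketAux S ξ η) ζ -
      S.anchor (Λ.sharp η) (Λ.toFun ξ ζ) - Λ.toFun η (Λ.bracketAux S ξ ζ) =
        2 * ζ (sharpDefect S Λ ξ η) := by
  have sharp_skew (α β : Module.Dual R Γ) : α (Λ.sharp β) = -β (Λ.sharp α) := Λ.toFun_skew β α
  have bracket_skew (α β γ : Module.Dual R Γ) := congrArg γ (S.bracket_skew (Λ.sharp α) (Λ.sharp β))
  simp only [map_neg] at bracket_skew
  have toFun_eq (α β : Module.Dual R Γ) : Λ.toFun α β = β (Λ.sharp α) := rfl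
  rw [← schouten_self, Λ.toFun_skew (Λ.bracketAux S ξ η)]
  simp only [schouten, toFun_eq, adDual_apply, Bivector.bracketAux_apply, bracket_skew ζ,
    bracket_skew η ξ, sharp_skew ξ, sharp_skew η ζ, map_neg]
  ring

namespace LieAlgebroid
variable (S : LieAlgebroid R Γ)

theorem adDual_bracket (X Y : Γ) (ξ : Module.Dual R Γ) :
    S.adDual (S.bracket X Y) ξ = S.adDual X (S.adDual Y ξ) - S.adDual Y (S.adDual X ξ) := by
  ext Z
  have jacobi := congrArg ξ (S.jacobi X Y Z)
  simp only [adDual_apply, LinearMap.sub_apply, S.anchor_bracket, map_sub, map_add,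
    Derivation.commutator_apply] at jacobi ⊢
  linear_combination jacobi

theorem adDual_d₀ (X : Γ) (f : R) : S.adDual X (S.d₀ f) = S.d₀ (S.anchor X f) := by
  ext Y
  have anchor_bracket := DFunLike.congr_fun (S.anchor_bracket X Y) f
  rw [Derivation.commutator_apply] at anchor_bracket
  change S.anchor X (S.anchor Y f) - S.anchor (S.bracket X Y) f = S.anchor Y (S.anchor X f)
  rw [anchor_bracket, sub_sub_cancel]

variable (Λ : Bivector R Γ)

theorem jacobiator_bracketAux (ξ η ζ : Module.Dual R Γ) :
    Λ.bracketAux S.toSkewAlgebroid ξ (Λ.bracketAux S.toSkewAlgebroid η ζ) -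
      Λ.bracketAux S.toSkewAlgebroid (Λ.bracketAux S.toSkewAlgebroid ξ η) ζ -
      Λ.bracketAux S.toSkewAlgebroid η (Λ.bracketAux S.toSkewAlgebroid ξ ζ) =
    S.adDual (sharpDefect S.toSkewAlgebroid Λ ξ η) ζ +
      S.adDual (sharpDefect S.toSkewAlgebroid Λ η ζ) ξ -
      S.adDual (sharpDefect S.toSkewAlgebroid Λ ξ ζ) η -
      S.d₀ (2 * ζ (sharpDefect S.toSkewAlgebroid Λ ξ η)) := by
  set A := S.toSkewAlgebroid
  have adDual_sharp_bracket (α β γ) : A.adDual (Λ.sharp (Λ.bracketAux A α β)) γ =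
      A.adDual (Λ.sharp α) (A.adDual (Λ.sharp β) γ) -
        A.adDual (Λ.sharp β) (A.adDual (Λ.sharp α) γ) - A.adDual (sharpDefect A Λ α β) γ := by
    rw [sharp_bracketAux, A.adDual_sub, S.adDual_bracket]
  have adDual_bracketAux (α β γ) : A.adDual (Λ.sharp α) (Λ.bracketAux A β γ) =
      A.adDual (Λ.sharp α) (A.adDual (Λ.sharp β) γ) -
        A.adDual (Λ.sharp α) (A.adDual (Λ.sharp γ) β) -
        A.d₀ (A.anchor (Λ.sharp α) (Λ.toFun β γ)) := by
    rw [Bivector.bracketAux, map_sub, map_sub, S.adDual_d₀]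
  have bracketAux_eq (α β) : Λ.bracketAux A α β =
      A.adDual (Λ.sharp α) β - A.adDual (Λ.sharp β) α - A.d₀ (Λ.toFun α β) := rfl
  rw [← bracketAux_cyclic_sum, bracketAux_eq ξ (Λ.bracketAux A η ζ),
    bracketAux_eq (Λ.bracketAux A ξ η) ζ, bracketAux_eq η (Λ.bracketAux A ξ ζ)]
  simp only [adDual_sharp_bracket, adDual_bracketAux, A.d₀_sub, A.d₀_add]
  abel

theorem bracketAux_jacobi
    (hΛ : ∀ X, bracketSection S.toSkewAlgebroid (schouten S.toSkewAlgebroid Λ Λ) X = 0)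
    (hN : ∀ ξ η, S.anchor (sharpDefect S.toSkewAlgebroid Λ ξ η) = 0) (ξ η ζ : Module.Dual R Γ) :
    Λ.bracketAux S.toSkewAlgebroid ξ (Λ.bracketAux S.toSkewAlgebroid η ζ) =
      Λ.bracketAux S.toSkewAlgebroid (Λ.bracketAux S.toSkewAlgebroid ξ η) ζ +
      Λ.bracketAux S.toSkewAlgebroid η (Λ.bracketAux S.toSkewAlgebroid ξ ζ) := by
  rw [← sub_eq_zero, ← sub_sub, S.jacobiator_bracketAux Λ]
  ext X
  have invariant := sharpDefect_invariant S.toSkewAlgebroid Λ hΛ ξ η ζ X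
  have bracket_skew (V : Γ) := S.bracket_skew V X
  have anchor_two (f : R) : S.anchor X (2 * f) = 2 * S.anchor X f := by
    rw [two_mul, map_add, two_mul]
  rw [sharpDefect_skew _ _ ζ ξ] at invariant
  simp only [LinearMap.sub_apply, LinearMap.add_apply, LinearMap.zero_apply, adDual_apply, hN,
    Derivation.zero_apply, bracket_skew, map_neg, S.d₀_apply, anchor_two] at invariant ⊢
  linear_combination -invariant

/-- The Lie algebroid structure on `A*` of an exact Lie bialgebroid. -/
def exactDual
    (hΛ : ∀ X, bracketSection S.toSkewAlgebroid (schouten S.toSkewAlgebroid Λ Λ) X = 0)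
    (hd : ∀ f β γ, schouten S.toSkewAlgebroid Λ Λ (S.d₀ f) β γ = 0) :
    LieAlgebroid R (Module.Dual R Γ) where
  toSkewAlgebroid := S.toSkewAlgebroid.dualOf Λ
  jacobi := S.bracketAux_jacobi Λ hΛ (anchor_sharpDefect _ Λ hd)
  anchor_bracket ξ η := by
    have anchor_defect := anchor_sharpDefect S.toSkewAlgebroid Λ hd ξ η
    rw [sharpDefect, map_sub, S.anchor_bracket, sub_eq_zero] at anchor_defect
    exact anchor_defect.symm

end LieAlgebroid
end Jacobi

section Frames
variable {R : Type*} [CommRing R] {V Q : Type*} [AddCommGroup V] [Module R V]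
  [AddCommGroup Q] [Module R Q]

/-- `e` and `ε` are dual frames of `V` on the locus where `r` does not vanish. Working with
multiples by `r` replaces the restriction of a bundle to an open set. -/
structure IsFrame (r : R) {n : ℕ} (e : Fin n → V) (ε : Fin n → Module.Dual R V) : Prop where
  span : ∀ X, r • X = r • ∑ i, ε i X • e i
  dual : ∀ i j, r * ε i (e j) = if i = j then r else 0

theorem smul_map_eq_of_smul_eq {ι : Type*} [Finite ι] (f : MultilinearMap R (fun _ : ι => V) Q)
    (r : R) {v w : ι → V} (h : ∀ l, r • v l = r • w l) : r • f v = r • f w := by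
  classical
  cases nonempty_fintype ι
  have replace_on : ∀ s : Finset ι, r • f (s.piecewise w v) = r • f v := by
    intro s
    induction s using Finset.induction_on with
    | empty => simp
    | insert l s hl ih =>
      rw [Finset.piecewise_insert, ← f.map_update_smul, ← h l, f.map_update_smul, ← ih]
      congr 2
      rw [← Finset.piecewise_eq_of_notMem s w v hl, Function.update_eq_self]
  simpa using (replace_on Finset.univ).symm

namespace IsFrame
variable {r : R} {n : ℕ} {e : Fin n → V} {ε : Fin n → Module.Dual R V}

theorem mul (h : IsFrame r e ε) (s : R) : IsFrame (s * r) e ε where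
  span X := by rw [mul_smul, h.span, mul_smul]
  dual i j := by simp [mul_assoc, h.dual]

theorem sq (h : IsFrame r e ε) : IsFrame (r ^ 2) e ε := by
  rw [pow_two]
  exact h.mul r

theorem span_dual (h : IsFrame r e ε) (ξ : Module.Dual R V) :
    r • ξ = r • ∑ i, ξ (e i) • ε i := by
  ext X
  have hX := congrArg ξ (h.span X)
  simpa [mul_comm] using hX

theorem toDual (h : IsFrame r e ε) : IsFrame r ε (fun i => Module.Dual.eval R V (e i)) where
  span := h.span_dual
  dual i j := by simp [h.dual, eq_comm]

theorem smul_sum_linearMap (h : IsFrame r e ε) (f : V →ₗ[R] Q) (X : V) :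
    r • ∑ i, ε i X • f (e i) = r • f X := by
  simpa using (congrArg f (h.span X)).symm

theorem smul_trace_rankOne (h : IsFrame r e ε) (φ : Module.Dual R V) (x : V) :
    r * ∑ i, ε i (φ.smulRight x (e i)) = r * φ x := by
  simpa [mul_comm] using h.smul_sum_linearMap φ x

theorem smul_map (h : IsFrame r e ε) {k : ℕ} (f : V [⋀^Fin k]→ₗ[R] Q) (v : Fin k → V) :
    r • f v = r • f.compLinearMap (Fintype.linearCombination R e) (fun l i => ε i (v l)) := by
  rw [AlternatingMap.compLinearMap_apply]
  refine smul_map_eq_of_smul_eq f.toMultilinearMap r fun l => ?_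
  rw [h.span, Fintype.linearCombination_apply]

theorem smul_eq_zero_of_lt (h : IsFrame r e ε) {k : ℕ} (hk : n < k) (f : V [⋀^Fin k]→ₗ[R] Q) :
    r • f = 0 := by
  have vanish : f.compLinearMap (Fintype.linearCombination R e) = 0 :=
    (Pi.basisFun R (Fin n)).ext_alternating fun w hw =>
      absurd (Fintype.card_le_of_injective w hw) (by simpa using hk)
  ext v
  simp [h.smul_map, vanish]

theorem smul_ext (h : IsFrame r e ε) {f g : V [⋀^Fin n]→ₗ[R] Q} (hfg : r • f e = r • g e) :
    r • f = r • g := by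
  have perm : ∀ (f : V [⋀^Fin n]→ₗ[R] Q) (σ : Equiv.Perm (Fin n)),
      (r • f).compLinearMap (Fintype.linearCombination R e)
        (fun i => Pi.basisFun R (Fin n) (σ i)) = Equiv.Perm.sign σ • r • f e := fun f σ => by
    rw [← AlternatingMap.smul_apply, ← (r • f).map_perm, AlternatingMap.compLinearMap_apply]
    congr 1
    ext
    simp
  have pulled : (r • f).compLinearMap (Fintype.linearCombination R e) =
      (r • g).compLinearMap (Fintype.linearCombination R e) :=
    (Pi.basisFun R (Fin n)).ext_alternating fun w hw => by
      let σ := Equiv.ofBijective w (Finite.injective_iff_bijective.mp hw)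
      exact (perm f σ).trans ((congrArg _ hfg).trans (perm g σ).symm)
  ext v
  rw [AlternatingMap.smul_apply, AlternatingMap.smul_apply, h.smul_map, h.smul_map]
  exact DFunLike.congr_fun pulled _

theorem smul_top_comm (h : IsFrame r e ε) (P : V [⋀^Fin n]→ₗ[R] R) (P' : V [⋀^Fin n]→ₗ[R] Q)
    (v w : Fin n → V) : r • P v • P' w = r • P w • P' v := by
  have at_frame : ∀ v, r • P v • P' e = r • P e • P' v := fun v => by
    simpa using DFunLike.congr_fun (h.smul_ext (g := P e • P')
      (f := (LinearMap.toSpanSingleton R Q (P' e)).compAlternatingMap P) (by simp)) v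
  simpa using DFunLike.congr_fun (h.smul_ext (f := P v • P')
    (g := (LinearMap.toSpanSingleton R Q (P' v)).compAlternatingMap P)
    (by simpa using at_frame v)) w

end IsFrame

/-- The form `ε₁ ∧ … ∧ εₙ`. For a frame `ε` of `Γ(A*)` this is the local volume form. -/
def topForm {n : ℕ} (ε : Fin n → Module.Dual R V) : V [⋀^Fin n]→ₗ[R] R :=
  Matrix.detRowAlternating.compLinearMap (LinearMap.pi ε)

theorem IsFrame.mul_topForm {r : R} {n : ℕ} {e : Fin n → V} {ε : Fin n → Module.Dual R V}
    (h : IsFrame r e ε) : r * topForm ε e = r := by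
  refine (smul_map_eq_of_smul_eq (Matrix.detRowAlternating (R := R) (n := Fin n)).toMultilinearMap
    r (v := fun j i => ε i (e j)) (w := (1 : Matrix (Fin n) (Fin n) R)) fun l => ?_).trans ?_
  · ext i
    simp only [Pi.smul_apply, smul_eq_mul, h.dual, Matrix.one_apply, mul_ite, mul_one, mul_zero,
      eq_comm]
  · exact (congrArg (r * ·) Matrix.det_one).trans (mul_one r)

end Frames

section Trace
variable {R : Type*} [CommRing R] {V Q : Type*} [AddCommGroup V] [Module R V]
  [AddCommGroup Q] [Module R Q]
variable {r : R} {n : ℕ} {e : Fin n → V} {ε : Fin n → Module.Dual R V}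

/-- A linear map as an operator over the zero derivation. -/
def DerivOp.ofLinear [Algebra ℝ R] (K : V →ₗ[R] V) : DerivOp (0 : Derivation ℝ R R) V where
  toFun := K.toAddMonoidHom
  leibniz f x := by simp

theorem IsFrame.smul_sum_update_linearMap [Algebra ℝ R] (h : IsFrame r e ε) (K : V →ₗ[R] V)
    (f : V [⋀^Fin n]→ₗ[R] Q) (v : Fin n → V) :
    r • ∑ l, f (Function.update v l (K (v l))) = r • (∑ i, ε i (K (e i))) • f v := by
  set θ := -(DerivOp.ofLinear K).alt (DerivOp.ofLinear (0 : Q →ₗ[R] Q)) n f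
  have θ_apply : ∀ v, θ v = ∑ l, f (Function.update v l (K (v l))) := fun v => by
    simp [θ, DerivOp.ofLinear]
  have at_frame : r • θ e = r • ((∑ i, ε i (K (e i))) • f) e := by
    rw [θ_apply, AlternatingMap.smul_apply, Finset.sum_smul, Finset.smul_sum, Finset.smul_sum]
    refine Finset.sum_congr rfl fun l _ => ?_
    rw [← f.map_update_smul, h.span, f.map_update_smul, f.map_update_sum,
      Finset.sum_eq_single l, f.map_update_smul, Function.update_eq_self]
    · intro i _ hi
      rw [f.map_update_smul, f.map_update_self _ hi.symm, smul_zero]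
    · simp
  rw [← θ_apply]
  exact DFunLike.congr_fun (h.smul_ext at_frame) v

theorem IsFrame.smul_sum_update_rankOne [Algebra ℝ R] (h : IsFrame r e ε) (φ : Module.Dual R V)
    (x : V) (f : V [⋀^Fin n]→ₗ[R] Q) (v : Fin n → V) :
    r • ∑ l, φ (v l) • f (Function.update v l x) = r • φ x • f v := by
  have contraction := h.smul_sum_update_linearMap (φ.smulRight x) f v
  rw [← mul_smul, h.smul_trace_rankOne, mul_smul] at contraction
  simpa only [LinearMap.smulRight_apply, f.map_update_smul] using contraction

end Trace

section Gluing
variable {R : Type*} [CommRing R] {I : Type*} (r : I → R)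

/-- Elements of `P` are determined by their multiples with the `r i`. -/
def Separates (P : Type*) [AddCommGroup P] [Module R P] : Prop :=
  ∀ x : P, (∀ i, r i • x = 0) → x = 0

/-- Compatible families of multiples with the `r i` come from elements of `P`. -/
def Glues (P : Type*) [AddCommGroup P] [Module R P] : Prop :=
  ∀ a : I → P, (∀ i j, r i • a j = r j • a i) → ∃ b, ∀ i, r i • b = a i

variable {r} {P : Type*} [AddCommGroup P] [Module R P] {V : Type*} [AddCommGroup V] [Module R V]

theorem Separates.eq (h : Separates r P) {x y : P} (hxy : ∀ i, r i • x = r i • y) : x = y :=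
  sub_eq_zero.mp (h _ fun i => by rw [smul_sub, hxy, sub_self])

theorem Separates.of_sq (h : Separates (fun i => r i ^ 2) P) : Separates r P := fun x hx =>
  h x fun i => by simp only [pow_two, mul_smul, hx, smul_zero]

theorem Separates.linearMap (h : Separates r P) : Separates r (V →ₗ[R] P) := fun _ hf =>
  LinearMap.ext fun v => h _ fun i => DFunLike.congr_fun (hf i) v

theorem Separates.alternating (h : Separates r P) {k : ℕ} : Separates r (V [⋀^Fin k]→ₗ[R] P) :=
  fun _ hf => AlternatingMap.ext fun v => h _ fun i => DFunLike.congr_fun (hf i) v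

theorem Glues.alternating (h : Glues r P) (hs : Separates r P) {k : ℕ} :
    Glues r (V [⋀^Fin k]→ₗ[R] P) := fun a ha => by
  choose b hb using fun v => h (fun i => a i v) fun i j => DFunLike.congr_fun (ha i j) v
  refine ⟨{ toFun := b, map_update_add' := ?_, map_update_smul' := ?_, map_eq_zero_of_eq' := ?_ },
    fun i => by ext v; exact hb v i⟩
  · intro _ v l x y
    refine hs.eq fun i => ?_
    rw [smul_add, hb, hb, hb, (a i).map_update_add]
  · intro _ v l c x
    refine hs.eq fun i => ?_
    rw [smul_comm, hb, hb, (a i).map_update_smul]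
  · intro v l l' hv hl
    refine hs _ fun i => ?_
    rw [hb, (a i).map_eq_zero_of_eq v hv hl]

theorem Separates.alternating_subsingleton (h : Separates r P) {n : ℕ} {e : I → Fin n → V}
    {ε : I → Fin n → Module.Dual R V} (hf : ∀ i, IsFrame (r i) (e i) (ε i)) {k : ℕ} (hk : n < k) :
    Subsingleton (V [⋀^Fin k]→ₗ[R] P) :=
  subsingleton_of_forall_eq 0 fun a => h.alternating _ fun i => (hf i).smul_eq_zero_of_lt hk a

end Gluing

section Euler
variable {R : Type*} [CommRing R]
variable {Γ N : Type*} [AddCommGroup Γ] [Module R Γ] [AddCommGroup N] [Module R N]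

theorem wedgeAux_eq_alternatizeUncurryFin {k : ℕ} (X : Γ) (a : Module.Dual R Γ [⋀^Fin k]→ₗ[R] N) :
    wedgeAux X a =
      AlternatingMap.alternatizeUncurryFin ((Module.Dual.eval R Γ X).smulRight a) := rfl

variable {r : R} {n : ℕ} {e : Fin n → Γ} {ε : Fin n → Module.Dual R Γ}

theorem IsFrame.smul_sum_wedgeAux_curryLeft (h : IsFrame r e ε) {k : ℕ}
    (u : Module.Dual R Γ [⋀^Fin (k + 1)]→ₗ[R] N) :
    r • ∑ i, wedgeAux (e i) (u.curryLeft (ε i)) = r • (k + 1) • u := by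
  have expand : r • ∑ i, (Module.Dual.eval R Γ (e i)).smulRight (u.curryLeft (ε i)) =
      r • u.curryLeft := by
    ext1 ξ
    simpa using h.toDual.smul_sum_linearMap u.curryLeft ξ
  rw [← AlternatingMap.alternatizeUncurryFin_curryLeft]
  simp only [wedgeAux_eq_alternatizeUncurryFin, ← AlternatingMap.alternatizeUncurryFinLM_apply]
  rw [← map_sum, ← map_smul, ← map_smul, expand]

theorem IsFrame.smul_sum_curryLeft_wedgeAux (h : IsFrame r e ε) {k : ℕ}
    (u : Module.Dual R Γ [⋀^Fin k]→ₗ[R] N) :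
    r • ∑ i, (wedgeAux (e i) u).curryLeft (ε i) + r • k • u = r • n • u := by
  have trace : r • ∑ i, ε i (e i) • u = r • n • u := by
    rw [Finset.smul_sum]
    simp only [smul_smul, h.dual, if_true, Finset.sum_const, Finset.card_univ, Fintype.card_fin]
    rw [smul_comm]
  rw [← trace]
  cases k with
  | zero => simp only [curryLeft_wedgeAux_zero, zero_smul, smul_zero, add_zero]
  | succ k =>
    rw [← h.smul_sum_wedgeAux_curryLeft]
    simp only [curryLeft_wedgeAux, Finset.sum_sub_distrib, smul_sub, sub_add_cancel]

theorem inv_natCast_smul_nsmul [Algebra ℝ R] {P : Type*} [AddCommGroup P] [Module R P] {k : ℕ}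
    (hk : k ≠ 0) (x : P) : algebraMap ℝ R (k : ℝ)⁻¹ • k • x = x := by
  rw [← Nat.cast_smul_eq_nsmul R, smul_smul, ← map_natCast (algebraMap ℝ R), ← map_mul,
    inv_mul_cancel₀ (Nat.cast_ne_zero.mpr hk), map_one, one_smul]

theorem IsFrame.exists_wedgeAux_eq [Algebra ℝ R] (h : IsFrame r e ε) {k : ℕ} (hk : k < n)
    (b : Γ →ₗ[R] Module.Dual R Γ [⋀^Fin (k + 1)]→ₗ[R] N)
    (skew : ∀ X Y, wedgeAux X (b Y) = -wedgeAux Y (b X)) :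
    ∃ a, ∀ X, r • wedgeAux X a = r • b X := by
  obtain ⟨j, rfl⟩ := Nat.exists_eq_add_of_lt hk
  set a := ∑ p, (b (e p)).curryLeft (ε p)
  have wedge_term : ∀ X p, wedgeAux X ((b (e p)).curryLeft (ε p)) =
      ε p X • b (e p) + (wedgeAux (e p) (b X)).curryLeft (ε p) := fun X p => by
    rw [eq_sub_of_add_eq' (eq_sub_iff_add_eq.mp (curryLeft_wedgeAux (ε p) X (b (e p)))), skew,
      sub_eq_add_neg]
    congr 1
    ext
    simp
  have wedge_sum : ∀ X, r • wedgeAux X a = r • (j + 1) • b X := fun X => by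
    have euler := h.smul_sum_curryLeft_wedgeAux (b X)
    have split_rank : (k + j + 1) • b X = j • b X + (k + 1) • b X := by
      rw [← add_smul]
      congr 1
      omega
    rw [split_rank, smul_add, add_left_inj] at euler
    simp only [a, map_sum, wedge_term, Finset.sum_add_distrib, smul_add]
    rw [h.smul_sum_linearMap, euler, ← smul_add, add_smul, one_smul, add_comm (b X)]
  refine ⟨algebraMap ℝ R ((j + 1 : ℕ) : ℝ)⁻¹ • a, fun X => ?_⟩
  rw [map_smul, smul_comm, wedge_sum, smul_comm, inv_natCast_smul_nsmul j.succ_ne_zero]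

end Euler

section StarComponent
variable {R : Type*} [CommRing R]
variable {Γ N : Type*} [AddCommGroup Γ] [Module R Γ] [AddCommGroup N] [Module R N]

variable (R Γ N) in
/-- The component of `starMap n` from degree `k` to degree `j`; it vanishes unless `k + j = n`. -/
def starComp (n k j : ℕ) : (Module.Dual R Γ [⋀^Fin k]→ₗ[R] N) →ₗ[R]
    Γ [⋀^Fin j]→ₗ[R] (Module.Dual R Γ [⋀^Fin n]→ₗ[R] N) :=
  LinearMap.proj j ∘ₗ starHom R Γ N n ∘ₗ
    LinearMap.single R (fun k => Module.Dual R Γ [⋀^Fin k]→ₗ[R] N) k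

variable {n k j : ℕ}

theorem starComp_apply (a : Module.Dual R Γ [⋀^Fin k]→ₗ[R] N) :
    starComp R Γ N n k j a = starMap n (Pi.single k a : Forms R (Module.Dual R Γ) N) j := rfl

theorem starMap_eq_starComp (h : k + j = n) (a : Forms R (Module.Dual R Γ) N) :
    starMap n a j = starComp R Γ N n k j (a k) :=
  starMap_congr n _ _ fun k' hk' => by
    obtain rfl : k' = k := by omega
    simp

theorem starComp_wedgeAux (h : k + (j + 1) = n) (X : Γ) (a : Module.Dual R Γ [⋀^Fin k]→ₗ[R] N) :
    starComp R Γ N n (k + 1) j (wedgeAux X a) =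
      (-1 : ℤ) ^ j • (starComp R Γ N n k (j + 1) a).curryLeft X := by
  have image := congrFun (starMap_wedgeOp n X (Pi.single k a : Forms R (Module.Dual R Γ) N)) j
  rw [starMap_eq_starComp (k := k + 1) (by omega), wedgeOp_succ_apply, Pi.single_eq_same] at image
  exact image

theorem curryLeft_curryLeft_skew {V : Type*} [AddCommGroup V] [Module R V]
    (θ : V [⋀^Fin (k + 2)]→ₗ[R] N) (X Y : V) :
    (θ.curryLeft X).curryLeft Y = -(θ.curryLeft Y).curryLeft X := by
  have polarized := θ.curryLeft_same (X + Y)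
  simp only [map_add, AlternatingMap.curryLeft_add, LinearMap.add_apply, θ.curryLeft_same,
    zero_add, add_zero] at polarized
  exact eq_neg_of_add_eq_zero_right polarized

end StarComponent

section StarBijective
variable {R : Type*} [CommRing R] [Algebra ℝ R]
variable {Γ N : Type*} [AddCommGroup Γ] [Module R Γ] [AddCommGroup N] [Module R N]
variable {I : Type*} {r : I → R} {n : ℕ} {e : I → Fin n → Γ} {ε : I → Fin n → Module.Dual R Γ}
  (hf : ∀ i, IsFrame (r i) (e i) (ε i)) (hN : Separates r N)
include hf hN

theorem starComp_injective {k j : ℕ} (h : k + j = n) :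
    Function.Injective (starComp R Γ N n k j) := by
  refine (injective_iff_map_eq_zero _).mpr fun a ha => ?_
  induction j generalizing k with
  | zero =>
    obtain rfl : k = n := h
    have value := DFunLike.congr_fun ha ![]
    rwa [starComp_apply, starMap_zero_apply, Pi.single_eq_same] at value
  | succ j ih =>
    have wedge_zero : ∀ X, wedgeAux X a = 0 := fun X =>
      ih (by omega) _ (by
        rw [starComp_wedgeAux h, ha, AlternatingMap.curryLeft_zero, LinearMap.zero_apply,
          smul_zero])
    refine hN.alternating _ fun i => ?_
    have euler := (hf i).smul_sum_curryLeft_wedgeAux a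
    simp only [wedge_zero, AlternatingMap.curryLeft_zero, LinearMap.zero_apply,
      Finset.sum_const_zero, smul_zero, zero_add] at euler
    have rank_split : n • a = k • a + (j + 1) • a := by rw [← add_smul, h]
    rw [rank_split, smul_add, left_eq_add, smul_comm] at euler
    rw [← inv_natCast_smul_nsmul (R := R) j.succ_ne_zero (r i • a), euler, smul_zero]

theorem wedgeAux_skew_of_starComp_eq {k j : ℕ} (h : k + (j + 1) = n)
    (θ : Γ [⋀^Fin (j + 1)]→ₗ[R] (Module.Dual R Γ [⋀^Fin n]→ₗ[R] N))
    (b : Γ → Module.Dual R Γ [⋀^Fin (k + 1)]→ₗ[R] N)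
    (hb : ∀ X, starComp R Γ N n (k + 1) j (b X) = (-1 : ℤ) ^ j • θ.curryLeft X) (X Y : Γ) :
    wedgeAux X (b Y) = -wedgeAux Y (b X) := by
  cases j with
  | zero =>
    have := hN.alternating_subsingleton (fun i => (hf i).toDual) (show n < k + 1 + 1 by omega)
    exact Subsingleton.elim _ _
  | succ j =>
    refine starComp_injective hf hN (k := k + 2) (j := j) (by omega) ?_
    have star_wedge : ∀ X Y, starComp R Γ N n (k + 2) j (wedgeAux X (b Y)) =
        -(θ.curryLeft Y).curryLeft X := fun X Y => by
      rw [starComp_wedgeAux (by omega), hb, pow_succ, mul_neg_one, neg_smul]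
      ext
      simp [smul_smul, ← mul_pow]
    rw [map_neg, star_wedge, star_wedge, curryLeft_curryLeft_skew]

theorem exists_smul_starComp_eq {k j : ℕ} (h : k + (j + 1) = n)
    (surj : Function.Surjective (starComp R Γ N n (k + 1) j))
    (θ : Γ [⋀^Fin (j + 1)]→ₗ[R] (Module.Dual R Γ [⋀^Fin n]→ₗ[R] N)) (i : I) :
    ∃ a, r i • starComp R Γ N n k (j + 1) a = r i • θ := by
  let σ := LinearEquiv.ofBijective _ ⟨starComp_injective hf hN (by omega), surj⟩
  let b : Γ →ₗ[R] Module.Dual R Γ [⋀^Fin (k + 1)]→ₗ[R] N :=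
    σ.symm.toLinearMap ∘ₗ ((-1 : ℤ) ^ j • θ.curryLeft)
  have hb : ∀ X, starComp R Γ N n (k + 1) j (b X) = (-1 : ℤ) ^ j • θ.curryLeft X := fun X =>
    σ.apply_symm_apply _
  obtain ⟨a, ha⟩ := (hf i).exists_wedgeAux_eq (by omega) b
    (wedgeAux_skew_of_starComp_eq hf hN h θ b hb)
  refine ⟨a, AlternatingMap.ext fun x => ?_⟩
  have image := congrArg (starComp R Γ N n (k + 1) j) (ha (x 0))
  rw [map_smul, map_smul, starComp_wedgeAux h, hb, smul_comm, smul_comm (r i)] at image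
  have unsigned := congrArg ((-1 : ℤ) ^ j • ·) image
  simp only [smul_smul, ← mul_pow, neg_one_mul, neg_neg, one_pow, one_smul] at unsigned
  have value := DFunLike.congr_fun unsigned (Fin.tail x)
  simp only [AlternatingMap.smul_apply, AlternatingMap.curryLeft_apply_apply] at value
  rwa [show Matrix.vecCons (x 0) (Fin.tail x) = x from Fin.cons_self_tail x] at value

theorem starComp_surjective (hG : Glues r N) {k j : ℕ} (h : k + j = n) :
    Function.Surjective (starComp R Γ N n k j) := by
  induction j generalizing k with
  | zero =>
    obtain rfl : k = n := h
    refine fun θ => ⟨θ ![], AlternatingMap.ext fun x => ?_⟩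
    rw [starComp_apply, starMap_zero_apply, Pi.single_eq_same, Subsingleton.elim x ![]]
  | succ j ih =>
    intro θ
    choose a ha using exists_smul_starComp_eq hf hN h (ih (by omega)) θ
    obtain ⟨c, hc⟩ := hG.alternating hN (fun i => r i • a i) fun i l =>
      starComp_injective hf hN h (by simp only [map_smul]; rw [ha, ha, smul_comm])
    refine ⟨c, hN.alternating.alternating.eq fun i => ?_⟩
    rw [← map_smul, hc, map_smul, ha]

theorem starMap_injective : Function.Injective (starMap (R := R) (Γ := Γ) (N := N) n) := by
  refine (injective_iff_map_eq_zero (starHom R Γ N n)).mpr fun a ha => funext fun k => ?_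
  rcases le_or_gt k n with hk | hk
  · refine (injective_iff_map_eq_zero _).mp (starComp_injective hf hN (Nat.add_sub_of_le hk)) _ ?_
    rw [← starMap_eq_starComp (Nat.add_sub_of_le hk)]
    exact congrFun ha _
  · have := hN.alternating_subsingleton (fun i => (hf i).toDual) hk
    exact Subsingleton.elim _ _

theorem starMap_bijective (hG : Glues r N) :
    Function.Bijective (starMap (R := R) (Γ := Γ) (N := N) n) := by
  refine ⟨starMap_injective hf hN, fun θ => ?_⟩
  choose a ha using fun k : Fin (n + 1) =>
    starComp_surjective hf hN hG (Nat.add_sub_of_le k.is_le) (θ (n - k))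
  refine ⟨fun k => if hk : k < n + 1 then a ⟨k, hk⟩ else 0, funext fun j => ?_⟩
  rcases le_or_gt j n with hj | hj
  · obtain ⟨k, rfl⟩ := Nat.exists_eq_add_of_le' hj
    rw [starMap_eq_starComp rfl, dif_pos (by omega)]
    have component := ha ⟨k, by omega⟩
    rwa [show k + j - k = j from Nat.add_sub_cancel_left k j] at component
  · have := hN.alternating.alternating_subsingleton
      (P := Module.Dual R Γ [⋀^Fin n]→ₗ[R] N) hf hj
    exact Subsingleton.elim _ _

end StarBijective

section LineFrame
variable {R : Type*} [CommRing R] {N : Type*} [AddCommGroup N] [Module R N]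

/-- Where `r` is invertible, `N` is free of rank one with generator `l` and coordinate `c`: the
usual identities are required only after multiplication by `r`. -/
structure IsLineFrame (r : R) (l : N) (c : Module.Dual R N) : Prop where
  span : ∀ x, r • x = r • c x • l
  dual : r * c l = r

/-- Contraction of the second tensor factor with a functional. -/
def contractSnd (c : Module.Dual R N) : N ⊗[R] N →ₗ[R] N :=
  TensorProduct.lift ((LinearMap.lsmul R N).flip.compl₂ c)

@[simp] theorem contractSnd_tmul (c : Module.Dual R N) (x y : N) :
    contractSnd c (x ⊗ₜ y) = c y • x := rfl

namespace IsLineFrame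
variable {r : R} {l : N} {c : Module.Dual R N}

theorem mul (h : IsLineFrame r l c) (s : R) : IsLineFrame (s * r) l c where
  span x := by rw [mul_smul, h.span, mul_smul]
  dual := by rw [mul_assoc, h.dual]

theorem sq (h : IsLineFrame r l c) : IsLineFrame (r ^ 2) l c := by
  rw [pow_two]
  exact h.mul r

theorem smul_tmul (h : IsLineFrame r l c) (x y : N) :
    r • (x ⊗ₜ[R] y) = r • (c x * c y) • (l ⊗ₜ[R] l) := by
  rw [TensorProduct.smul_tmul', h.span, TensorProduct.smul_tmul, TensorProduct.smul_tmul,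
    smul_comm, h.span]
  simp only [TensorProduct.tmul_smul, map_smul, smul_eq_mul, mul_smul]

theorem smul_tmul_comm (h : IsLineFrame r l c) (x y : N) :
    r • (x ⊗ₜ[R] y) = r • (y ⊗ₜ[R] x) := by
  rw [h.smul_tmul, h.smul_tmul, mul_comm]

theorem smul_tensor (h : IsLineFrame r l c) (t : N ⊗[R] N) :
    r • t = r • c (contractSnd c t) • (l ⊗ₜ[R] l) := by
  induction t using TensorProduct.induction_on with
  | zero => simp
  | tmul x y => rw [h.smul_tmul, contractSnd_tmul, map_smul, smul_eq_mul, mul_comm]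
  | add x y hx hy => rw [smul_add, hx, hy, map_add, map_add, add_smul, smul_add]

theorem smul_eq_zero_of_tmul (h : IsLineFrame r l c) {z : N} (hz : r • (z ⊗ₜ[R] l) = 0) :
    r • z = 0 := by
  have contracted := congrArg (contractSnd c) hz
  rwa [map_smul, contractSnd_tmul, smul_smul, h.dual, map_zero] at contracted

end IsLineFrame

end LineFrame

section RootUniqueness
variable {R : Type*} [CommRing R] [Algebra ℝ R] {N : Type*} [AddCommGroup N] [Module R N]

variable (R) in
theorem eq_zero_of_add_self {P : Type*} [AddCommGroup P] [Module R P] {x : P} (h : x + x = 0) :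
    x = 0 := by
  rw [← half_smul_add_self (R := R) x, h, smul_zero]

theorem IsLineFrame.smul_eq_zero_of_tmul_add {r : R} {l : N} {c : Module.Dual R N}
    (h : IsLineFrame r l c) {κ : N → N}
    (hκ : ∀ x y, r • (κ x ⊗ₜ[R] y + x ⊗ₜ[R] κ y) = 0) (x : N) : r • κ x = 0 := by
  have generator : r • κ l = 0 := by
    refine eq_zero_of_add_self R ?_
    have diagonal := hκ l l
    rw [smul_add, h.smul_tmul_comm l, ← smul_add, ← TensorProduct.add_tmul] at diagonal
    rw [← smul_add]
    exact h.smul_eq_zero_of_tmul diagonal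
  have against_generator := hκ x l
  rw [smul_add, TensorProduct.smul_tmul' r x, TensorProduct.smul_tmul, generator,
    TensorProduct.tmul_zero, add_zero] at against_generator
  exact h.smul_eq_zero_of_tmul against_generator

end RootUniqueness

section RootExistence
variable {R : Type*} [CommRing R] [Algebra ℝ R] {N : Type*} [AddCommGroup N] [Module R N]
variable {D : Derivation ℝ R R}

theorem DerivOp.sq_smul_congr {P : Type*} [AddCommGroup P] [Module R P] (δ : DerivOp D P) {r : R}
    {x y : P} (h : r • x = r • y) : r ^ 2 • δ x = r ^ 2 • δ y := by
  have image := congrArg (fun z => r • δ z) h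
  simp only [δ.leibniz, smul_add] at image
  rw [smul_comm r (D r), smul_comm r (D r), h] at image
  rw [pow_two, mul_smul, mul_smul]
  exact add_left_cancel image

theorem IsLineFrame.sq_smul_derivOp_tmul {r : R} {l : N} {c : Module.Dual R N}
    (h : IsLineFrame r l c) (Q : DerivOp D (N ⊗[R] N)) (x y : N) :
    r ^ 2 • Q (x ⊗ₜ[R] y) = r ^ 2 •
      (D (c x * c y) + c x * c y * c (contractSnd c (Q (l ⊗ₜ l)))) • (l ⊗ₜ[R] l) := by
  rw [Q.sq_smul_congr (h.smul_tmul x y), Q.leibniz, add_smul, smul_add, smul_add,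
    smul_comm _ (c x * c y), h.sq.smul_tensor (Q (l ⊗ₜ l)), mul_smul _ (c (contractSnd c _)),
    smul_comm (r ^ 2) (c x * c y)]

theorem IsLineFrame.exists_root {r : R} {l : N} {c : Module.Dual R N}
    (h : IsLineFrame r l c) (Q : DerivOp D (N ⊗[R] N)) :
    ∃ δ : N → N, ∀ x y, r ^ 2 • (δ x ⊗ₜ[R] y + x ⊗ₜ[R] δ y) = r ^ 2 • Q (x ⊗ₜ[R] y) := by
  set g := c (contractSnd c (Q (l ⊗ₜ l)))
  -- With `Q (l ⊗ l) = g • l ⊗ l`, the root is `x • l ↦ (D x + (g / 2) x) • l`.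
  obtain ⟨half, half_add⟩ : ∃ half, half + half = g :=
    ⟨algebraMap ℝ R 2⁻¹ • g, by rw [← smul_add, half_smul_add_self]⟩
  refine ⟨fun x => (D (c x) + half * c x) • l, fun x y => ?_⟩
  have coordinate : ∀ x, r ^ 2 * c ((D (c x) + half * c x) • l) =
      r ^ 2 * (D (c x) + half * c x) := fun x => by
    rw [map_smul, smul_eq_mul, mul_left_comm, h.sq.dual, mul_comm]
  rw [h.sq_smul_derivOp_tmul, smul_add, h.sq.smul_tmul, h.sq.smul_tmul x, smul_smul, smul_smul,
    smul_smul, ← add_smul]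
  congr 1
  rw [D.leibniz, smul_eq_mul, smul_eq_mul]
  change _ = r ^ 2 * (_ + c x * c y * g)
  rw [← half_add]
  linear_combination c y * coordinate x + c x * coordinate y

theorem exists_derivOp_of_tmul_add (cancel : ∀ z : N, (∀ y : N, z ⊗ₜ[R] y = 0) → z = 0)
    (Q : DerivOp D (N ⊗[R] N)) (f : N → N)
    (hf : ∀ x y, f x ⊗ₜ[R] y + x ⊗ₜ[R] f y = Q (x ⊗ₜ y)) :
    ∃ δ : DerivOp D N, ∀ x, δ x = f x := by
  have f_tmul : ∀ x y, f x ⊗ₜ[R] y = Q (x ⊗ₜ y) - x ⊗ₜ f y := fun x y =>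
    eq_sub_of_add_eq (hf x y)
  refine ⟨⟨AddMonoidHom.mk' f fun x x' => ?_, fun a x => ?_⟩, fun x => rfl⟩
  · refine sub_eq_zero.mp (cancel (f (x + x') - (f x + f x')) fun y => ?_)
    simp only [TensorProduct.sub_tmul, TensorProduct.add_tmul, f_tmul, map_add]
    abel
  · refine sub_eq_zero.mp (cancel (f (a • x) - (D a • x + a • f x)) fun y => ?_)
    simp only [TensorProduct.sub_tmul, TensorProduct.add_tmul, f_tmul,
      ← TensorProduct.smul_tmul', Q.leibniz, smul_sub]
    abel

variable {I : Type*} {r : I → R} {l : I → N} {c : I → Module.Dual R N}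

theorem exists_derivOp_root (hL : ∀ i, IsLineFrame (r i) (l i) (c i))
    (hN : Separates (fun i => r i ^ 2) N) (hG : Glues (fun i => r i ^ 2) N)
    (hT : Separates (fun i => r i ^ 2) (N ⊗[R] N)) (Q : DerivOp D (N ⊗[R] N)) :
    ∃ δ : DerivOp D N, ∀ x y, δ x ⊗ₜ[R] y + x ⊗ₜ[R] δ y = Q (x ⊗ₜ y) := by
  choose f hf using fun i => (hL i).exists_root Q
  have overlap : ∀ x j i, r j ^ 2 • r i ^ 2 • f i x = r i ^ 2 • r j ^ 2 • f j x := fun x j i => by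
    rw [smul_comm, smul_smul, smul_smul, ← sub_eq_zero, ← smul_sub]
    refine ((hL j).sq.mul (r i ^ 2)).smul_eq_zero_of_tmul_add (κ := fun x => f i x - f j x)
      (fun x y => ?_) x
    rw [TensorProduct.sub_tmul, TensorProduct.tmul_sub, sub_add_sub_comm, smul_sub, mul_smul,
      mul_smul, hf j, smul_comm, hf i, smul_comm, sub_self]
  choose δ hδ using fun x => hG (fun i => r i ^ 2 • f i x) (overlap x)
  have root : ∀ x y, δ x ⊗ₜ[R] y + x ⊗ₜ[R] δ y = Q (x ⊗ₜ[R] y) := fun x y => hT.eq fun i => by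
    rw [← hf, smul_add, smul_add, TensorProduct.smul_tmul', hδ, ← TensorProduct.tmul_smul, hδ,
      TensorProduct.tmul_smul, ← TensorProduct.smul_tmul']
  obtain ⟨δ', hδ'⟩ := exists_derivOp_of_tmul_add
    (fun z hz => hN z fun i => (hL i).sq.smul_eq_zero_of_tmul (by rw [hz, smul_zero])) Q δ root
  exact ⟨δ', by simpa only [hδ'] using root⟩

end RootExistence

section Root
variable {R : Type*} [CommRing R] {N : Type*} [AddCommGroup N] [Module R N]
  {C : Type*} [AddCommGroup C] [Module R C]

theorem map_tmul_comm_of_isLineFrame {I : Type*} {r : I → R} {l : I → N} {c : I → Module.Dual R N}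
    (hL : ∀ i, IsLineFrame (r i) (l i) (c i)) (hC : Separates r C) (q : (N ⊗[R] N) ≃ₗ[R] C)
    (x y : N) : q (x ⊗ₜ y) = q (y ⊗ₜ x) :=
  hC.eq fun i => by rw [← map_smul, (hL i).smul_tmul_comm, map_smul]

/-- `δ` is a square root of `Q` under `C ≅ N ⊗ N`: on `N ⊗ N` the operator `Q` is
`δ ⊗ 1 + 1 ⊗ δ`. -/
def IsRoot (q : (N ⊗[R] N) ≃ₗ[R] C) (Q : C → C) (δ : N → N) : Prop :=
  ∀ x y, q (δ x ⊗ₜ y) + q (x ⊗ₜ δ y) = Q (q (x ⊗ₜ y))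

namespace IsRoot
variable {q : (N ⊗[R] N) ≃ₗ[R] C} {Q Q' : C → C} {δ δ' : N → N}

theorem add (h : IsRoot q Q δ) (h' : IsRoot q Q' δ') : IsRoot q (Q + Q') (δ + δ') :=
  fun x y => by
    simp only [Pi.add_apply, ← h x y, ← h' x y, TensorProduct.add_tmul, TensorProduct.tmul_add,
      map_add]
    abel

theorem smul (h : IsRoot q Q δ) (f : R) : IsRoot q (f • Q) (f • δ) := fun x y => by
  simp only [Pi.smul_apply, ← h x y, ← TensorProduct.smul_tmul', TensorProduct.tmul_smul,
    map_smul, smul_add]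

theorem smul_id (g : R) : IsRoot q (fun z => (g + g) • z) (fun x => g • x) := fun x y => by
  simp only [add_smul, ← TensorProduct.smul_tmul', TensorProduct.tmul_smul, map_smul]

theorem comm [Algebra ℝ R] {D D' : Derivation ℝ R R} {Q : DerivOp D C} {Q' : DerivOp D' C}
    {δ : DerivOp D N} {δ' : DerivOp D' N} (h : IsRoot q Q δ) (h' : IsRoot q Q' δ') :
    IsRoot q (Q.comm Q') (δ.comm δ') := fun x y => by
  simp only [DerivOp.comm_apply]
  rw [← h' x y, ← h x y, map_add, map_add, ← h, ← h, ← h', ← h', TensorProduct.sub_tmul,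
    TensorProduct.tmul_sub, map_sub, map_sub]
  abel

end IsRoot

variable [Algebra ℝ R]

/-- Every derivation operator on `C ≅ N ⊗ N` has a square root, and square roots are unique, even
among arbitrary maps. -/
structure HasUniqueRoots (q : (N ⊗[R] N) ≃ₗ[R] C) : Prop where
  exists_isRoot : ∀ {D : Derivation ℝ R R} (Q : DerivOp D C), ∃ δ : DerivOp D N, IsRoot q Q δ
  eq_zero : ∀ {κ : N → N}, IsRoot q (fun _ => 0) κ → ∀ x, κ x = 0

namespace HasUniqueRoots
variable {q : (N ⊗[R] N) ≃ₗ[R] C} (hq : HasUniqueRoots q) {D : Derivation ℝ R R}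

include hq in
theorem unique {Q Q' : C → C} {δ δ' : N → N} (h : IsRoot q Q δ) (h' : IsRoot q Q' δ')
    (hQ : ∀ z, Q z = Q' z) (x : N) : δ x = δ' x := by
  refine sub_eq_zero.mp (hq.eq_zero (κ := fun x => δ x - δ' x) (fun x y => ?_) x)
  rw [TensorProduct.sub_tmul, TensorProduct.tmul_sub, map_sub, map_sub, sub_add_sub_comm, h, h',
    hQ, sub_self]

/-- The square root of a derivation operator. -/
def rootOp (Q : DerivOp D C) : DerivOp D N := (hq.exists_isRoot Q).choose

theorem isRoot_rootOp (Q : DerivOp D C) : IsRoot q Q (hq.rootOp Q) :=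
  (hq.exists_isRoot Q).choose_spec

end HasUniqueRoots

/-- Transport of an operator along an isomorphism. -/
def DerivOp.pullback {D : Derivation ℝ R R} {P : Type*} [AddCommGroup P] [Module R P]
    (q : P ≃ₗ[R] C) (Q : DerivOp D C) : DerivOp D P where
  toFun := AddMonoidHom.mk' (fun x => q.symm (Q (q x))) fun x y => by simp only [map_add]
  leibniz f x := by
    simp only [AddMonoidHom.mk'_apply, map_smul, Q.leibniz, map_add, q.symm_apply_apply]

variable {I : Type*} {r : I → R} {l : I → N} {c : I → Module.Dual R N}

theorem hasUniqueRoots_of_isLineFrame (hL : ∀ i, IsLineFrame (r i) (l i) (c i))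
    (hN : Separates (fun i => r i ^ 2) N) (hG : Glues (fun i => r i ^ 2) N)
    (hC : Separates (fun i => r i ^ 2) C) (q : (N ⊗[R] N) ≃ₗ[R] C) : HasUniqueRoots q where
  exists_isRoot Q := by
    have hT : Separates (fun i => r i ^ 2) (N ⊗[R] N) := fun t ht =>
      q.map_eq_zero_iff.mp (hC (q t) fun i => by rw [← map_smul, ht, map_zero])
    obtain ⟨δ, hδ⟩ := exists_derivOp_root hL hN hG hT (Q.pullback q)
    refine ⟨δ, fun x y => ?_⟩
    rw [← map_add, hδ]
    exact q.apply_symm_apply _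
  eq_zero {κ} hκ x := hN _ fun i => (hL i).sq.smul_eq_zero_of_tmul_add (fun x y => by
    rw [q.map_eq_zero_iff.mp ((map_add q _ _).trans (hκ x y)), smul_zero]) x

end Root

section Operators
variable {R : Type*} [CommRing R] [Algebra ℝ R]
variable {V N : Type*} [AddCommGroup V] [Module R V] [AddCommGroup N] [Module R N]
variable {D D' : Derivation ℝ R R}

namespace DerivOp

theorem alt_congr {k : ℕ} {δ : DerivOp D V} {δ' : DerivOp D' V} {τ : DerivOp D N}
    {τ' : DerivOp D' N} (hδ : ∀ v, δ v = δ' v) (hτ : ∀ x, τ x = τ' x) (θ : V [⋀^Fin k]→ₗ[R] N) :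
    δ.alt τ k θ = δ'.alt τ' k θ := by
  ext v
  simp only [alt_apply, hδ, hτ]

theorem alt_add {k : ℕ} {D'' : Derivation ℝ R R} {δ : DerivOp D V} {δ' : DerivOp D' V}
    {δ'' : DerivOp D'' V} {τ : DerivOp D N} {τ' : DerivOp D' N} {τ'' : DerivOp D'' N}
    (hδ : ∀ v, δ'' v = δ v + δ' v) (hτ : ∀ x, τ'' x = τ x + τ' x) (θ : V [⋀^Fin k]→ₗ[R] N) :
    δ''.alt τ'' k θ = δ.alt τ k θ + δ'.alt τ' k θ := by
  ext v
  simp only [alt_apply, AlternatingMap.add_apply, hδ, hτ, AlternatingMap.map_update_add,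
    Finset.sum_add_distrib]
  abel

theorem alt_comm {k : ℕ} (δ : DerivOp D V) (τ : DerivOp D N) (δ' : DerivOp D' V)
    (τ' : DerivOp D' N) (θ : V [⋀^Fin k]→ₗ[R] N) :
    (δ.comm δ').alt (τ.comm τ') k θ = (δ.alt τ k).comm (δ'.alt τ' k) θ := by
  have in_degree := congrFun (DFunLike.congr_fun (lieOp_commutator δ τ δ' τ') (Pi.single k θ)) k
  change δ.alt τ k (δ'.alt τ' k ((Pi.single k θ : Forms R V N) k)) -
    δ'.alt τ' k (δ.alt τ k ((Pi.single k θ : Forms R V N) k)) =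
    (δ.comm δ').alt (τ.comm τ') k ((Pi.single k θ : Forms R V N) k) at in_degree
  rw [Pi.single_eq_same] at in_degree
  exact in_degree.symm

/-- The rank-one term `φ ⊗ x` acts on top-degree forms through its trace `φ x`. -/
theorem alt_smul {I : Type*} {r : I → R} {n : ℕ} {e : I → Fin n → V}
    {ε : I → Fin n → Module.Dual R V} (hf : ∀ i, IsFrame (r i) (e i) (ε i)) (hN : Separates r N)
    {δ : DerivOp D V} {δ' : DerivOp D' V} {τ : DerivOp D N} {τ' : DerivOp D' N} {f c : R}
    {φ : Module.Dual R V} {x : V} (hδ : ∀ v, δ' v = f • δ v + φ v • x)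
    (hτ : ∀ y, τ' y = f • τ y + c • y) (θ : V [⋀^Fin n]→ₗ[R] N) :
    δ'.alt τ' n θ = f • δ.alt τ n θ + (c - φ x) • θ := by
  ext v
  have trace_term : ∑ l, φ (v l) • θ (Function.update v l x) = φ x • θ v :=
    hN.eq fun i => (hf i).smul_sum_update_rankOne φ x θ v
  simp only [alt_apply, AlternatingMap.add_apply, AlternatingMap.smul_apply, hδ, hτ,
    AlternatingMap.map_update_add, AlternatingMap.map_update_smul, Finset.sum_add_distrib,
    trace_term, smul_sub, Finset.smul_sum]
  rw [sub_smul]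
  abel

theorem hom_comm (δ : DerivOp D V) (τ : DerivOp D N) (δ' : DerivOp D' V) (τ' : DerivOp D' N)
    (φ : V →ₗ[R] N) : (δ.comm δ').hom (τ.comm τ') φ = (δ.hom τ).comm (δ'.hom τ') φ := by
  ext v
  simp only [hom_apply, comm_apply, LinearMap.sub_apply, map_sub]
  abel

end DerivOp

end Operators

section Canonical
variable {R : Type*} [CommRing R] [Algebra ℝ R] {Γ : Type*} [AddCommGroup Γ] [Module R Γ]
variable {n m : ℕ} {D D' D'' : Derivation ℝ R R}

theorem lieTopForm_add (hD : D'' = D + D') (μ : TopForm R m) :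
    lieTopForm m D'' μ = lieTopForm m D μ + lieTopForm m D' μ := by
  subst hD
  exact DerivOp.alt_add (fun v => add_lie D D' v) (fun _ => rfl) μ

theorem lieTopForm_comm (hD : D'' = ⁅D, D'⁆) (μ : TopForm R m) :
    lieTopForm m D'' μ = (lieTopForm m D).comm (lieTopForm m D') μ := by
  subst hD
  refine Eq.trans ?_ (DerivOp.alt_comm ((tangent R).ad D) (DerivOp.fn D) ((tangent R).ad D')
    (DerivOp.fn D') μ)
  refine DerivOp.alt_congr (fun v => ?_) (fun x => ?_) μ
  · exact eq_sub_of_add_eq (leibniz_lie D D' v).symm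
  · exact Derivation.commutator_apply x

theorem SkewAlgebroid.ad_smul (S : SkewAlgebroid R Γ) (f : R) (X Y : Γ) :
    S.ad (f • X) Y = f • S.ad X Y + (-S.d₀ f) Y • X := by
  rw [LinearMap.neg_apply, neg_smul, ← sub_eq_add_neg]
  exact S.bracket_smul_left X Y f

theorem lieTopForm_smul {I : Type*} {r : I → R} {d : I → Fin m → Derivation ℝ R R}
    {dx : I → Fin m → Module.Dual R (Derivation ℝ R R)} (hd : ∀ i, IsFrame (r i) (d i) (dx i))
    (hR : Separates r R) {f : R} (hD : D' = f • D) (μ : TopForm R m) :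
    lieTopForm m D' μ = f • lieTopForm m D μ + D f • μ := by
  subst hD
  refine (DerivOp.alt_smul hd hR (τ := DerivOp.fn D) (c := 0) ((tangent R).ad_smul f D)
    (fun y => ?_) μ).trans ?_
  · rw [zero_smul, add_zero]
    rfl
  · rw [zero_sub, LinearMap.neg_apply, neg_neg]
    rfl

variable (n m) in
/-- The operator on `∧ⁿA* ⊗ ∧ᵐT*M` induced by an operator on `A*` and its vector field. For
`[ξ, ·]` it is the canonical action of `A*`, for `L_X` the Lie derivative along a section of `A`. -/
def canonicalOp (δ : DerivOp D (Module.Dual R Γ)) : DerivOp D (CanonicalLine R Γ n m) :=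
  (δ.alt (DerivOp.fn D) n).hom (lieTopForm m D)

theorem canonicalOp_apply (δ : DerivOp D (Module.Dual R Γ)) (φ : CanonicalLine R Γ n m)
    (P : TopMultivector R Γ n) :
    canonicalOp n m δ φ P = lieTopForm m D (φ P) - φ (δ.alt (DerivOp.fn D) n P) := rfl

variable {δ : DerivOp D (Module.Dual R Γ)} {δ' : DerivOp D' (Module.Dual R Γ)}
  {δ'' : DerivOp D'' (Module.Dual R Γ)}

theorem canonicalOp_add (hD : D'' = D + D') (hδ : ∀ ξ, δ'' ξ = δ ξ + δ' ξ)
    (φ : CanonicalLine R Γ n m) :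
    canonicalOp n m δ'' φ = canonicalOp n m δ φ + canonicalOp n m δ' φ := by
  ext1 P
  rw [LinearMap.add_apply, canonicalOp_apply, canonicalOp_apply, canonicalOp_apply,
    lieTopForm_add hD, DerivOp.alt_add (τ := DerivOp.fn D) (τ' := DerivOp.fn D') hδ
      (fun x => by simp [hD]), map_add]
  abel

theorem canonicalOp_comm (hD : D'' = ⁅D, D'⁆) (hδ : ∀ ξ, δ'' ξ = δ.comm δ' ξ)
    (φ : CanonicalLine R Γ n m) :
    canonicalOp n m δ'' φ = (canonicalOp n m δ).comm (canonicalOp n m δ') φ := by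
  rw [canonicalOp, canonicalOp, canonicalOp, ← DerivOp.hom_comm]
  ext1 P
  rw [DerivOp.hom_apply, DerivOp.hom_apply, lieTopForm_comm hD, ← DerivOp.alt_comm]
  congr 2
  exact DerivOp.alt_congr hδ (fun x => by simp [hD, Derivation.commutator_apply]) P

theorem canonicalOp_smul {I : Type*} {r : I → R} {d : I → Fin m → Derivation ℝ R R}
    {dx : I → Fin m → Module.Dual R (Derivation ℝ R R)} (hd : ∀ i, IsFrame (r i) (d i) (dx i))
    {e : I → Fin n → Γ} {ε : I → Fin n → Module.Dual R Γ} (hf : ∀ i, IsFrame (r i) (e i) (ε i))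
    (hR : Separates r R) {f : R} (hD : D' = f • D) {φ : Module.Dual R (Module.Dual R Γ)}
    {x : Module.Dual R Γ} (hδ : ∀ ξ, δ' ξ = f • δ ξ + φ ξ • x) (ψ : CanonicalLine R Γ n m) :
    canonicalOp n m δ' ψ = f • canonicalOp n m δ ψ + (D f + φ x) • ψ := by
  have alt_eq := fun P => DerivOp.alt_smul (fun i => (hf i).toDual) hR
    (τ := DerivOp.fn D) (τ' := DerivOp.fn D') (c := 0) hδ (fun y => by simp [hD]) P
  ext1 P
  rw [canonicalOp_apply, lieTopForm_smul hd hR hD, alt_eq, map_add, map_smul, map_smul, zero_sub]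
  ext v
  simp only [LinearMap.add_apply, LinearMap.smul_apply, AlternatingMap.add_apply,
    AlternatingMap.sub_apply, AlternatingMap.smul_apply, canonicalOp_apply, smul_eq_mul]
  ring

end Canonical

section Actions
variable {R : Type*} [CommRing R] [Algebra ℝ R] {Γ : Type*} [AddCommGroup Γ] [Module R Γ]
  {N : Type*} [AddCommGroup N] [Module R N] {n m : ℕ}

theorem SkewAlgebroid.adDual_add (S : SkewAlgebroid R Γ) (X Y : Γ) (ξ : Module.Dual R Γ) :
    S.adDual (X + Y) ξ = S.adDual X ξ + S.adDual Y ξ := by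
  ext Z
  simp only [adDual_apply, LinearMap.add_apply, map_add, Derivation.add_apply,
    AddMonoidHom.add_apply]
  ring

theorem SkewAlgebroid.adDual_smul (S : SkewAlgebroid R Γ) (f : R) (X : Γ) (ξ : Module.Dual R Γ) :
    S.adDual (f • X) ξ = f • S.adDual X ξ + Module.Dual.eval R Γ X ξ • S.d₀ f := by
  ext Z
  simp only [adDual_apply, S.bracket_smul_left, map_smul, map_sub, LinearMap.add_apply,
    LinearMap.smul_apply, Derivation.smul_apply, Module.Dual.eval_apply, SkewAlgebroid.d₀_apply,
    smul_eq_mul]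
  ring

variable {q : (N ⊗[R] N) ≃ₗ[R] CanonicalLine R Γ n m}
  (hq : HasUniqueRoots (C := CanonicalLine R Γ n m) q)

/-- The Lie derivative on the half-densities `L`; it is not linear over functions. -/
def lieRoot (S : SkewAlgebroid R Γ) (X : Γ) : DerivOp (S.anchor X) N :=
  hq.rootOp (canonicalOp n m (S.adDual X))

theorem isRoot_lieRoot (S : SkewAlgebroid R Γ) (X : Γ) :
    IsRoot q (canonicalOp n m (S.adDual X)) (lieRoot hq S X) :=
  hq.isRoot_rootOp _

theorem lieRoot_add (S : SkewAlgebroid R Γ) (X Y : Γ) (x : N) :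
    lieRoot hq S (X + Y) x = lieRoot hq S X x + lieRoot hq S Y x :=
  hq.unique (isRoot_lieRoot hq S (X + Y)) ((isRoot_lieRoot hq S X).add (isRoot_lieRoot hq S Y))
    (canonicalOp_add (map_add _ _ _) (S.adDual_add X Y)) x

theorem lieRoot_bracket (S : LieAlgebroid R Γ) (X Y : Γ) (x : N) :
    lieRoot hq S.toSkewAlgebroid (S.bracket X Y) x =
      (lieRoot hq S.toSkewAlgebroid X).comm (lieRoot hq S.toSkewAlgebroid Y) x :=
  hq.unique (isRoot_lieRoot hq S.toSkewAlgebroid (S.bracket X Y))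
    ((isRoot_lieRoot hq S.toSkewAlgebroid X).comm (isRoot_lieRoot hq S.toSkewAlgebroid Y))
    (canonicalOp_comm (S.anchor_bracket X Y) (S.adDual_bracket X Y)) x

variable {I : Type*} {r : I → R}
  {d : I → Fin m → Derivation ℝ R R} {dx : I → Fin m → Module.Dual R (Derivation ℝ R R)}
  (hd : ∀ i, IsFrame (r i) (d i) (dx i))
  {e : I → Fin n → Γ} {ε : I → Fin n → Module.Dual R Γ} (hf : ∀ i, IsFrame (r i) (e i) (ε i))
  (hR : Separates r R) (hN : Separates r N)

include hd hf hR in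
theorem lieRoot_smul (S : SkewAlgebroid R Γ) (f : R) (X : Γ) (x : N) :
    lieRoot hq S (f • X) x = f • lieRoot hq S X x + S.anchor X f • x :=
  hq.unique (isRoot_lieRoot hq S (f • X))
    (((isRoot_lieRoot hq S X).smul f).add (.smul_id (S.anchor X f)))
    (canonicalOp_smul hd hf hR (map_smul _ _ _) (S.adDual_smul f X)) x

/-- The action of `A` on `∧ⁿA ⊗ L` by Lie derivatives. The trace of `L_{fX} - f L_X` on `∧ⁿA`
cancels the half traces on the two factors of `L ⊗ L`, so that it is linear over functions. -/
def dualRootConnection (S : SkewAlgebroid R Γ) :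
    S.Connection (Module.Dual R Γ [⋀^Fin n]→ₗ[R] N) where
  act X := (S.adDual X).alt (lieRoot hq S X) n
  add_left X Y b := DerivOp.alt_add (S.adDual_add X Y) (lieRoot_add hq S X Y) b
  smul_left f X b := by
    refine (DerivOp.alt_smul (fun i => (hf i).toDual) hN (S.adDual_smul f X)
      (lieRoot_smul hq hd hf hR S f X) b).trans ?_
    rw [Module.Dual.eval_apply, SkewAlgebroid.d₀_apply, sub_self, zero_smul, add_zero]

theorem dualRootConnection_isInducedBy (S : SkewAlgebroid R Γ) :
    (dualRootConnection hq hd hf hR hN S).IsInducedBy (lieRoot hq S) :=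
  fun _ _ => rfl

theorem dualRootConnection_isFlat (S : LieAlgebroid R Γ) :
    (dualRootConnection hq hd hf hR hN S.toSkewAlgebroid).IsFlat := fun X Y b =>
  (DerivOp.alt_congr (S.adDual_bracket X Y) (lieRoot_bracket hq S X Y) b).trans
    (DerivOp.alt_comm (S.adDual X) (lieRoot hq S.toSkewAlgebroid X) (S.adDual Y)
      (lieRoot hq S.toSkewAlgebroid Y) b)

/-- The action of `A*` on `L` by square roots of the canonical action. -/
def rootConnection (S : SkewAlgebroid R (Module.Dual R Γ)) : S.Connection N where
  act ξ := hq.rootOp (canonicalOp n m (S.ad ξ))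
  add_left ξ η x :=
    hq.unique (hq.isRoot_rootOp (canonicalOp n m (S.ad (ξ + η))))
      ((hq.isRoot_rootOp (canonicalOp n m (S.ad ξ))).add
        (hq.isRoot_rootOp (canonicalOp n m (S.ad η))))
      (canonicalOp_add (map_add _ _ _) fun ζ => DFunLike.congr_fun (map_add S.bracket ξ η) ζ) x
  smul_left f ξ x :=
    hq.unique (hq.isRoot_rootOp (canonicalOp n m (S.ad (f • ξ))))
      ((hq.isRoot_rootOp (canonicalOp n m (S.ad ξ))).smul f) (fun z => by
        have trace : S.anchor ξ f + (-S.d₀ f) ξ = 0 := add_neg_cancel _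
        rw [canonicalOp_smul hd hf hR (map_smul _ _ _) (S.ad_smul f ξ), trace,
          zero_smul, add_zero]
        rfl) x

theorem rootConnection_isFlat (S : LieAlgebroid R (Module.Dual R Γ)) :
    (rootConnection hq hd hf hR S.toSkewAlgebroid).IsFlat := fun ξ η x =>
  hq.unique (hq.isRoot_rootOp (canonicalOp n m (S.ad (S.bracket ξ η))))
    ((hq.isRoot_rootOp (canonicalOp n m (S.ad ξ))).comm
      (hq.isRoot_rootOp (canonicalOp n m (S.ad η))))
    (canonicalOp_comm (S.anchor_bracket ξ η) fun ζ => eq_sub_of_add_eq (S.jacobi ξ η ζ).symm) x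

theorem isRootAction_iff (S : SkewAlgebroid R (Module.Dual R Γ)) (E : S.Connection N) :
    IsRootAction S q E ↔ E = rootConnection hq hd hf hR S := by
  have is_root : ∀ ξ, IsRoot q (lieCanonicalLine S n m ξ) (rootConnection hq hd hf hR S |>.act ξ) :=
    fun ξ => hq.isRoot_rootOp (canonicalOp n m (S.ad ξ))
  constructor
  · intro h
    ext ξ x
    exact hq.unique (h ξ) (is_root ξ) (fun _ => rfl) x
  · rintro rfl
    exact is_root

include hf hR in
theorem topMultivector_comm (φ : CanonicalLine R Γ n m) (P P' : TopMultivector R Γ n)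
    (η : Fin n → Module.Dual R Γ) : P η • φ P' = P' η • φ P := by
  rw [← map_smul, ← map_smul]
  congr 1
  ext w
  exact hR.eq fun i => by
    simpa [mul_comm] using (hf i).toDual.smul_top_comm P P' η w

theorem DerivOp.alt_tensorTop {D : Derivation ℝ R R} (δ : DerivOp D (Module.Dual R Γ))
    (τ : DerivOp D N) (P : TopMultivector R Γ n) (l : N) (η : Fin n → Module.Dual R Γ) :
    δ.alt τ n (tensorTop P l) η = δ.alt (DerivOp.fn D) n P η • l + P η • τ l := by
  simp only [alt_apply, tensorTop, LinearMap.compAlternatingMap_apply,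
    LinearMap.toSpanSingleton_apply, leibniz, fn_apply, sub_smul, Finset.sum_smul]
  abel

theorem dualSquare_tensorTop (q : (N ⊗[R] N) ≃ₗ[R] CanonicalLine R Γ n m)
    (P P' : TopMultivector R Γ n) (l l' : N) :
    dualSquare q (tensorTop P l) P' l' = tensorTop P (q (l ⊗ₜ l') P') := by
  ext1 η
  change q ((P η • l) ⊗ₜ l') P' = P η • q (l ⊗ₜ l') P'
  rw [← TensorProduct.smul_tmul', map_smul, LinearMap.smul_apply]

variable (hsymm : ∀ x y, q (x ⊗ₜ y) = q (y ⊗ₜ x))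

include hsymm in
theorem isDualRootAction_dualRootConnection (S : SkewAlgebroid R Γ) :
    IsDualRootAction S q (dualRootConnection hq hd hf hR hN S) := by
  intro X P P' l l'
  ext1 η
  have root := DFunLike.congr_fun (isRoot_lieRoot hq S X l l') P'
  rw [LinearMap.add_apply, canonicalOp_apply] at root
  rw [dualSquare_tensorTop, lieDualLine, DerivOp.alt_tensorTop, eq_add_of_sub_eq root.symm,
    AlternatingMap.add_apply, dualSquare_apply, dualSquare_apply,
    dualRootConnection_isInducedBy, dualRootConnection_isInducedBy, DerivOp.alt_tensorTop,
    DerivOp.alt_tensorTop]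
  simp only [TensorProduct.add_tmul, ← TensorProduct.smul_tmul', map_add, map_smul,
    LinearMap.add_apply, LinearMap.smul_apply]
  rw [topMultivector_comm hf hR _ _ P, topMultivector_comm hf hR (q (lieRoot hq S X l' ⊗ₜ l)) _ P,
    hsymm l' l, hsymm _ l]
  simp only [smul_add]
  abel

include hq hf hR hN hsymm in
theorem eq_zero_of_dualSquare
    (κ : (Module.Dual R Γ [⋀^Fin n]→ₗ[R] N) →ₗ[R] (Module.Dual R Γ [⋀^Fin n]→ₗ[R] N))
    (hκ : ∀ (P P' : TopMultivector R Γ n) (l l' : N),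
      dualSquare q (κ (tensorTop P l)) P' l' + dualSquare q (κ (tensorTop P' l')) P l = 0)
    (b : Module.Dual R Γ [⋀^Fin n]→ₗ[R] N) : κ b = 0 := by
  -- For fixed `P` and `η`, a multiple of `l ↦ κ (P ⊗ l) η` is a square root of zero.
  have on_tensorTop : ∀ P l η η', P η' • κ (tensorTop P l) η = 0 := fun P l η η' =>
    hq.eq_zero (κ := fun l => P η' • κ (tensorTop P l) η) (fun x y => by
      ext1 P'
      have vanish := DFunLike.congr_fun (hκ P P x y) η
      simp only [AlternatingMap.add_apply, dualSquare_apply] at vanish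
      rw [← TensorProduct.smul_tmul', TensorProduct.tmul_smul, map_smul, map_smul, ← smul_add,
        LinearMap.smul_apply, topMultivector_comm hf hR, hsymm x, LinearMap.add_apply, vanish,
        AlternatingMap.zero_apply, smul_zero]
      rfl) l
  refine hN.alternating _ fun i => ?_
  set P := topForm fun j => Module.Dual.eval R Γ (e i j)
  have expand : r i • b = r i • tensorTop P (b (ε i)) := (hf i).toDual.smul_ext <| by
    change _ = r i • P (ε i) • b (ε i)
    rw [smul_smul, (hf i).toDual.mul_topForm]
  ext1 η
  rw [← map_smul, expand, map_smul, AlternatingMap.smul_apply, ← (hf i).toDual.mul_topForm,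
    mul_smul, on_tensorTop, smul_zero, AlternatingMap.zero_apply]

include hsymm in
theorem isDualRootAction_iff (S : SkewAlgebroid R Γ)
    (E : S.Connection (Module.Dual R Γ [⋀^Fin n]→ₗ[R] N)) :
    IsDualRootAction S q E ↔ E = dualRootConnection hq hd hf hR hN S := by
  set E₀ := dualRootConnection hq hd hf hR hN S
  have E₀_root : IsDualRootAction S q E₀ :=
    isDualRootAction_dualRootConnection hq hd hf hR hN hsymm S
  refine ⟨fun h => ?_, fun h => h ▸ E₀_root⟩
  ext X b : 3
  let κ : (Module.Dual R Γ [⋀^Fin n]→ₗ[R] N) →ₗ[R] (Module.Dual R Γ [⋀^Fin n]→ₗ[R] N) :=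
    { toFun := fun b => E.act X b - E₀.act X b
      map_add' := fun b b' => by simp only [map_add, add_sub_add_comm]
      map_smul' := fun f b => by
        simp only [DerivOp.leibniz, add_sub_add_left_eq_sub, RingHom.id_apply, smul_sub] }
  refine sub_eq_zero.mp (eq_zero_of_dualSquare hq hf hR hN hsymm κ (fun P P' l l' => ?_) b)
  have same := (h X P P' l l').trans (E₀_root X P P' l l').symm
  ext1 η
  have at_η := DFunLike.congr_fun same η
  simp only [AlternatingMap.add_apply, dualSquare_apply] at at_η ⊢
  change q ((E.act X _ η - E₀.act X _ η) ⊗ₜ l') P' + q ((E.act X _ η - E₀.act X _ η) ⊗ₜ l) P = 0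
  rw [TensorProduct.sub_tmul, TensorProduct.sub_tmul, map_sub, map_sub, LinearMap.sub_apply,
    LinearMap.sub_apply, sub_add_sub_comm, at_η, sub_self]

end Actions

section Tensoriality
variable {R : Type*} [CommRing R] [Algebra ℝ R] {Γ : Type*} [AddCommGroup Γ] [Module R Γ]
  (S : SkewAlgebroid R Γ) (Λ : Bivector R Γ)

theorem sharpDefect_self (α : Module.Dual R Γ) : sharpDefect S Λ α α = 0 :=
  eq_zero_of_add_self R (eq_neg_iff_add_eq_zero.mp (sharpDefect_skew S Λ α α))

theorem sharpDefect_rotate (v : Fin 3 → Module.Dual R Γ) (i : Fin 3) :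
    v i (sharpDefect S Λ (v (i + 1)) (v (i + 2))) = v 0 (sharpDefect S Λ (v 1) (v 2)) := by
  fin_cases i
  · rfl
  · exact (sharpDefect_cyclic S Λ _ _ _).symm
  · exact sharpDefect_cyclic S Λ _ _ _

/-- Half the Schouten square `[Λ, Λ]`, as an alternating form on the dual. -/
def halfSchoutenSquare : Module.Dual R Γ [⋀^Fin 3]→ₗ[R] R where
  toFun v := v 0 (sharpDefect S Λ (v 1) (v 2))
  map_update_add' v i x y := by
    have succ_ne : i + 1 ≠ i := by lia
    have succ_succ_ne : i + 2 ≠ i := by lia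
    simp only [← sharpDefect_rotate S Λ _ i, Function.update_self, Function.update_of_ne succ_ne,
      Function.update_of_ne succ_succ_ne, LinearMap.add_apply]
  map_update_smul' v i c x := by
    have succ_ne : i + 1 ≠ i := by lia
    have succ_succ_ne : i + 2 ≠ i := by lia
    simp only [← sharpDefect_rotate S Λ _ i, Function.update_self, Function.update_of_ne succ_ne,
      Function.update_of_ne succ_succ_ne, LinearMap.smul_apply]
  map_eq_zero_of_eq' v i j hv hij := by
    obtain rfl | rfl : j = i + 1 ∨ j = i + 2 := by lia
    · rw [← sharpDefect_rotate S Λ v i, ← sharpDefect_cyclic, ← hv, sharpDefect_self, map_zero]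
    · rw [← sharpDefect_rotate S Λ v i, sharpDefect_cyclic, ← hv, sharpDefect_self, map_zero]

section Invariant
variable {S Λ} (hΛ : ∀ X, bracketSection S (schouten S Λ Λ) X = 0)
include hΛ

-- Replacing `X` by `f • X` in the invariance of `[Λ, Λ]` leaves the terms containing `d f`.
theorem cyclic_sum_d₀_sharpDefect (f : R) (α β γ : Module.Dual R Γ) (X : Γ) :
    α X * S.d₀ f (sharpDefect S Λ β γ) + β X * S.d₀ f (sharpDefect S Λ γ α) +
      γ X * S.d₀ f (sharpDefect S Λ α β) = 0 := by
  have invariant := sharpDefect_invariant S Λ hΛ α β γ X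
  have invariant_smul := sharpDefect_invariant S Λ hΛ α β γ (f • X)
  simp only [S.bracket_smul_left, map_sub, map_smul, Derivation.smul_apply, smul_eq_mul]
    at invariant_smul
  simp only [SkewAlgebroid.d₀_apply]
  linear_combination invariant_smul - f * invariant

variable {r : R} {n : ℕ} {e : Fin n → Γ} {ε : Fin n → Module.Dual R Γ}

-- The trace over `α` and `X` of the preceding identity.
theorem IsFrame.mul_sub_two_mul_d₀_sharpDefect (h : IsFrame r e ε) (f : R)
    (β γ : Module.Dual R Γ) :
    r * (((n : R) - 2) * S.d₀ f (sharpDefect S Λ β γ)) = 0 := by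
  set D := fun α η => S.d₀ f (sharpDefect S Λ α η)
  have expand (ζ : Module.Dual R Γ) (X : Γ) :
      r * ζ X = r * ∑ p, ζ (e p) * ε p X := by
    simpa using DFunLike.congr_fun (h.span_dual ζ) X
  have swap (α η : Module.Dual R Γ) : D α η = -D η α := by
    simp only [D, sharpDefect_skew S Λ α η, map_neg]
  have trace_id : ∑ p, r * ε p (e p) = n * r := by
    simp [h.dual]
  have trace_left : r * ∑ p, β (e p) * D γ (ε p) = r * D γ β := by
    simp only [D, ← sharpDefect_cyclic S Λ (S.d₀ f) γ]
    exact (expand β _).symm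
  have trace_right : r * ∑ p, γ (e p) * D (ε p) β = r * D γ β := by
    simp only [D, sharpDefect_cyclic S Λ _ β (S.d₀ f)]
    exact (expand γ _).symm
  have trace_zero :
      r * ∑ p, (ε p (e p) * D β γ + β (e p) * D γ (ε p) + γ (e p) * D (ε p) β) = 0 := by
    simp only [D, cyclic_sum_d₀_sharpDefect hΛ, Finset.sum_const_zero, mul_zero]
  simp only [Finset.sum_add_distrib, mul_add, trace_left, trace_right, swap γ β] at trace_zero
  rw [← Finset.sum_mul, ← mul_assoc, Finset.mul_sum, trace_id] at trace_zero
  change r * ((n - 2) * D β γ) = 0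
  linear_combination trace_zero

end Invariant

variable {S Λ} {I : Type*} {r : I → R} {n : ℕ} {e : I → Fin n → Γ}
  {ε : I → Fin n → Module.Dual R Γ}

theorem schouten_d₀ (hf : ∀ i, IsFrame (r i) (e i) (ε i)) (hR : Separates r R)
    (hΛ : ∀ X, bracketSection S (schouten S Λ Λ) X = 0) (f : R) (β γ : Module.Dual R Γ) :
    schouten S Λ Λ (S.d₀ f) β γ = 0 := by
  rw [schouten_cyclic, schouten_self]
  suffices S.d₀ f (sharpDefect S Λ β γ) = 0 by rw [this, mul_zero]
  rcases eq_or_ne n 2 with rfl | hn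
  · have := hR.alternating_subsingleton (fun i => (hf i).toDual) (Nat.lt_succ_self 2)
    exact DFunLike.congr_fun (Subsingleton.elim (halfSchoutenSquare S Λ) 0) ![S.d₀ f, β, γ]
  · have inv_mul : algebraMap ℝ R ((n : ℝ) - 2)⁻¹ * ((n : R) - 2) = 1 := by
      have real_inv : ((n : ℝ) - 2)⁻¹ * (n - 2) = 1 :=
        inv_mul_cancel₀ (sub_ne_zero.mpr (by exact_mod_cast hn))
      simpa only [map_mul, map_sub, map_natCast, map_ofNat, map_one] using
        congrArg (algebraMap ℝ R) real_inv
    refine hR _ fun i => ?_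
    rw [smul_eq_mul]
    linear_combination algebraMap ℝ R ((n : ℝ) - 2)⁻¹ *
      (hf i).mul_sub_two_mul_d₀_sharpDefect hΛ f β γ -
        r i * S.d₀ f (sharpDefect S Λ β γ) * inv_mul

end Tensoriality

theorem sum_forms_apply {R V N ι : Type*} [CommRing R] [AddCommGroup V] [Module R V]
    [AddCommGroup N] [Module R N] (s : Finset ι) (w : ι → Forms R V N) (k : ℕ) (v : Fin k → V) :
    (∑ i ∈ s, w i) k v = ∑ i ∈ s, w i k v :=
  map_sum (AddMonoidHom.mk' (fun u => u k v) fun _ _ => rfl : Forms R V N →+ N) w s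

theorem sum_end_apply {M ι : Type*} [AddCommGroup M] (s : Finset ι) (T : ι → AddMonoid.End M)
    (x : M) : (∑ i ∈ s, T i) x = ∑ i ∈ s, T i x :=
  Finset.sum_smul (f := T) (s := s) (x := x)

section Trace
variable {R : Type*} [CommRing R] [Algebra ℝ R] {Γ : Type*} [AddCommGroup Γ] [Module R Γ]

/-- The two-form `dξ`, as a map from vectors to covectors. -/
def SkewAlgebroid.extD (S : SkewAlgebroid R Γ) (ξ : Module.Dual R Γ) : Γ →ₗ[R] Module.Dual R Γ where
  toFun X := S.adDual X ξ - S.d₀ (ξ X)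
  map_add' X Y := by
    rw [S.adDual_add, map_add, S.d₀_add]
    abel
  map_smul' f X := by
    ext Z
    simp only [S.adDual_smul, map_smul, smul_eq_mul, SkewAlgebroid.d₀_apply, Derivation.leibniz,
      Module.Dual.eval_apply, LinearMap.sub_apply, LinearMap.add_apply, LinearMap.smul_apply,
      RingHom.id_apply]
    ring

theorem SkewAlgebroid.extD_skew (S : SkewAlgebroid R Γ) (ξ : Module.Dual R Γ) (X Y : Γ) :
    S.extD ξ X Y = -S.extD ξ Y X := by
  change S.anchor X (ξ Y) - ξ (S.bracket X Y) - S.anchor Y (ξ X) =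
    -(S.anchor Y (ξ X) - ξ (S.bracket Y X) - S.anchor X (ξ Y))
  rw [S.bracket_skew X Y, map_neg]
  ring

variable {N : Type*} [AddCommGroup N] [Module R N] {n m : ℕ}
  {r : R} {e : Fin n → Γ} {ε : Fin n → Module.Dual R Γ}

theorem IsFrame.smul_sum_sharp (h : IsFrame r e ε) (Λ : Bivector R Γ) (ξ : Module.Dual R Γ) :
    r • ∑ p, (ξ (e p) • Λ.sharp (ε p) - ξ (Λ.sharp (ε p)) • e p) =
      r • (Λ.sharp ξ + Λ.sharp ξ) := by
  have skew (p) : ξ (Λ.sharp (ε p)) = -ε p (Λ.sharp ξ) := Λ.toFun_skew (ε p) ξ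
  have span_dual := congrArg Λ.sharp (h.span_dual ξ)
  simp only [map_smul, map_sum] at span_dual
  simp only [skew, neg_smul, sub_neg_eq_add, Finset.sum_add_distrib, smul_add, ← h.span,
    ← span_dual]

theorem IsFrame.scale_mul_bivector_wedgeOp (h : IsFrame r e ε) (Λ : Bivector R Γ) :
    (scale r * (Λ.wedgeOp + Λ.wedgeOp) : AddMonoid.End (Forms R (Module.Dual R Γ) N)) =
      scale r * ∑ p, wedgeOp (e p) * wedgeOp (Λ.sharp (ε p)) := by
  rw [← sub_eq_zero]
  refine op_eq_zero_of_contract_comm _ (fun w => ?_) fun ξ => ?_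
  · have sum_zero : (∑ p, wedgeOp (e p) * wedgeOp (Λ.sharp (ε p)) :
        AddMonoid.End (Forms R (Module.Dual R Γ) N)) w 0 = 0 := by
      rw [sum_end_apply, Finset.sum_apply]
      exact Finset.sum_const_zero
    have wedge_zero :
        (Λ.wedgeOp + Λ.wedgeOp : AddMonoid.End (Forms R (Module.Dual R Γ) N)) w 0 = 0 := add_zero 0
    exact (congrArg₂ (fun x y => r • x - r • y) wedge_zero sum_zero).trans (sub_self _)
  · have contract_scale := contract_mul_scale (R := R) (V := Module.Dual R Γ) (N := N)
    rw [mul_sub, sub_mul, ← mul_assoc, ← mul_assoc, contract_scale, mul_assoc, mul_assoc, mul_add,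
      Λ.contract_mul_wedgeOp, Finset.mul_sum]
    simp only [contract_mul_wedgeOp_mul_wedgeOp, Finset.sum_add_distrib, ← Finset.sum_mul]
    rw [← map_sum, mul_add (scale r) _ (DiracGen.wedgeOp _), ← wedgeOp_smul, h.smul_sum_sharp,
      wedgeOp_smul, map_add]
    simp only [mul_add, add_mul, mul_assoc]
    abel

section Contraction
variable {S : SkewAlgebroid R Γ} {E : S.Connection (Module.Dual R Γ [⋀^Fin n]→ₗ[R] N)}
  {δ : ∀ X, DerivOp (S.anchor X) N}
  [Subsingleton (Module.Dual R Γ [⋀^Fin (n + 1)]→ₗ[R] N)]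
  (hs : Function.Bijective (starMap (R := R) (Γ := Γ) (N := N) n)) (hδ : E.IsInducedBy δ)
  (ξ : Module.Dual R Γ) (w : Forms R (Module.Dual R Γ) N) (x : Fin 0 → Module.Dual R Γ)
include hδ

theorem boundaryContract_wedgeOp_wedgeOp (X Y : Γ) :
    boundaryContract hs S E ξ (wedgeOp X (wedgeOp Y w)) 0 x = S.extD ξ Y X • w 0 x := by
  have wedge_boundaryContract : (0 : N) = boundaryContract hs S E ξ (wedgeOp X (wedgeOp Y w)) 0 x +
      contract (S.extD ξ X) (wedgeOp Y w) 0 x :=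
    DFunLike.congr_fun (congrFun (DFunLike.congr_fun (wedgeOp_mul_boundaryContract hs hδ ξ X)
      (wedgeOp Y w)) 0) x
  have contract_wedge : contract (S.extD ξ X) (wedgeOp Y w) 0 x = S.extD ξ X Y • w 0 x - 0 :=
    DFunLike.congr_fun (congrFun (DFunLike.congr_fun (contract_mul_wedgeOp (S.extD ξ X) Y) w) 0) x
  rw [S.extD_skew, neg_smul, ← sub_zero (S.extD ξ X Y • w 0 x), ← contract_wedge]
  exact eq_neg_of_add_eq_zero_left wedge_boundaryContract.symm

theorem IsFrame.smul_boundaryContract_bivector (h : IsFrame r e ε) (Λ : Bivector R Γ) :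
    r • (boundaryContract hs S E ξ (Λ.wedgeOp w) 0 x +
        boundaryContract hs S E ξ (Λ.wedgeOp w) 0 x) =
      r • (∑ p, S.extD ξ (Λ.sharp (ε p)) (e p)) • w 0 x := by
  have boundaryContract_smul (u : Forms R (Module.Dual R Γ) N) :
      boundaryContract hs S E ξ (r • u) = r • boundaryContract hs S E ξ u :=
    DFunLike.congr_fun (boundaryContract_mul_scale hs hδ ξ r) u
  have bivector : r • (Λ.wedgeOp w + Λ.wedgeOp w) =
      r • ∑ p, wedgeOp (e p) (wedgeOp (Λ.sharp (ε p)) w) :=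
    (DFunLike.congr_fun (h.scale_mul_bivector_wedgeOp Λ) w).trans
      (congrArg (r • ·) (sum_end_apply _ _ w))
  have contracted := congrArg (boundaryContract hs S E ξ · 0 x) bivector
  rw [boundaryContract_smul, boundaryContract_smul, map_add, map_sum] at contracted
  have boundaryContract_sum : (∑ p, boundaryContract hs S E ξ
      (wedgeOp (e p) (wedgeOp (Λ.sharp (ε p)) w))) 0 x =
      (∑ p, S.extD ξ (Λ.sharp (ε p)) (e p)) • w 0 x := by
    rw [sum_forms_apply, Finset.sum_smul]
    exact Finset.sum_congr rfl fun p _ => boundaryContract_wedgeOp_wedgeOp hs hδ ξ w x _ _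
  exact contracted.trans (congrArg (fun y : N => r • y) boundaryContract_sum)

end Contraction

section TopDegree
variable {D : Derivation ℝ R R}

theorem IsFrame.smul_alt_add_linearMap (h : IsFrame r e ε) {δ δ' : DerivOp D Γ} (τ : DerivOp D N)
    (K : Γ →ₗ[R] Γ) (hδ : ∀ v, δ' v = δ v + K v) (θ : Γ [⋀^Fin n]→ₗ[R] N) :
    r • δ'.alt τ n θ = r • (δ.alt τ n θ - (∑ p, ε p (K (e p))) • θ) := by
  ext v
  simp only [AlternatingMap.smul_apply, AlternatingMap.sub_apply, DerivOp.alt_apply, hδ,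
    AlternatingMap.map_update_add, Finset.sum_add_distrib, smul_sub, smul_add,
    h.smul_sum_update_linearMap K θ v]
  abel

theorem IsFrame.smul_canonicalOp_add_linearMap (h : IsFrame r e ε)
    {δ δ' : DerivOp D (Module.Dual R Γ)} (K : Module.Dual R Γ →ₗ[R] Module.Dual R Γ)
    (hδ : ∀ ξ, δ' ξ = δ ξ + K ξ) (φ : CanonicalLine R Γ n m) :
    r • canonicalOp n m δ' φ = r • (canonicalOp n m δ φ + (∑ p, K (ε p) (e p)) • φ) := by
  ext P v
  have alt_eq : r • δ'.alt (DerivOp.fn D) n P =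
      r • (δ.alt (DerivOp.fn D) n P - (∑ p, K (ε p) (e p)) • P) :=
    h.toDual.smul_alt_add_linearMap (DerivOp.fn D) K hδ P
  have apply_alt := DFunLike.congr_fun (congrArg φ alt_eq) v
  simp only [map_smul, map_sub, AlternatingMap.smul_apply, AlternatingMap.sub_apply,
    smul_eq_mul] at apply_alt
  simp only [LinearMap.smul_apply, LinearMap.add_apply, AlternatingMap.smul_apply,
    AlternatingMap.add_apply, canonicalOp_apply, AlternatingMap.sub_apply, smul_eq_mul]
  linear_combination -apply_alt

end TopDegree

theorem IsFrame.smul_canonicalOp_adDual_sharp (h : IsFrame r e ε) (S : SkewAlgebroid R Γ)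
    (Λ : Bivector R Γ) (ξ : Module.Dual R Γ) (φ : CanonicalLine R Γ n m) :
    r • canonicalOp n m (S.adDual (Λ.sharp ξ)) φ =
      r • (canonicalOp n m ((S.dualOf Λ).ad ξ) φ +
        (∑ p, S.extD ξ (Λ.sharp (ε p)) (e p)) • φ) :=
  h.smul_canonicalOp_add_linearMap (S.extD ξ ∘ₗ Λ.sharp) (S.adDual_sharp Λ ξ) φ

end Trace

section Derived
variable {R : Type*} [CommRing R] [Algebra ℝ R] {Γ : Type*} [AddCommGroup Γ] [Module R Γ]
  {N : Type*} [AddCommGroup N] [Module R N] {n m : ℕ}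
  {q : (N ⊗[R] N) ≃ₗ[R] CanonicalLine R Γ n m}
  (hq : HasUniqueRoots (C := CanonicalLine R Γ n m) q)
  {I : Type*} {r : I → R} {d : I → Fin m → Derivation ℝ R R}
  {dx : I → Fin m → Module.Dual R (Derivation ℝ R R)} (hd : ∀ i, IsFrame (r i) (d i) (dx i))
  {e : I → Fin n → Γ} {ε : I → Fin n → Module.Dual R Γ} (hf : ∀ i, IsFrame (r i) (e i) (ε i))
  (hR : Separates r R) (hN : Separates r N)

theorem smul_lieRoot_sharp (S : SkewAlgebroid R Γ) (Λ : Bivector R Γ) (ξ : Module.Dual R Γ)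
    (i : I) (y : N) :
    r i • lieRoot hq S (Λ.sharp ξ) y = r i • ((rootConnection hq hd hf hR (S.dualOf Λ)).act ξ y +
      (algebraMap ℝ R 2⁻¹ * ∑ p, S.extD ξ (Λ.sharp (ε i p)) (e i p)) • y) := by
  set t := ∑ p, S.extD ξ (Λ.sharp (ε i p)) (e i p)
  have half_add_half : algebraMap ℝ R 2⁻¹ * t + algebraMap ℝ R 2⁻¹ * t = t := by
    rw [← mul_add]
    exact half_smul_add_self (R := R) t
  refine hq.unique ((isRoot_lieRoot hq S (Λ.sharp ξ)).smul (r i))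
    (((hq.isRoot_rootOp (canonicalOp n m ((S.dualOf Λ).ad ξ))).add
      (.smul_id (algebraMap ℝ R 2⁻¹ * t))).smul (r i)) (fun φ => ?_) y
  rw [half_add_half]
  exact (hf i).smul_canonicalOp_adDual_sharp S Λ ξ φ

theorem rootConnection_isDerived
    [Subsingleton (Module.Dual R Γ [⋀^Fin (n + 1)]→ₗ[R] N)]
    (hs : Function.Bijective (starMap (R := R) (Γ := Γ) (N := N) n)) (S : SkewAlgebroid R Γ)
    (Λ : Bivector R Γ) : (rootConnection hq hd hf hR (S.dualOf Λ)).IsDerived hs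
      (dualRootConnection hq hd hf hR hN S) (lieRoot hq S) := fun ξ w x => by
  refine hN.eq fun i => ?_
  set t := ∑ p, S.extD ξ (Λ.sharp (ε i p)) (e i p)
  set E := dualRootConnection hq hd hf hR hN S
  set contracted := boundaryContract hs S E ξ (Λ.wedgeOp w) 0 x
  have twice_contracted : r i • (contracted + contracted) = r i • t • w 0 x :=
    (hf i).smul_boundaryContract_bivector hs
      (dualRootConnection_isInducedBy hq hd hf hR hN S) ξ w x Λ
  have half_trace : r i • contracted = r i • (algebraMap ℝ R 2⁻¹ * t) • w 0 x := by
    rw [← half_smul_add_self (R := R) (r i • contracted), ← smul_add, twice_contracted, smul_comm,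
      mul_smul]
  rw [smul_sub, smul_lieRoot_sharp hq hd hf hR S Λ ξ i, half_trace, smul_add, add_sub_cancel_right]

theorem dirac_dirac_of_uniqueRoots
    [Subsingleton (Module.Dual R Γ [⋀^Fin (n + 1)]→ₗ[R] N)]
    (hs : Function.Bijective (starMap (R := R) (Γ := Γ) (N := N) n)) (S : LieAlgebroid R Γ)
    (Λ : Bivector R Γ)
    (hΛ : ∀ X, bracketSection S.toSkewAlgebroid (schouten S.toSkewAlgebroid Λ Λ) X = 0)
    (a : Forms R (Module.Dual R Γ) N) :
    let E := dualRootConnection hq hd hf hR hN S.toSkewAlgebroid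
    let E' := rootConnection hq hd hf hR (S.dualOf Λ)
    dirac S.toSkewAlgebroid (S.dualOf Λ) hs E E'
      (dirac S.toSkewAlgebroid (S.dualOf Λ) hs E E' a) = 0 := by
  have flat := dualRootConnection_isFlat hq hd hf hR hN S
  have dual_d_sq := (S.exactDual Λ hΛ (schouten_d₀ hf hR hΛ)).dOp_mul_dOp
    (rootConnection_isFlat hq hd hf hR _)
  intro _ _
  exact dirac_dirac hs (dualRootConnection_isInducedBy hq hd hf hR hN S.toSkewAlgebroid)
    (rootConnection_isDerived hq hd hf hR hN hs S.toSkewAlgebroid Λ) (S.dOp_mul_dOp flat)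
    dual_d_sq a

end Derived

section DiracSquare
variable {R : Type*} [CommRing R] [Algebra ℝ R] {Γ : Type*} [AddCommGroup Γ] [Module R Γ]
  {N : Type*} [AddCommGroup N] [Module R N] {n m : ℕ}
  {q : (N ⊗[R] N) ≃ₗ[R] CanonicalLine R Γ n m} {I : Type*} {r : I → R}
  {l : I → N} {c : I → Module.Dual R N} {d : I → Fin m → Derivation ℝ R R}
  {dx : I → Fin m → Module.Dual R (Derivation ℝ R R)} {e : I → Fin n → Γ}
  {ε : I → Fin n → Module.Dual R Γ}

theorem exists_dirac_dirac (hL : ∀ i, IsLineFrame (r i) (l i) (c i))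
    (hd : ∀ i, IsFrame (r i) (d i) (dx i)) (hf : ∀ i, IsFrame (r i) (e i) (ε i))
    (hR : Separates (fun i => r i ^ 2) R) (hN : Separates (fun i => r i ^ 2) N)
    (hG : Glues (fun i => r i ^ 2) N) (S : LieAlgebroid R Γ) (Λ : Bivector R Γ)
    (hΛ : ∀ X, bracketSection S.toSkewAlgebroid (schouten S.toSkewAlgebroid Λ Λ) X = 0) :
    ∃ hs : Function.Bijective (starMap (R := R) (Γ := Γ) (N := N) n),
      ∃ E E', (∀ E₁, IsDualRootAction S.toSkewAlgebroid q E₁ ↔ E₁ = E) ∧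
        (∀ E₁, IsRootAction (S.dualOf Λ) q E₁ ↔ E₁ = E') ∧
        ∀ a, dirac S.toSkewAlgebroid (S.dualOf Λ) hs E E'
          (dirac S.toSkewAlgebroid (S.dualOf Λ) hs E E' a) = 0 := by
  have hd_sq i := (hd i).sq
  have hf_sq i := (hf i).sq
  have hs := starMap_bijective hf_sq hN hG
  have hC : Separates (fun i => r i ^ 2) (CanonicalLine R Γ n m) := hR.alternating.linearMap
  have hq := hasUniqueRoots_of_isLineFrame hL hN hG hC q
  have hsymm := map_tmul_comm_of_isLineFrame hL (Separates.of_sq hC) q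
  have := hN.alternating_subsingleton (fun i => (hf_sq i).toDual) n.lt_succ_self
  refine ⟨hs, dualRootConnection hq hd_sq hf_sq hR hN S.toSkewAlgebroid,
    rootConnection hq hd_sq hf_sq hR (S.dualOf Λ),
    isDualRootAction_iff hq hd_sq hf_sq hR hN hsymm S.toSkewAlgebroid,
    isRootAction_iff hq hd_sq hf_sq hR (S.dualOf Λ),
    dirac_dirac_of_uniqueRoots hq hd_sq hf_sq hR hN hs S Λ hΛ⟩

end DiracSquare

section Hadamard
open MeasureTheory
variable {E W : Type*} [NormedAddCommGroup E] [NormedSpace ℝ E] [NormedAddCommGroup W]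
  [NormedSpace ℝ W]

-- The integral is the convolution at `0` of the indicator function of `(0, 1]` with the
-- compactly supported family `t ↦ χ t • φ p (-t)`.
theorem contDiff_integral_zero_one {φ : E → ℝ → W} (hφ : ContDiff ℝ ∞ ↿φ) :
    ContDiff ℝ ∞ fun p => ∫ t in (0 : ℝ)..1, φ p t := by
  let χ : ContDiffBump (0 : ℝ) := ⟨2, 3, by norm_num, by norm_num⟩
  let f : ℝ → ℝ := Set.indicator (Set.Ioc 0 1) 1
  let g : E → ℝ → W := fun p t => χ t • φ p (-t)
  have contDiff_g : ContDiff ℝ ∞ ↿g :=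
    (χ.contDiff.comp contDiff_snd).smul (hφ.comp (contDiff_fst.prodMk contDiff_snd.neg))
  have f_integrable : LocallyIntegrable f volume :=
    ((integrable_indicator_iff measurableSet_Ioc).mpr
      (integrableOn_const (by simp))).locallyIntegrable
  have g_eq_zero : ∀ p t, p ∈ Set.univ → t ∉ Metric.closedBall (0 : ℝ) 3 → g p t = 0 :=
    fun p t _ ht => by simp [g, χ.zero_of_le_dist (not_le.mp ht).le]
  have contDiff_convolution := contDiffOn_convolution_right_with_param_comp (μ := volume)
    (n := ⊤) (ContinuousLinearMap.lsmul ℝ ℝ) (v := fun _ : E => (0 : ℝ)) contDiffOn_const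
    isOpen_univ (isCompact_closedBall _ _) g_eq_zero f_integrable contDiff_g.contDiffOn
  rw [contDiffOn_univ] at contDiff_convolution
  convert contDiff_convolution using 2 with p
  rw [intervalIntegral.integral_of_le zero_le_one, convolution,
    ← integral_indicator measurableSet_Ioc]
  congr 1
  ext t
  by_cases ht : t ∈ Set.Ioc (0 : ℝ) 1
  · have χ_eq_one : χ (-t) = 1 := χ.one_of_mem_closedBall (by
      rw [mem_closedBall_zero_iff, norm_neg, Real.norm_eq_abs, abs_of_pos ht.1]
      exact ht.2.trans one_le_two)
    simp [f, g, ht, χ_eq_one]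
  · simp [f, g, ht]

theorem exists_contDiff_eq_add_apply_sub [CompleteSpace W] {h : E → W} (hh : ContDiff ℝ ∞ h)
    (z₀ : E) : ∃ G : E → E →L[ℝ] W, ContDiff ℝ ∞ G ∧ G z₀ = fderiv ℝ h z₀ ∧
      ∀ z, h z = h z₀ + G z (z - z₀) := by
  have contDiff_fderiv : ContDiff ℝ ∞ (fderiv ℝ h) := hh.fderiv_right (by simp)
  refine ⟨fun z => ∫ t in (0 : ℝ)..1, fderiv ℝ h (z₀ + t • (z - z₀)), ?_, by simp, fun z => ?_⟩
  · exact contDiff_integral_zero_one (φ := fun z t => fderiv ℝ h (z₀ + t • (z - z₀)))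
      (contDiff_fderiv.comp (contDiff_const.add
        (contDiff_snd.smul (contDiff_fst.sub contDiff_const))))
  · have continuous_fderiv : Continuous fun t : ℝ => fderiv ℝ h (z₀ + t • (z - z₀)) :=
      contDiff_fderiv.continuous.comp (by fun_prop)
    have hasDerivAt_segment (t : ℝ) : HasDerivAt (fun t : ℝ => h (z₀ + t • (z - z₀)))
        (fderiv ℝ h (z₀ + t • (z - z₀)) (z - z₀)) t := by
      refine (hh.differentiable (by simp) _).hasFDerivAt.comp_hasDerivAt t ?_
      simpa using ((hasDerivAt_id t).smul_const (z - z₀)).const_add z₀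
    rw [ContinuousLinearMap.intervalIntegral_apply (continuous_fderiv.intervalIntegrable _ _),
      intervalIntegral.integral_eq_sub_of_hasDerivAt (fun t _ => hasDerivAt_segment t)
        ((continuous_fderiv.clm_apply continuous_const).intervalIntegrable _ _)]
    simp

end Hadamard

section Coordinates
variable {𝕂 : Type*} [RCLike 𝕂] {m : ℕ}

/-- The `j`-th coordinate, with values in `𝕂`. -/
def coordCLM (j : Fin m) : EuclideanSpace ℝ (Fin m) →L[ℝ] 𝕂 :=
  RCLike.ofRealCLM ∘L EuclideanSpace.proj j

theorem coordCLM_single (i j : Fin m) :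
    (coordCLM i (EuclideanSpace.single j 1) : 𝕂) = if i = j then 1 else 0 := by
  change ((EuclideanSpace.single j (1 : ℝ) i : ℝ) : 𝕂) = _
  split_ifs with hij <;> simp [hij]

theorem exists_contDiff_eq_add_sum_coordCLM {h : EuclideanSpace ℝ (Fin m) → 𝕂}
    (hh : ContDiff ℝ ∞ h) (z₀ : EuclideanSpace ℝ (Fin m)) :
    ∃ k : Fin m → EuclideanSpace ℝ (Fin m) → 𝕂, (∀ j, ContDiff ℝ ∞ (k j)) ∧
      (∀ j, k j z₀ = fderiv ℝ h z₀ (EuclideanSpace.single j 1)) ∧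
      ∀ z, h z = h z₀ + ∑ j, (coordCLM j z - coordCLM j z₀) * k j z := by
  obtain ⟨G, hG, hG_z₀, expansion⟩ := exists_contDiff_eq_add_apply_sub hh z₀
  refine ⟨fun j z => G z (EuclideanSpace.single j 1), fun j => hG.clm_apply contDiff_const,
    fun j => congrArg (· (EuclideanSpace.single j 1)) hG_z₀, fun z => ?_⟩
  have sub_eq_sum : z - z₀ = ∑ j, (z j - z₀ j) • EuclideanSpace.single j (1 : ℝ) := by
    ext i
    simp [Finset.sum_apply, Pi.single_apply]
  rw [expansion z, sub_eq_sum, map_sum]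
  congr! 2 with j
  rw [map_smul, Algebra.smul_def, ← map_sub]
  rfl

end Coordinates

section CutOff
open Topology Bundle

theorem smul_congr_of_ne_zero {R N : Type*} [Zero R] [Zero N] [SMulWithZero R N] {r : R}
    {a b : N} (h : r ≠ 0 → a = b) : r • a = r • b := by
  by_cases hr : r = 0
  · rw [hr, zero_smul, zero_smul]
  · rw [h hr]

variable {𝕂 : Type*} [RCLike 𝕂] {m : ℕ}
  {M : Type*} [TopologicalSpace M] [ChartedSpace (EuclideanSpace ℝ (Fin m)) M]

variable (m) in
/-- A smooth real function on `M` with closed support in `U`; it localizes functions and sections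
that are smooth on `U` only. -/
structure CutOff (U : Set M) where
  toFun : M → ℝ
  contMDiff : ContMDiff (𝓡 m) 𝓘(ℝ, ℝ) ∞ toFun
  tsupport_subset : tsupport toFun ⊆ U

namespace CutOff
variable {U : Set M}

instance : CoeFun (CutOff m U) fun _ => M → ℝ := ⟨toFun⟩

theorem mem_of_apply_ne_zero (ρ : CutOff m U) {y : M} (hy : ρ y ≠ 0) : y ∈ U :=
  ρ.tsupport_subset (subset_tsupport _ hy)

theorem mem_of_apply_eq_one (ρ : CutOff m U) {y : M} (hy : ρ y = 1) : y ∈ U :=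
  ρ.mem_of_apply_ne_zero (hy ▸ one_ne_zero)

/-- A cut-off function as a scalar. -/
def scalar (ρ : CutOff m U) : SmoothFunctions 𝕂 m M :=
  ⟨fun y => ρ y • (1 : 𝕂), ρ.contMDiff.smul contMDiff_const⟩

theorem scalar_apply (ρ : CutOff m U) (y : M) :
    (ρ.scalar : SmoothFunctions 𝕂 m M) y = ρ y • 1 := rfl

theorem exists_eventually_eq_one [IsManifold (𝓡 m) ∞ M] [T2Space M] {x : M} (hU : U ∈ 𝓝 x) :
    ∃ ρ : CutOff m U, ∀ᶠ y in 𝓝 x, ρ y = 1 := by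
  obtain ⟨f, -, hf⟩ := (SmoothBumpFunction.nhds_basis_tsupport (I := 𝓡 m) x).mem_iff.mp hU
  exact ⟨⟨f, f.contMDiff, hf⟩, f.eventuallyEq_one⟩

variable (𝕂) in
theorem exists_scalar_eventually_eq_one [IsManifold (𝓡 m) ∞ M] [T2Space M] {x : M}
    (hU : U ∈ 𝓝 x) : ∃ (ρ : CutOff m U) (τ : SmoothFunctions 𝕂 m M),
      (∀ᶠ y in 𝓝 x, τ y = 1) ∧ ∀ y, τ y ≠ 0 → ∀ᶠ z in 𝓝 y, ρ z = 1 := by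
  obtain ⟨ρ, hρ⟩ := exists_eventually_eq_one (m := m) hU
  obtain ⟨σ, hσ⟩ := exists_eventually_eq_one (m := m) (eventually_eventually_nhds.mpr hρ)
  refine ⟨ρ, σ.scalar, hσ.mono fun y hy => by rw [scalar_apply, hy, one_smul], fun y hy => ?_⟩
  exact σ.mem_of_apply_ne_zero (left_ne_zero_of_smul (show σ y • (1 : 𝕂) ≠ 0 from hy))

/-- The product of a cut-off function with a function that is smooth on `U`. -/
def smulFn (ρ : CutOff m U) (hU : IsOpen U) (g : M → 𝕂)
    (hg : ContMDiffOn (𝓡 m) 𝓘(ℝ, 𝕂) ∞ g U) : SmoothFunctions 𝕂 m M :=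
  ⟨fun y => ρ y • g y, contMDiff_of_tsupport fun x hx => by
    have x_mem : x ∈ U := ρ.tsupport_subset (tsupport_smul_subset_left _ _ hx)
    exact (ρ.contMDiff x).smul ((hg x x_mem).contMDiffAt (hU.mem_nhds x_mem))⟩

variable {F : Type*} [NormedAddCommGroup F] [NormedSpace ℝ F]
  {A : M → Type*} [TopologicalSpace (TotalSpace F A)]
  [∀ x, TopologicalSpace (A x)] [∀ x, AddCommGroup (A x)] [∀ x, Module ℝ (A x)]
  [FiberBundle F A] [VectorBundle ℝ F A] [ContMDiffVectorBundle ∞ F A (𝓡 m)]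
  (e : Trivialization F (TotalSpace.proj : TotalSpace F A → M)) [MemTrivializationAtlas e]

/-- The section that is constant with value `v` in the trivialization `e`, cut off. -/
def cutSection (ρ : CutOff m U) (hU : IsOpen U) (hUe : U ⊆ e.baseSet) (v : F) :
    Cₛ^∞⟮𝓡 m; F, A⟯ :=
  ⟨fun y => ρ y • e.symm y v, ContMDiffOn.smul_section_of_tsupport ρ.contMDiff.contMDiffOn hU
    ρ.tsupport_subset ((e.contMDiffOn_section_iff hU hUe).mpr
      ((contMDiffOn_const (c := v)).congr fun y hy => by rw [e.apply_mk_symm (hUe hy)]))⟩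

theorem apply_cutSection (ρ : CutOff m U) (hU : IsOpen U) (hUe : U ⊆ e.baseSet) (v : F) {y : M}
    (hy : ρ y = 1) : (e ⟨y, ρ.cutSection e hU hUe v y⟩).2 = v := by
  change (e ⟨y, ρ y • e.symm y v⟩).2 = v
  rw [hy, one_smul, e.apply_mk_symm (hUe (ρ.mem_of_apply_eq_one hy))]

variable [NormedSpace 𝕂 F] [IsScalarTower ℝ 𝕂 F] [FiniteDimensional 𝕂 F]
  [∀ x, Module 𝕂 (A x)] [VectorBundle 𝕂 F A]

/-- A linear function of the value of a section in the trivialization `e`, cut off. -/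
def coord (ρ : CutOff m U) (hU : IsOpen U) (hUe : U ⊆ e.baseSet) (φ : F →ₗ[𝕂] 𝕂) :
    Module.Dual (SmoothFunctions 𝕂 m M) Cₛ^∞⟮𝓡 m; F, A⟯ where
  toFun s := ρ.smulFn hU (fun y => φ (e ⟨y, s y⟩).2)
    ((φ.toContinuousLinearMap.contDiff.restrict_scalars ℝ).contMDiff.comp_contMDiffOn
      ((e.contMDiffOn_section_iff hU hUe).mp s.contMDiff.contMDiffOn))
  map_add' s t := by
    ext y
    refine (smul_congr_of_ne_zero fun hy => ?_).trans (smul_add _ _ _)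
    exact (congrArg φ ((e.linear 𝕂 (hUe (ρ.mem_of_apply_ne_zero hy))).1 _ _)).trans (map_add φ _ _)
  map_smul' f s := by
    ext y
    refine (smul_congr_of_ne_zero fun hy => ?_).trans (smul_comm _ (f y) _)
    exact (congrArg φ ((e.linear 𝕂 (hUe (ρ.mem_of_apply_ne_zero hy))).2 _ _)).trans
      (map_smul φ _ _)

theorem coord_apply (ρ : CutOff m U) (hU : IsOpen U) (hUe : U ⊆ e.baseSet) (φ : F →ₗ[𝕂] 𝕂)
    (s : Cₛ^∞⟮𝓡 m; F, A⟯) {y : M} (hy : ρ y = 1) :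
    ρ.coord e hU hUe φ s y = φ (e ⟨y, s y⟩).2 := by
  change ρ y • φ (e ⟨y, s y⟩).2 = _
  rw [hy, one_smul]

theorem sum_coord_smul_cutSection {n : ℕ} (ρ : CutOff m U) (hU : IsOpen U) (hUe : U ⊆ e.baseSet)
    (b : Module.Basis (Fin n) 𝕂 F) (s : Cₛ^∞⟮𝓡 m; F, A⟯) {y : M} (hy : ρ y = 1) :
    (∑ i, ρ.coord e hU hUe (b.coord i) s • ρ.cutSection e hU hUe (b i)) y = s y := by
  have y_mem : y ∈ e.baseSet := hUe (ρ.mem_of_apply_eq_one hy)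
  apply (e.linearEquivAt 𝕂 y y_mem).injective
  have sum_apply := congrFun (map_sum (ContMDiffSection.coeAddHom (𝓡 m) F ∞ A)
    (fun i => ρ.coord e hU hUe (b.coord i) s • ρ.cutSection e hU hUe (b i)) Finset.univ) y
  rw [Finset.sum_apply] at sum_apply
  refine (congrArg _ sum_apply).trans ((map_sum _ _ _).trans ?_)
  refine (Finset.sum_congr rfl fun i _ => ?_).trans (b.sum_repr (e ⟨y, s y⟩).2)
  refine (map_smul (e.linearEquivAt 𝕂 y y_mem) _ _).trans ?_
  rw [ρ.coord_apply e hU hUe _ s hy]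
  exact congrArg _ (ρ.apply_cutSection e hU hUe (b i) hy)

theorem isFrame_sections {n : ℕ} (ρ : CutOff m U) (hU : IsOpen U) (hUe : U ⊆ e.baseSet)
    (b : Module.Basis (Fin n) 𝕂 F) {τ : SmoothFunctions 𝕂 m M}
    (hτ : ∀ y, τ y ≠ 0 → ρ y = 1) :
    IsFrame τ (fun i => (ρ.cutSection e hU hUe (b i) : Cₛ^∞⟮𝓡 m; F, A⟯))
      (fun i => ρ.coord e hU hUe (b.coord i)) where
  span s := by
    ext y
    exact smul_congr_of_ne_zero fun hy =>
      (ρ.sum_coord_smul_cutSection e hU hUe b s (hτ y hy)).symm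
  dual i j := by
    have dual_of_ne_zero (y : M) (hy : τ y ≠ 0) :
        ρ.coord e hU hUe (b.coord i) (ρ.cutSection e hU hUe (b j) : Cₛ^∞⟮𝓡 m; F, A⟯) y =
          if i = j then 1 else 0 := by
      rw [coord_apply _ _ _ _ _ _ (hτ y hy), apply_cutSection _ _ _ _ _ (hτ y hy), b.coord_apply,
        b.repr_self, Finsupp.single_apply]
      simp only [eq_comm]
    ext y
    refine (smul_congr_of_ne_zero (dual_of_ne_zero y)).trans ?_
    split_ifs
    · exact mul_one _
    · exact mul_zero _

end CutOff
end CutOff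

section Derivations
variable {R : Type*} [CommRing R] [Algebra ℝ R]

/-- The differential of a function, as a linear form on derivations. -/
def differential (f : R) : Module.Dual R (Derivation ℝ R R) where
  toFun D := D f
  map_add' _ _ := rfl
  map_smul' _ _ := rfl

theorem derivation_eq_zero_of_mul_self_eq_neg_one (D : Derivation ℝ R R) {j : R}
    (hj : j * j = -1) : D j = 0 := by
  have mul_D_eq_zero : j * D j = 0 := by
    have leibniz := D.leibniz j j
    rw [hj, D.map_neg, D.map_one_eq_zero, neg_zero] at leibniz
    exact eq_zero_of_add_self R leibniz.symm
  calc D j = -(j * j * D j) := by rw [hj]; ring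
    _ = 0 := by rw [mul_assoc, mul_D_eq_zero, mul_zero, neg_zero]

end Derivations

section ChartDerivations
open Topology
variable {𝕂 : Type*} [RCLike 𝕂] {m : ℕ}
  {M : Type*} [TopologicalSpace M] [ChartedSpace (EuclideanSpace ℝ (Fin m)) M]

theorem derivation_const (D : Derivation ℝ (SmoothFunctions 𝕂 m M) (SmoothFunctions 𝕂 m M))
    (c : 𝕂) : D (ContMDiffMap.const c) = 0 := by
  have D_I : D (ContMDiffMap.const (RCLike.I : 𝕂)) = 0 := by
    rcases RCLike.I_mul_I (K := 𝕂) with I_eq_zero | I_sq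
    · rw [I_eq_zero]
      exact map_zero D
    · exact derivation_eq_zero_of_mul_self_eq_neg_one D (ContMDiffMap.ext fun _ => I_sq)
  have const_eq : (ContMDiffMap.const c : SmoothFunctions 𝕂 m M) =
      RCLike.re c • 1 + RCLike.im c • ContMDiffMap.const (RCLike.I : 𝕂) := by
    ext y
    change c = RCLike.re c • (1 : 𝕂) + RCLike.im c • (RCLike.I : 𝕂)
    rw [Algebra.smul_def, Algebra.smul_def, mul_one]
    exact (RCLike.re_add_im c).symm
  rw [const_eq, map_add, D.map_smul, D.map_smul, D_I, D.map_one_eq_zero, smul_zero, smul_zero,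
    add_zero]

theorem exists_contDiff_eventuallyEq {s : Set (EuclideanSpace ℝ (Fin m))}
    {f : EuclideanSpace ℝ (Fin m) → 𝕂} (hf : ContDiffOn ℝ ∞ f s) (hs : IsOpen s)
    {z : EuclideanSpace ℝ (Fin m)} (hz : z ∈ s) : ∃ h, ContDiff ℝ ∞ h ∧ h =ᶠ[𝓝 z] f := by
  obtain ⟨χ, hχ⟩ := CutOff.exists_eventually_eq_one (m := m) (hs.mem_nhds hz)
  refine ⟨χ.smulFn hs f hf.contMDiffOn, (χ.smulFn hs f hf.contMDiffOn).contMDiff.contDiff, ?_⟩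
  filter_upwards [hχ] with y hy
  change χ y • f y = f y
  rw [hy, one_smul]

variable [IsManifold (𝓡 m) ∞ M]

theorem derivation_congr [T2Space M]
    (D : Derivation ℝ (SmoothFunctions 𝕂 m M) (SmoothFunctions 𝕂 m M))
    {f g : SmoothFunctions 𝕂 m M} {y : M} (hfg : ∀ᶠ z in 𝓝 y, f z = g z) : D f y = D g y := by
  obtain ⟨σ, hσ⟩ := CutOff.exists_eventually_eq_one (m := m) hfg
  have mul_sub_eq_zero : σ.scalar * (f - g) = 0 := by
    ext z
    refine (smul_congr_of_ne_zero fun hz => ?_).trans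
      (smul_zero ((σ.scalar : SmoothFunctions 𝕂 m M) z))
    have σ_ne_zero : σ z ≠ 0 := left_ne_zero_of_smul (show σ z • (1 : 𝕂) ≠ 0 from hz)
    exact sub_eq_zero.mpr (σ.mem_of_apply_ne_zero σ_ne_zero)
  have leibniz := DFunLike.congr_fun (D.leibniz σ.scalar (f - g)) y
  rw [mul_sub_eq_zero, map_zero, map_sub] at leibniz
  change 0 = (σ y • (1 : 𝕂)) * (D f y - D g y) + (f y - g y) * D σ.scalar y at leibniz
  rw [hfg.self_of_nhds, hσ.self_of_nhds, sub_self, zero_mul, add_zero, one_smul, one_mul]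
    at leibniz
  exact sub_eq_zero.mp leibniz.symm

variable {U : Set M} {x : M}

theorem contDiffOn_comp_extChartAt_symm (f : SmoothFunctions 𝕂 m M) (x : M) :
    ContDiffOn ℝ ∞ (f ∘ (extChartAt (𝓡 m) x).symm) (extChartAt (𝓡 m) x).target :=
  contMDiffOn_iff_contDiffOn.mp (f.contMDiff.comp_contMDiffOn (contMDiffOn_extChartAt_symm x))

theorem differentiableAt_comp_extChartAt_symm (f : SmoothFunctions 𝕂 m M) {y : M}
    (hy : y ∈ (extChartAt (𝓡 m) x).source) :
    DifferentiableAt ℝ (f ∘ (extChartAt (𝓡 m) x).symm) (extChartAt (𝓡 m) x y) :=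
  ((contDiffOn_comp_extChartAt_symm f x).contDiffAt ((isOpen_extChartAt_target x).mem_nhds
    ((extChartAt (𝓡 m) x).map_source hy))).differentiableAt (by simp)

theorem contMDiffOn_fderiv_comp_extChartAt_symm (f : SmoothFunctions 𝕂 m M) (x : M)
    (v : EuclideanSpace ℝ (Fin m)) :
    ContMDiffOn (𝓡 m) 𝓘(ℝ, 𝕂) ∞
      (fun y => fderiv ℝ (f ∘ (extChartAt (𝓡 m) x).symm) (extChartAt (𝓡 m) x y) v)
      (extChartAt (𝓡 m) x).source := by
  have contDiffOn_fderiv : ContDiffOn ℝ ∞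
      (fun z => fderiv ℝ (f ∘ (extChartAt (𝓡 m) x).symm) z v) (extChartAt (𝓡 m) x).target :=
    ((contDiffOn_comp_extChartAt_symm f x).fderiv_of_isOpen (isOpen_extChartAt_target x)
      (by simp)).clm_apply contDiffOn_const
  refine contDiffOn_fderiv.contMDiffOn.comp ?_ fun y => (extChartAt (𝓡 m) x).map_source
  rw [extChartAt_source]
  exact contMDiffOn_extChartAt

namespace CutOff

/-- The derivative in a fixed direction `v` of a chart, cut off. -/
def chartDeriv (ρ : CutOff m U) (hU : IsOpen U) (hUx : U ⊆ (extChartAt (𝓡 m) x).source)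
    (v : EuclideanSpace ℝ (Fin m)) :
    Derivation ℝ (SmoothFunctions 𝕂 m M) (SmoothFunctions 𝕂 m M) :=
  Derivation.mk'
    { toFun f := ρ.smulFn hU
        (fun y => fderiv ℝ (f ∘ (extChartAt (𝓡 m) x).symm) (extChartAt (𝓡 m) x y) v)
        ((contMDiffOn_fderiv_comp_extChartAt_symm f x v).mono hUx)
      map_add' f g := by
        ext y
        refine (smul_congr_of_ne_zero fun hy => ?_).trans (smul_add _ _ _)
        have y_mem := hUx (ρ.mem_of_apply_ne_zero hy)
        exact DFunLike.congr_fun (fderiv_add (differentiableAt_comp_extChartAt_symm f y_mem)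
          (differentiableAt_comp_extChartAt_symm g y_mem)) v
      map_smul' c f := by
        ext y
        refine (smul_congr_of_ne_zero fun hy => ?_).trans (smul_comm _ c _)
        exact DFunLike.congr_fun (fderiv_const_smul (differentiableAt_comp_extChartAt_symm f
          (hUx (ρ.mem_of_apply_ne_zero hy))) c) v }
    fun f g => by
      ext y
      refine (smul_congr_of_ne_zero fun hy => ?_).trans ((smul_add _ _ _).trans
        (congrArg₂ (· + ·) (smul_comm _ (f y) _) (smul_comm _ (g y) _)))
      have y_mem := hUx (ρ.mem_of_apply_ne_zero hy)
      refine (DFunLike.congr_fun (fderiv_mul (differentiableAt_comp_extChartAt_symm f y_mem)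
        (differentiableAt_comp_extChartAt_symm g y_mem)) v).trans ?_
      simp only [Function.comp_apply, (extChartAt (𝓡 m) x).left_inv y_mem]
      rfl

theorem chartDeriv_apply (ρ : CutOff m U) (hU : IsOpen U)
    (hUx : U ⊆ (extChartAt (𝓡 m) x).source) (v : EuclideanSpace ℝ (Fin m))
    (f : SmoothFunctions 𝕂 m M) (y : M) : ρ.chartDeriv hU hUx v f y =
      ρ y • fderiv ℝ (f ∘ (extChartAt (𝓡 m) x).symm) (extChartAt (𝓡 m) x y) v := rfl

/-- A function on the model space, pulled back by a chart and cut off. -/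
def pullback (ρ : CutOff m U) (hU : IsOpen U) (hUx : U ⊆ (extChartAt (𝓡 m) x).source)
    {k : EuclideanSpace ℝ (Fin m) → 𝕂} (hk : ContDiff ℝ ∞ k) : SmoothFunctions 𝕂 m M :=
  ρ.smulFn hU (k ∘ extChartAt (𝓡 m) x) (hk.contMDiff.comp_contMDiffOn
    (contMDiffOn_extChartAt.mono (extChartAt_source (𝓡 m) x ▸ hUx)))

theorem pullback_apply (ρ : CutOff m U) (hU : IsOpen U) (hUx : U ⊆ (extChartAt (𝓡 m) x).source)
    {k : EuclideanSpace ℝ (Fin m) → 𝕂} (hk : ContDiff ℝ ∞ k) {y : M} (hy : ρ y = 1) :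
    ρ.pullback hU hUx hk y = k (extChartAt (𝓡 m) x y) := by
  change ρ y • k (extChartAt (𝓡 m) x y) = _
  rw [hy, one_smul]

theorem chartDeriv_pullback (ρ : CutOff m U) (hU : IsOpen U)
    (hUx : U ⊆ (extChartAt (𝓡 m) x).source) (v : EuclideanSpace ℝ (Fin m))
    {k : EuclideanSpace ℝ (Fin m) → 𝕂} (hk : ContDiff ℝ ∞ k) {y : M}
    (hy : ∀ᶠ z in 𝓝 y, ρ z = 1) :
    ρ.chartDeriv hU hUx v (ρ.pullback hU hUx hk) y =
      fderiv ℝ k (extChartAt (𝓡 m) x y) v := by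
  have y_mem := hUx (ρ.mem_of_apply_eq_one hy.self_of_nhds)
  have tendsto_symm : Filter.Tendsto (extChartAt (𝓡 m) x).symm (𝓝 (extChartAt (𝓡 m) x y))
      (𝓝 y) := by
    simpa only [(extChartAt (𝓡 m) x).left_inv y_mem]
      using (continuousAt_extChartAt_symm' y_mem).tendsto
  have eventuallyEq_k :
      ρ.pullback hU hUx hk ∘ (extChartAt (𝓡 m) x).symm =ᶠ[𝓝 (extChartAt (𝓡 m) x y)] k := by
    filter_upwards [tendsto_symm.eventually hy, (isOpen_extChartAt_target x).mem_nhds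
      ((extChartAt (𝓡 m) x).map_source y_mem)] with z hz z_mem
    rw [Function.comp_apply, pullback_apply _ _ _ _ hz, (extChartAt (𝓡 m) x).right_inv z_mem]
  rw [chartDeriv_apply, hy.self_of_nhds, one_smul, eventuallyEq_k.fderiv_eq]

/-- The `j`-th coordinate function of a chart, cut off. -/
def chartCoord (ρ : CutOff m U) (hU : IsOpen U) (hUx : U ⊆ (extChartAt (𝓡 m) x).source)
    (j : Fin m) : SmoothFunctions 𝕂 m M :=
  ρ.pullback hU hUx (coordCLM j).contDiff

theorem exists_eventually_eq_add_sum_chartCoord (ρ : CutOff m U) (hU : IsOpen U)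
    (hUx : U ⊆ (extChartAt (𝓡 m) x).source) {y : M} (hy : ∀ᶠ z in 𝓝 y, ρ z = 1)
    (f : SmoothFunctions 𝕂 m M) :
    ∃ K : Fin m → SmoothFunctions 𝕂 m M,
      (∀ j, K j y = ρ.chartDeriv hU hUx (EuclideanSpace.single j 1) f y) ∧
      ∀ᶠ z in 𝓝 y, f z = f y +
        ∑ j, (ρ.chartCoord hU hUx j z - ρ.chartCoord hU hUx j y) * K j z := by
  set φ := extChartAt (𝓡 m) x with hφ
  have y_mem : y ∈ U := ρ.mem_of_apply_eq_one hy.self_of_nhds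
  obtain ⟨h, hh, h_eventuallyEq⟩ := exists_contDiff_eventuallyEq
    (contDiffOn_comp_extChartAt_symm f x) (isOpen_extChartAt_target x)
    (φ.map_source (hUx y_mem))
  obtain ⟨k, hk, k_y, expansion⟩ := exists_contDiff_eq_add_sum_coordCLM hh (φ y)
  have h_comp_eq {z : M} (hz : (f ∘ φ.symm) (φ z) = h (φ z)) (z_mem : z ∈ U) : f z = h (φ z) := by
    rwa [Function.comp_apply, φ.left_inv (hUx z_mem)] at hz
  refine ⟨fun j => ρ.pullback hU hUx (hk j), fun j => ?_, ?_⟩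
  · rw [pullback_apply _ _ _ _ hy.self_of_nhds, ← hφ, k_y, h_eventuallyEq.fderiv_eq,
      chartDeriv_apply, hy.self_of_nhds, one_smul]
  · filter_upwards [hy, hU.mem_nhds y_mem, (continuousAt_extChartAt' (hUx y_mem)).eventually
      h_eventuallyEq] with z hz z_mem hzh
    rw [h_comp_eq hzh.symm z_mem, h_comp_eq h_eventuallyEq.symm.self_of_nhds y_mem, expansion]
    simp only [chartCoord, pullback_apply _ _ _ _ hz, pullback_apply _ _ _ _ hy.self_of_nhds, ← hφ]

theorem derivation_apply_eq_sum [T2Space M] (ρ : CutOff m U) (hU : IsOpen U)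
    (hUx : U ⊆ (extChartAt (𝓡 m) x).source) {y : M} (hy : ∀ᶠ z in 𝓝 y, ρ z = 1)
    (D : Derivation ℝ (SmoothFunctions 𝕂 m M) (SmoothFunctions 𝕂 m M))
    (f : SmoothFunctions 𝕂 m M) :
    D f y = ∑ j, D (ρ.chartCoord hU hUx j) y *
      ρ.chartDeriv hU hUx (EuclideanSpace.single j 1) f y := by
  obtain ⟨K, K_y, expansion⟩ := ρ.exists_eventually_eq_add_sum_chartCoord hU hUx hy f
  let X (j : Fin m) : SmoothFunctions 𝕂 m M := ρ.chartCoord hU hUx j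
  have sum_apply (s : Fin m → SmoothFunctions 𝕂 m M) (z : M) : (∑ j, s j) z = ∑ j, s j z :=
    map_sum (ContMDiffMap.evalRingHom z) s _
  have D_f : D f y = D (ContMDiffMap.const (f y) +
      ∑ j, (X j - ContMDiffMap.const (X j y)) * K j) y := by
    refine derivation_congr D (expansion.mono fun z hz => hz.trans ?_)
    exact congrArg (f y + ·)
      (sum_apply (fun j => (X j - ContMDiffMap.const (X j y)) * K j) z).symm
  rw [D_f, map_add, derivation_const, zero_add, map_sum, sum_apply]
  refine Finset.sum_congr rfl fun j _ => ?_
  rw [D.leibniz, map_sub, derivation_const, sub_zero]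
  change (X j y - X j y) * D (K j) y + K j y * D (X j) y = _
  rw [sub_self, zero_mul, zero_add, K_y, mul_comm]

theorem isFrame_chartDeriv [T2Space M] (ρ : CutOff m U) (hU : IsOpen U)
    (hUx : U ⊆ (extChartAt (𝓡 m) x).source) {τ : SmoothFunctions 𝕂 m M}
    (hτ : ∀ y, τ y ≠ 0 → ∀ᶠ z in 𝓝 y, ρ z = 1) :
    IsFrame τ (fun j => ρ.chartDeriv hU hUx (EuclideanSpace.single j 1))
      (fun j => differential (ρ.chartCoord hU hUx j)) where
  span D := by
    ext f y
    refine smul_congr_of_ne_zero fun hy =>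
      (ρ.derivation_apply_eq_sum hU hUx (hτ y hy) D f).trans ?_
    exact (map_sum ((ContMDiffMap.evalRingHom y).toAddMonoidHom.comp
      (differential f).toAddMonoidHom) (fun j => differential (ρ.chartCoord hU hUx j) D •
        ρ.chartDeriv hU hUx (EuclideanSpace.single j 1)) Finset.univ).symm
  dual i j := by
    have dual_of_ne_zero (y : M) (hy : τ y ≠ 0) :
        ρ.chartDeriv hU hUx (EuclideanSpace.single j 1)
          (ρ.chartCoord hU hUx i : SmoothFunctions 𝕂 m M) y = if i = j then 1 else 0 := by
      rw [chartCoord, chartDeriv_pullback _ _ _ _ _ (hτ y hy), ContinuousLinearMap.fderiv,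
        coordCLM_single]
    ext y
    refine (smul_congr_of_ne_zero (dual_of_ne_zero y)).trans ?_
    split_ifs
    · exact mul_one _
    · exact mul_zero _

end CutOff
end ChartDerivations

theorem IsFrame.isLineFrame {R : Type*} [CommRing R] {N : Type*} [AddCommGroup N]
    [Module R N] {r : R} {e : Fin 1 → N} {ε : Fin 1 → Module.Dual R N} (h : IsFrame r e ε) :
    IsLineFrame r (e 0) (ε 0) where
  span x := by rw [h.span, Fin.sum_univ_one]
  dual := by rw [h.dual, if_pos rfl]

section Localization
open Topology Bundle
variable {𝕂 : Type*} [RCLike 𝕂] {m : ℕ}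
  {M : Type*} [TopologicalSpace M] [ChartedSpace (EuclideanSpace ℝ (Fin m)) M]

theorem sq_apply_eq_one {τ : SmoothFunctions 𝕂 m M} {y : M} (hτ : τ y = 1) : (τ ^ 2) y = 1 := by
  rw [pow_two]
  change τ y * τ y = 1
  rw [hτ, one_mul]

variable {τ : M → SmoothFunctions 𝕂 m M}

theorem separates_smoothFunctions (hτ : ∀ x, τ x x = 1) :
    Separates (fun x => τ x ^ 2) (SmoothFunctions 𝕂 m M) := fun f hf => by
  ext x
  have sq_mul : (τ x ^ 2) x * f x = 0 := DFunLike.congr_fun (hf x) x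
  rwa [sq_apply_eq_one (hτ x), one_mul] at sq_mul

variable {F : Type*} [NormedAddCommGroup F] [NormedSpace ℝ F] [NormedSpace 𝕂 F]
  [IsScalarTower ℝ 𝕂 F]
  {A : M → Type*} [TopologicalSpace (TotalSpace F A)]
  [∀ x, TopologicalSpace (A x)] [∀ x, AddCommGroup (A x)] [∀ x, Module ℝ (A x)]
  [∀ x, Module 𝕂 (A x)] [FiberBundle F A] [VectorBundle ℝ F A] [VectorBundle 𝕂 F A]

theorem separates_sections (hτ : ∀ x, τ x x = 1) :
    Separates (fun x => τ x ^ 2) Cₛ^∞⟮𝓡 m; F, A⟯ := fun s hs => by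
  ext x
  have sq_smul : (τ x ^ 2) x • s x = 0 := DFunLike.congr_fun (hs x) x
  rwa [sq_apply_eq_one (hτ x), one_smul] at sq_smul

theorem glues_sections (hτ : ∀ x, ∀ᶠ y in 𝓝 x, τ x y = 1) :
    Glues (fun x => τ x ^ 2) Cₛ^∞⟮𝓡 m; F, A⟯ := fun a ha => by
  have sq_smul_diagonal (x y : M) : (τ x ^ 2) y • a y y = a x y := by
    have compatible : (τ x ^ 2) y • a y y = (τ y ^ 2) y • a x y := DFunLike.congr_fun (ha x y) y
    rwa [sq_apply_eq_one (hτ y).self_of_nhds, one_smul] at compatible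
  refine ⟨⟨fun y => a y y, fun x => ?_⟩, fun x => ContMDiffSection.ext (sq_smul_diagonal x)⟩
  refine ((a x).contMDiff x).congr_of_eventuallyEq ?_
  filter_upwards [hτ x] with y hy
  rw [← sq_smul_diagonal x y, sq_apply_eq_one hy, one_smul]

end Localization

end DiracGen
end

theorem mainTheorem8_general {𝕂 : Type*} [RCLike 𝕂] {m : ℕ}
    {M : Type*} [TopologicalSpace M] [ChartedSpace (EuclideanSpace ℝ (Fin m)) M]
    [IsManifold (𝓡 m) ∞ M] [T2Space M]
    {F : Type*} [NormedAddCommGroup F] [NormedSpace ℝ F] [NormedSpace 𝕂 F]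
    [IsScalarTower ℝ 𝕂 F] [FiniteDimensional 𝕂 F]
    {A : M → Type*} [TopologicalSpace (Bundle.TotalSpace F A)]
    [∀ x, TopologicalSpace (A x)] [∀ x, AddCommGroup (A x)] [∀ x, Module ℝ (A x)]
    [∀ x, Module 𝕂 (A x)] [FiberBundle F A] [VectorBundle ℝ F A] [VectorBundle 𝕂 F A]
    [ContMDiffVectorBundle ∞ F A (𝓡 m)]
    {L : M → Type*} [TopologicalSpace (Bundle.TotalSpace 𝕂 L)]
    [∀ x, TopologicalSpace (L x)] [∀ x, AddCommGroup (L x)] [∀ x, Module ℝ (L x)]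
    [∀ x, Module 𝕂 (L x)] [FiberBundle 𝕂 L] [VectorBundle ℝ 𝕂 L] [VectorBundle 𝕂 𝕂 L]
    [ContMDiffVectorBundle ∞ 𝕂 L (𝓡 m)]
    (𝒜 : LieAlgebroid (SmoothFunctions 𝕂 m M) Cₛ^∞⟮𝓡 m; F, A⟯)
    (Λ : Bivector (SmoothFunctions 𝕂 m M) Cₛ^∞⟮𝓡 m; F, A⟯)
    (hΛ : ∀ X, bracketSection 𝒜.toSkewAlgebroid (schouten 𝒜.toSkewAlgebroid Λ Λ) X = 0)
    (q : (Cₛ^∞⟮𝓡 m; 𝕂, L⟯ ⊗[SmoothFunctions 𝕂 m M] Cₛ^∞⟮𝓡 m; 𝕂, L⟯) ≃ₗ[SmoothFunctions 𝕂 m M]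
      CanonicalLine (SmoothFunctions 𝕂 m M) Cₛ^∞⟮𝓡 m; F, A⟯ (Module.finrank 𝕂 F) m) :
    ∃ hs : Function.Bijective (starMap (R := SmoothFunctions 𝕂 m M) (Γ := Cₛ^∞⟮𝓡 m; F, A⟯)
        (N := Cₛ^∞⟮𝓡 m; 𝕂, L⟯) (Module.finrank 𝕂 F)),
      ∃ E E', (∀ E₁, IsDualRootAction 𝒜.toSkewAlgebroid q E₁ ↔ E₁ = E) ∧
        (∀ E₁, IsRootAction (𝒜.dualOf Λ) q E₁ ↔ E₁ = E') ∧
        ∀ a, dirac 𝒜.toSkewAlgebroid (𝒜.dualOf Λ) hs E E'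
          (dirac 𝒜.toSkewAlgebroid (𝒜.dualOf Λ) hs E E' a) = 0 := by
  let V (x : M) : Set M := (trivializationAt F A x).baseSet ∩ (trivializationAt 𝕂 L x).baseSet ∩
    (extChartAt (𝓡 m) x).source
  have isOpen_V (x : M) : IsOpen (V x) := ((trivializationAt F A x).open_baseSet.inter
    (trivializationAt 𝕂 L x).open_baseSet).inter (isOpen_extChartAt_source x)
  have V_mem_nhds (x : M) : V x ∈ nhds x := (isOpen_V x).mem_nhds
    ⟨⟨FiberBundle.mem_baseSet_trivializationAt' x, FiberBundle.mem_baseSet_trivializationAt' x⟩,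
      mem_extChartAt_source x⟩
  choose ρ τ τ_eventually ρ_eventually using fun x =>
    CutOff.exists_scalar_eventually_eq_one (m := m) 𝕂 (V_mem_nhds x)
  have τ_self (x : M) : τ x x = 1 := (τ_eventually x).self_of_nhds
  have ρ_eq_one (x y : M) (hy : τ x y ≠ 0) : ρ x y = 1 := (ρ_eventually x y hy).self_of_nhds
  exact exists_dirac_dirac
    (fun x => ((ρ x).isFrame_sections (A := L) (trivializationAt 𝕂 L x) (isOpen_V x)
      (fun y hy => hy.1.2) (Module.Basis.singleton (Fin 1) 𝕂) (ρ_eq_one x)).isLineFrame)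
    (fun x => (ρ x).isFrame_chartDeriv (isOpen_V x) (fun y hy => hy.2) (ρ_eventually x))
    (fun x => (ρ x).isFrame_sections (A := A) (trivializationAt F A x) (isOpen_V x)
      (fun y hy => hy.1.1) (Module.finBasis 𝕂 F) (ρ_eq_one x))
    (separates_smoothFunctions τ_self) (separates_sections τ_self) (glues_sections τ_eventually)
    𝒜 Λ hΛ

theorem mainTheorem8 {𝕂 : Type*} [RCLike 𝕂] {m : ℕ}
    {M : Type*} [TopologicalSpace M] [ChartedSpace (EuclideanSpace ℝ (Fin m)) M]
    [IsManifold (𝓡 m) ∞ M] [T2Space M] [SecondCountableTopology M]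
    {F : Type*} [NormedAddCommGroup F] [NormedSpace ℝ F] [NormedSpace 𝕂 F]
    [IsScalarTower ℝ 𝕂 F] [FiniteDimensional 𝕂 F]
    {A : M → Type*} [TopologicalSpace (Bundle.TotalSpace F A)]
    [∀ x, TopologicalSpace (A x)] [∀ x, AddCommGroup (A x)] [∀ x, Module ℝ (A x)]
    [∀ x, Module 𝕂 (A x)] [FiberBundle F A] [VectorBundle ℝ F A] [VectorBundle 𝕂 F A]
    [ContMDiffVectorBundle ∞ F A (𝓡 m)]
    {L : M → Type*} [TopologicalSpace (Bundle.TotalSpace 𝕂 L)]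
    [∀ x, TopologicalSpace (L x)] [∀ x, AddCommGroup (L x)] [∀ x, Module ℝ (L x)]
    [∀ x, Module 𝕂 (L x)] [FiberBundle 𝕂 L] [VectorBundle ℝ 𝕂 L] [VectorBundle 𝕂 𝕂 L]
    [ContMDiffVectorBundle ∞ 𝕂 L (𝓡 m)]
    (𝒜 : LieAlgebroid (SmoothFunctions 𝕂 m M) Cₛ^∞⟮𝓡 m; F, A⟯)
    (Λ : Bivector (SmoothFunctions 𝕂 m M) Cₛ^∞⟮𝓡 m; F, A⟯)
    (hΛ : ∀ X, bracketSection 𝒜.toSkewAlgebroid (schouten 𝒜.toSkewAlgebroid Λ Λ) X = 0)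
    (q : (Cₛ^∞⟮𝓡 m; 𝕂, L⟯ ⊗[SmoothFunctions 𝕂 m M] Cₛ^∞⟮𝓡 m; 𝕂, L⟯) ≃ₗ[SmoothFunctions 𝕂 m M]
      CanonicalLine (SmoothFunctions 𝕂 m M) Cₛ^∞⟮𝓡 m; F, A⟯ (Module.finrank 𝕂 F) m) :
    ∃ hs : Function.Bijective (starMap (R := SmoothFunctions 𝕂 m M) (Γ := Cₛ^∞⟮𝓡 m; F, A⟯)
        (N := Cₛ^∞⟮𝓡 m; 𝕂, L⟯) (Module.finrank 𝕂 F)),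
      ∃ E E', (∀ E₁, IsDualRootAction 𝒜.toSkewAlgebroid q E₁ ↔ E₁ = E) ∧
        (∀ E₁, IsRootAction (𝒜.dualOf Λ) q E₁ ↔ E₁ = E') ∧
        ∀ a, dirac 𝒜.toSkewAlgebroid (𝒜.dualOf Λ) hs E E'
          (dirac 𝒜.toSkewAlgebroid (𝒜.dualOf Λ) hs E E' a) = 0 :=
  mainTheorem8_general 𝒜 Λ hΛ q
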